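/- **Model.** The CoMP user $U_0$ is at the origin of $\mathbb R^2$. The base stations $x_1,x_2,\dots$, ordered by increasing distance to the origin, form a homogeneous Poisson point process of density $\lambda_c>0$. Base station $\mathrm{BS}_j$ has $K\ge 1$ users at positions $x_j+y_{j,k}$, $1\le k\le K$, where the $y_{j,k}$ are i.i.d. uniform in the disk of radius $\mathcal R_c>0$ centred at $0$. The path loss is $L(r)=r^4$ (i.e. $\alpha=4$). All channel coefficients $h_{\mathrm{BS}_i,U_0}$, $h_{\mathrm{BS}_i,U_{j,k}}$ are independent Rayleigh, with $|h|^2$ exponential of mean $1$; base stations, offsets $y_{j,k}$ and channels are mutually independent. Cluster $j$ selects the user $k_j^*$ that maximises $|h_{\mathrm{BS}_j,U_{j,k}}|^2/L(\|y_{j,k}\|)$. Let $\phi>0$ be the ratio of the transmission power of the CoMP user to that of a NOMA user, $\rho>0$ the normalised NOMA transmit signal-to-noise ratio (including the path loss constant), and let $\epsilon_0=2^{\tilde R_0}-1$, $\epsilon_1=2^{\tilde R_1}-1$ for the fixed target rates $\tilde R_0,\tilde R_1>0$ of the CoMP user and of the NOMA user of $\mathrm{BS}_1$. Put $$I=\sum_{j\ge2}\frac{|h_{\mathrm{BS}_1,U_{j,k_j^*}}|^2}{\|y_{j,k_j^*}+x_j-x_1\|^{4}}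 .$$ In the nearest N-NOMA scheme $\mathrm{BS}_1$ first decodes its NOMA user and then, after removing that user's signal, the CoMP user. The CoMP user's outage probability $\mathrm P_0^{\mathrm{nearest}}$ is the probability that not both $$\frac{|h_{\mathrm{BS}_1,U_{1,k_1^*}}|^2\,\|y_{1,k_1^*}\|^{-4}}{\phi|h_{\mathrm{BS}_1,U_0}|^2\|x_1\|^{-4}+I+1/\rho}\ge\epsilon_1\quad\text{and}\quad \frac{\phi|h_{\mathrm{BS}_1,U_0}|^2\|x_1\|^{-4}}{I+1/\rho}\ge\epsilon_0$$ hold. Let $\hat{\mathrm P}_0^{\mathrm{nearest}}$ be the same probability when, in $I$, the offset $y_{j,k_j^*}$ of each interfering user from its base station is neglected (replaced by $0$). **Formula.** For $N\ge1$ and $1\le n\le N$ let $\theta_n=\cos\frac{(2n-1)\pi}{2N}$, $w_n=\frac{\pi}{2N}\sqrt{1-\theta_n^2}\,(\theta_n+1)$, $c_n=\left(\frac{\mathcal R_c}{2}\theta_n+\frac{\mathcal R_c}{2}\right)^4$; $\tilde w_0=1$, $\tilde c_0=0$, and $\tilde w_n=-w_n$, $\tilde c_n=c_n$ for $n\ge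 1$. For natural numbers $k_0,\dots,k_N$ let $\mu=\sum_n k_n\tilde c_n$ and $\xi(d)=\epsilon_1\mu+\epsilon_0(\phi\epsilon_1\mu+d^4)/\phi$. Put, with $\alpha=4$ and $B$ the beta function, $$\begin{aligned}F_N=1&+\sum_{\substack{k_0+\cdots+k_N=K\\k_0\ne K}}\binom{K}{k_0,\dots,k_N}\prod_{n:\,k_n\ne0}\tilde w_n^{k_n}e^{-k_n\tilde c_n\epsilon_1/\rho}\\ &\times\int_0^\infty\exp\!\Big(-2\pi\lambda_c\tfrac{\xi(d)^{2/\alpha}}{\alpha}B\big(\tfrac2\alpha,\tfrac{\alpha-2}\alpha\big)+\tfrac12\pi\lambda_c\sqrt{\xi(d)}\arctan\sqrt{-\tfrac12+\tfrac12\sqrt{1+\tfrac{16d^4}{\xi(d)}}}\Big)\\ &\qquad\times\frac{2\pi\lambda_cd^5}{\phi\epsilon_1\mu+d^4}\exp\!\Big(-\frac{\epsilon_0(\phi\epsilon_1\mu+d^4)}{\phi\rho}-\lambda_c\pi d^2\Big)\,\mathrm dd .\end{aligned}$$ **Proposition 2.** The CoMP user's outage probability $\mathrm P_0^{\mathrm{nearest}}$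 is approximated by $F_N$, in the following sense. All the integrals in $F_N$ converge absolutely; $F_N\to\hat{\mathrm P}_0^{\mathrm{nearest}}$ as $N\to\infty$; and there is a constant $C$ depending only on $K$ such that, for all $\lambda_c,\mathcal R_c,\phi,\rho,\tilde R_0,\tilde R_1>0$, $$\big|\mathrm P_0^{\mathrm{nearest}}-\hat{\mathrm P}_0^{\mathrm{nearest}}\big|\le C\,\mathcal R_c\sqrt{\lambda_c}.$$ -/

import Mathlib

open Filter Topology MeasureTheory ProbabilityTheory
open scoped ENNReal NNReal

noncomputable section

namespace NNOMA

/-- The plane with its Euclidean norm. -/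
abbrev Plane : Type := EuclideanSpace ℝ (Fin 2)

/-- The path loss `L(r) = r ^ 4` (path loss exponent `4`). -/
def pathLoss (r : ℝ) : ℝ := r ^ 4

/-- The channel power gain `|h|² / L(r)` of a link with fading coefficient `h` and length `r`. -/
def gain (h : ℂ) (r : ℝ) : ℝ≥0∞ := ‖h‖ₑ ^ 2 / ENNReal.ofReal (pathLoss r)

section Model

variable {Ω : Type*} [MeasurableSpace Ω]

/-- The number of points of the random sequence `x` in the set `B`. -/
def count (x : ℕ → Ω → Plane) (B : Set Plane) (ω : Ω) : ℕ∞ := {i : ℕ | x i ω ∈ B}.encard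

/-- `x` enumerates a homogeneous Poisson point process of density `lam` in the plane: the number of
points in a Borel set `B` of finite area is Poisson distributed with mean `lam * area B`, and the
numbers of points in pairwise disjoint Borel sets are independent. -/
structure IsHPPP (x : ℕ → Ω → Plane) (lam : ℝ) (P : Measure Ω) : Prop where
  measurable : ∀ i, Measurable (x i)
  poisson : ∀ B : Set Plane, MeasurableSet B → volume B ≠ ∞ → ∀ n : ℕ,
    P {ω | count x B ω = n} = poissonMeasure (lam * (volume B).toReal).toNNReal {n}
  indep : ∀ (m : ℕ) (B : Fin m → Set Plane), (∀ j, MeasurableSet (B j)) →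
    Pairwise (fun j l => Disjoint (B j) (B l)) → iIndepFun (fun j => count x (B j)) P

/-- The network on a probability space `(Ω, P)`.  Base stations are indexed by `ℕ` in the order of
their distance to the CoMP user, who is at the origin, so base station `0` is the nearest one.
The pairs `(j, k)` index the NOMA users: user `k` of cluster `j`. -/
structure Network (K : ℕ) (lam Rc : ℝ) (P : Measure Ω) where
  /-- Location of base station `i`. -/
  x : ℕ → Ω → Plane
  /-- Location of user `k` of cluster `j` relative to base station `j`. -/
  y : ℕ → Fin K → Ω → Plane
  /-- `h i none` is the fading coefficient between base station `i` and the CoMP user, and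
  `h i (some (j, k))` the one between base station `i` and user `k` of cluster `j`. -/
  h : ℕ → Option (ℕ × Fin K) → Ω → ℂ
  /-- The user of cluster `j` that is selected. -/
  kstar : ℕ → Ω → Fin K
  hppp : IsHPPP x lam P
  ordered : ∀ᵐ ω ∂P, Monotone fun i => ‖x i ω‖
  y_measurable : ∀ j k, Measurable (y j k)
  /-- The users of a cluster are uniformly distributed in a disk of radius `Rc`. -/
  y_uniform : ∀ j k, pdf.IsUniform (y j k) (Metric.closedBall 0 Rc) P volume
  y_indep : iIndepFun (fun p : ℕ × Fin K => y p.1 p.2) P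
  h_measurable : ∀ i u, Measurable (h i u)
  /-- Rayleigh fading: `|h|²` is exponentially distributed with mean `1`. -/
  h_rayleigh : ∀ i u, P.map (fun ω => ‖h i u ω‖ ^ 2) = expMeasure 1
  h_indep : iIndepFun (fun p : ℕ × Option (ℕ × Fin K) => h p.1 p.2) P
  /-- Base stations, users' relative locations and fading are mutually independent: this field
  together with `y_h_indep`. -/
  x_indep : IndepFun (fun ω i => x i ω)
    (fun ω => ((fun (p : ℕ × Fin K) => y p.1 p.2 ω),
      (fun (p : ℕ × Option (ℕ × Fin K)) => h p.1 p.2 ω))) P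
  y_h_indep : IndepFun (fun ω (p : ℕ × Fin K) => y p.1 p.2 ω)
    (fun ω (p : ℕ × Option (ℕ × Fin K)) => h p.1 p.2 ω) P
  kstar_measurable : ∀ j, Measurable (kstar j)
  /-- In each cluster a user with the largest composite channel gain is selected. -/
  kstar_max : ∀ᵐ ω ∂P, ∀ j k, gain (h j (some (j, k)) ω) ‖y j k ω‖ ≤
    gain (h j (some (j, kstar j ω)) ω) ‖y j (kstar j ω) ω‖

namespace Network

variable {K : ℕ} {lam Rc : ℝ} {P : Measure Ω} (M : Network K lam Rc P)

/-- The location of the selected NOMA user of cluster `j`. -/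
def userPos (j : ℕ) (ω : Ω) : Plane := M.y j (M.kstar j ω) ω + M.x j ω

/-- The inter-cell interference at the nearest base station from the selected users of all the
other clusters, when these transmit from the positions `u j`. -/
def interference (u : ℕ → Ω → Plane) (ω : Ω) : ℝ≥0∞ :=
  ∑' j : {j : ℕ // j ≠ 0},
    gain (M.h 0 (some (j.1, M.kstar j.1 ω)) ω) ‖u j.1 ω - M.x 0 ω‖

/-- The received power of the CoMP user at the nearest base station (normalised). -/
def compPower (φ : ℝ) (ω : Ω) : ℝ≥0∞ := ENNReal.ofReal φ * gain (M.h 0 none ω) ‖M.x 0 ω‖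

/-- SINR with which the nearest base station decodes its NOMA user, the CoMP user's signal
being treated as interference. -/
def sinrNOMA (φ ρ : ℝ) (u : ℕ → Ω → Plane) (ω : Ω) : ℝ≥0∞ :=
  gain (M.h 0 (some (0, M.kstar 0 ω)) ω) ‖M.y 0 (M.kstar 0 ω) ω‖ /
    (M.compPower φ ω + M.interference u ω + ENNReal.ofReal (1 / ρ))

/-- SINR with which the CoMP user is decoded at the nearest base station once the signal of its
NOMA user has been removed. -/
def sinrCoMP (φ ρ : ℝ) (u : ℕ → Ω → Plane) (ω : Ω) : ℝ≥0∞ :=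
  M.compPower φ ω / (M.interference u ω + ENNReal.ofReal (1 / ρ))

/-- The CoMP user is in outage unless the NOMA user is decoded (threshold `ε₁`) and then the
CoMP user is decoded (threshold `ε₀`); this is the probability of outage when the interfering
users transmit from the positions `u j`. -/
def outageWith (φ ρ ε₀ ε₁ : ℝ) (u : ℕ → Ω → Plane) : ℝ :=
  P.real {ω | ¬ (ENNReal.ofReal ε₁ ≤ M.sinrNOMA φ ρ u ω ∧
    ENNReal.ofReal ε₀ ≤ M.sinrCoMP φ ρ u ω)}

/-- The outage probability of the CoMP user in the nearest N-NOMA scheme. -/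
def outage (φ ρ ε₀ ε₁ : ℝ) : ℝ := M.outageWith φ ρ ε₀ ε₁ M.userPos

/-- The same when the offset between each interfering user and its base station is neglected. -/
def outageNoOffset (φ ρ ε₀ ε₁ : ℝ) : ℝ := M.outageWith φ ρ ε₀ ε₁ M.x

end Network

end Model

section Formula

/-- Chebyshev nodes `θ_n = cos ((2n-1)π/(2N))`. -/
def theta (N n : ℕ) : ℝ := Real.cos ((2 * (n : ℝ) - 1) / (2 * (N : ℝ)) * Real.pi)

/-- `w_n = π/(2N) √(1-θ_n²) (θ_n+1)`. -/
def weight (N n : ℕ) : ℝ :=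
  Real.pi / (2 * (N : ℝ)) * Real.sqrt (1 - theta N n ^ 2) * (theta N n + 1)

/-- `c_n = (Rc θ_n/2 + Rc/2)⁴`. -/
def node (Rc : ℝ) (N n : ℕ) : ℝ := (Rc / 2 * theta N n + Rc / 2) ^ 4

/-- `w̃_0 = 1` and `w̃_n = -w_n` for `1 ≤ n ≤ N`. -/
def weightT (N : ℕ) (n : Fin (N + 1)) : ℝ := if n = 0 then 1 else -weight N n

/-- `c̃_0 = 0` and `c̃_n = c_n` for `1 ≤ n ≤ N`. -/
def nodeT (Rc : ℝ) (N : ℕ) (n : Fin (N + 1)) : ℝ := if n = 0 then 0 else node Rc N n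

/-- The tuples `(k_0, …, k_N)` of natural numbers with sum `K` and `k_0 ≠ K`. -/
def tuples (K N : ℕ) : Finset (Fin (N + 1) → ℕ) :=
  (Finset.piAntidiag Finset.univ K).filter fun k => k 0 ≠ K

/-- `μ = ∑ k_n c̃_n`. -/
def muOf (Rc : ℝ) (N : ℕ) (k : Fin (N + 1) → ℕ) : ℝ :=
  ∑ n with k n ≠ 0, (k n : ℝ) * nodeT Rc N n

/-- `ξ(d) = ε₁ μ + ε₀ (φ ε₁ μ + d⁴) / φ`. -/
def xi (φ ε₀ ε₁ μ d : ℝ) : ℝ := ε₁ * μ + ε₀ * (φ * ε₁ * μ + d ^ 4) / φ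

/-- The integrand of the single integral over the distance `d` of the nearest base station. -/
def integrand (lam φ ρ ε₀ ε₁ μ d : ℝ) : ℝ :=
  Real.exp
      (-(2 * Real.pi * lam * (xi φ ε₀ ε₁ μ d ^ (2 / 4 : ℝ) / 4) * beta (2 / 4) ((4 - 2) / 4))
        + 1 / 2 * Real.pi * lam * Real.sqrt (xi φ ε₀ ε₁ μ d) *
          Real.arctan (Real.sqrt (-(1 / 2) +
            1 / 2 * Real.sqrt (1 + 16 * d ^ 4 / xi φ ε₀ ε₁ μ d)))) *
    (2 * Real.pi * lam * d ^ 5 / (φ * ε₁ * μ + d ^ 4)) *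
    Real.exp (-(ε₀ * (φ * ε₁ * μ + d ^ 4) / (φ * ρ)) - lam * Real.pi * d ^ 2)

/-- The single-integral expression with `N` Chebyshev nodes. -/
def outageFormula (K : ℕ) (lam Rc φ ρ ε₀ ε₁ : ℝ) (N : ℕ) : ℝ :=
  1 + ∑ k ∈ tuples K N,
    (Nat.multinomial Finset.univ k : ℝ) *
      (∏ n with k n ≠ 0,
        weightT N n ^ k n * Real.exp (-((k n : ℝ) * nodeT Rc N n * ε₁ * (1 / ρ)))) *
      ∫ d in Set.Ioi (0 : ℝ), integrand lam φ ρ ε₀ ε₁ (muOf Rc N k) d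

end Formula

end NNOMA

end

/-! Exact part. Without offsets, the only ingredient that is not integrated in closed form is the
law of the best gain in the nearest cluster. Given everything outside that cluster, its NOMA user
fails exactly when K independent composite gains all lie below a threshold T, which has probability
(1 - G(T))^K with G(t) = E exp(-t‖y‖⁴) and y uniform in the disk (`measure_forall_cellGain_lt`,
`measure_decoded`). In the angle variable, r = Rc(1 + cos t)/2, the Chebyshev rule is a midpoint
rule, so S_N(T) = ∑ w̃_n exp(-c̃_n T) tends to 1 - G(T) pointwise and is bounded uniformly in N.
Expanding S_N(T)^K by the multinomial theorem leaves expectations of exp(-μT) on the event that the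
CoMP user passes its own threshold, and each of these is exactly one of the integrals in F_N. Hence
F_N is, for every N, the outage formula with 1 - G replaced by S_N
(`integral_one_sub_chebyshevSum_pow`), and its limit follows by dominated convergence.

Evaluating E[exp(-μT); CoMP decoded]. Integrating out the CoMP user's exponential fading gives
d⁴/(φε₁μ + d⁴) · exp(-ξ(d)(I + 1/ρ)), where d is the distance of the nearest base station
(`lintegral_power_ge`). Integrating out the interferers' fading turns exp(-ξI) into the product of
r_j⁴/(ξ + r_j⁴), that is, exp of minus a sum over the other points (`lintegral_expNeg_interf`). What
remains is a joint Laplace functional of the nearest point and of the rest of the Poisson process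
(`IsHPPP.nearest_formula`). It comes from a Mecke formula with an infinite penalty on points closer
to the origin than the distinguished one; the Mecke formula is obtained by differentiating the
Laplace functional, which in turn follows from the independent Poisson counts. The exponent is πd²
plus the integral of ξ/(ξ + ‖z - a‖⁴) outside the disk of radius d = ‖a‖, and the arctangent is the
integral over the disk itself (`lintegral_disk`).

Offsets. Restoring the offsets changes each interfering distance by at most Rc, hence the
interference by a factor at most 1 + 8δ, where δ is the largest ratio Rc/‖x_j - x_0‖, provided δ <
1/8. A decoding decision can change only if an exponential variable falls in an interval [b, (1 +
8δ)b), which has probability at most 8δ whatever b is (`expMeasure_Ico_le`). So the error is at most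
a multiple of the mean of δ truncated at 1/8, and the tail bound P(δ > t) ≤ π² lam Rc²/t² makes that
mean of order Rc√lam (`lintegral_distortion_le`). -/

noncomputable section

namespace NNOMA

/-! ### The function `exp (-t)` on `[0, ∞]` -/

/-- `exp (-t)` for `t ∈ [0, ∞]`. -/
def expNeg (t : ℝ≥0∞) : ℝ≥0∞ := EReal.exp (-(t : EReal))

lemma expNeg_zero : expNeg 0 = 1 := by simp [expNeg]

lemma expNeg_top : expNeg ∞ = 0 := by simp [expNeg]

lemma expNeg_add (a b : ℝ≥0∞) : expNeg (a + b) = expNeg a * expNeg b := by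
  unfold expNeg
  rw [← EReal.exp_add, EReal.coe_ennreal_add, EReal.neg_add] <;> simp [sub_eq_add_neg]

lemma expNeg_ofReal {a : ℝ} (ha : 0 ≤ a) :
    expNeg (ENNReal.ofReal a) = ENNReal.ofReal (Real.exp (-a)) := by
  unfold expNeg
  rw [EReal.coe_ennreal_ofReal, max_eq_left ha, ← EReal.coe_neg, EReal.exp_coe]

lemma continuous_expNeg : Continuous expNeg :=
  ENNReal.continuous_exp.comp (continuous_neg.comp continuous_coe_ennreal_ereal)

lemma measurable_expNeg : Measurable expNeg := continuous_expNeg.measurable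

@[fun_prop]
lemma _root_.Measurable.expNeg {α : Type*} [MeasurableSpace α] {f : α → ℝ≥0∞} (hf : Measurable f) :
    Measurable fun a => expNeg (f a) := measurable_expNeg.comp hf

lemma antitone_expNeg : Antitone expNeg := fun _ _ h =>
  EReal.exp_monotone (EReal.neg_le_neg_iff.2 (EReal.coe_ennreal_le_coe_ennreal_iff.2 h))

lemma expNeg_le_one (a : ℝ≥0∞) : expNeg a ≤ 1 := expNeg_zero ▸ antitone_expNeg (zero_le)

lemma expNeg_ne_top (a : ℝ≥0∞) : expNeg a ≠ ∞ := ((expNeg_le_one a).trans_lt ENNReal.one_lt_top).ne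

lemma expNeg_ne_zero {a : ℝ≥0∞} (ha : a ≠ ∞) : expNeg a ≠ 0 := by
  simp [expNeg, ha]

lemma expNeg_finset_sum {ι : Type*} (s : Finset ι) (f : ι → ℝ≥0∞) :
    expNeg (∑ i ∈ s, f i) = ∏ i ∈ s, expNeg (f i) := by
  classical
  induction s using Finset.induction_on with
  | empty => simp [expNeg_zero]
  | insert i s hi ih => rw [Finset.sum_insert hi, Finset.prod_insert hi, expNeg_add, ih]

lemma expNeg_natCast_mul (n : ℕ) (a : ℝ≥0∞) : expNeg (n * a) = expNeg a ^ n := by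
  induction n with
  | zero => simp [expNeg_zero]
  | succ n ih => rw [Nat.cast_succ, add_mul, one_mul, expNeg_add, ih, pow_succ]

lemma one_sub_expNeg_le (a : ℝ≥0∞) : 1 - expNeg a ≤ a := by
  rcases eq_or_ne a ∞ with rfl | ha
  · exact le_top
  · lift a to ℝ≥0 using ha
    rw [← ENNReal.ofReal_coe_nnreal, expNeg_ofReal a.coe_nonneg, ← ENNReal.ofReal_one,
      ← ENNReal.ofReal_sub _ (Real.exp_pos _).le]
    refine ENNReal.ofReal_le_ofReal ?_
    have := Real.add_one_le_exp (-(a : ℝ))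
    linarith

lemma mul_expNeg_le (a : ℝ≥0∞) : a * expNeg a ≤ 1 - expNeg a := by
  rcases eq_or_ne a ∞ with rfl | ha
  · simp [expNeg_top]
  · lift a to ℝ≥0 using ha
    rw [← ENNReal.ofReal_coe_nnreal, expNeg_ofReal a.coe_nonneg, ← ENNReal.ofReal_one,
      ← ENNReal.ofReal_sub _ (Real.exp_pos _).le, ← ENNReal.ofReal_mul a.coe_nonneg]
    refine ENNReal.ofReal_le_ofReal ?_
    have h := Real.add_one_le_exp (a : ℝ)
    have h2 : Real.exp (a : ℝ) * Real.exp (-(a : ℝ)) = 1 := by rw [← Real.exp_add]; simp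
    nlinarith [Real.exp_pos (-(a : ℝ))]

/-- With x = exp(-a) this is 1 - x² ≤ 2(1 - x). It is the single step behind the monotonicity of the
dyadic difference quotients. -/
lemma one_sub_expNeg_double_le (a : ℝ≥0∞) : 1 - expNeg (2 * a) ≤ 2 * (1 - expNeg a) := by
  rcases eq_or_ne a ∞ with rfl | ha
  · simp [expNeg_top]
  · have h2 : (2 : ℝ≥0∞) * a = a + a := two_mul a
    rw [h2, expNeg_add]
    have h1 := expNeg_le_one a
    obtain ⟨x, hx⟩ : ∃ x : ℝ≥0, (x : ℝ≥0∞) = expNeg a := ⟨_, ENNReal.coe_toNNReal (expNeg_ne_top a)⟩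
    rw [← hx] at h1 ⊢
    have h1' : x ≤ 1 := by exact_mod_cast h1
    norm_cast
    have e1 : 1 - x * x ≤ 2 * (1 - x) := by
      rw [← NNReal.coe_le_coe, NNReal.coe_sub (by nlinarith), NNReal.coe_mul, NNReal.coe_mul,
        NNReal.coe_sub h1']
      push_cast
      nlinarith [sq_nonneg (1 - (x : ℝ))]
    exact_mod_cast e1

/-- Difference quotients of `exp (-t s)` at `t = 0` increase to `s` as `t = 2⁻ᵏ` decreases. -/
lemma monotone_dyadic_quotient (s : ℝ≥0∞) :
    Monotone fun k : ℕ => (2 : ℝ≥0∞) ^ k * (1 - expNeg (((2 : ℝ≥0∞) ^ k)⁻¹ * s)) := by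
  refine monotone_nat_of_le_succ fun k => ?_
  have h : ((2 : ℝ≥0∞) ^ k)⁻¹ * s = 2 * (((2 : ℝ≥0∞) ^ (k + 1))⁻¹ * s) := by
    rw [pow_succ, ENNReal.mul_inv (by simp) (by simp), mul_comm ((2 : ℝ≥0∞) ^ k)⁻¹ 2⁻¹, ← mul_assoc,
      ← mul_assoc, ENNReal.mul_inv_cancel (by simp) (by simp), one_mul]
  calc (2 : ℝ≥0∞) ^ k * (1 - expNeg (((2 : ℝ≥0∞) ^ k)⁻¹ * s))
      ≤ (2 : ℝ≥0∞) ^ k * (2 * (1 - expNeg (((2 : ℝ≥0∞) ^ (k + 1))⁻¹ * s))) := by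
        rw [h]; gcongr; exact one_sub_expNeg_double_le _
    _ = _ := by rw [pow_succ, mul_assoc]

lemma dyadic_quotient_le (s : ℝ≥0∞) (k : ℕ) :
    (2 : ℝ≥0∞) ^ k * (1 - expNeg (((2 : ℝ≥0∞) ^ k)⁻¹ * s)) ≤ s := by
  calc (2 : ℝ≥0∞) ^ k * (1 - expNeg (((2 : ℝ≥0∞) ^ k)⁻¹ * s))
      ≤ (2 : ℝ≥0∞) ^ k * (((2 : ℝ≥0∞) ^ k)⁻¹ * s) := by gcongr; exact one_sub_expNeg_le _
    _ = s := by rw [← mul_assoc, ENNReal.mul_inv_cancel (by simp) (by simp), one_mul]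

lemma tendsto_two_pow_inv_mul {s : ℝ≥0∞} (hs : s ≠ ∞) :
    Tendsto (fun k : ℕ => ((2 : ℝ≥0∞) ^ k)⁻¹ * s) atTop (𝓝 0) := by
  have h : Tendsto (fun k : ℕ => ((2 : ℝ≥0∞)⁻¹) ^ k) atTop (𝓝 0) :=
    ENNReal.tendsto_pow_atTop_nhds_zero_of_lt_one (by simp)
  have := ENNReal.Tendsto.mul_const h (Or.inr hs)
  simpa [ENNReal.inv_pow] using this

/-- For finite s the quotient is squeezed between s exp(-s/2ᵏ) and s; for s = ∞ it is 2ᵏ itself.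
Infinite s has to be allowed, because sums over the point process may diverge. -/
lemma tendsto_dyadic_quotient (s : ℝ≥0∞) :
    Tendsto (fun k : ℕ => (2 : ℝ≥0∞) ^ k * (1 - expNeg (((2 : ℝ≥0∞) ^ k)⁻¹ * s)))
      atTop (𝓝 s) := by
  rcases eq_or_ne s ∞ with rfl | hs
  · have : ∀ k : ℕ, ((2 : ℝ≥0∞) ^ k)⁻¹ * ∞ = ∞ := fun k => ENNReal.mul_top (by simp)
    simp only [this, expNeg_top, tsub_zero, mul_one]
    exact ENNReal.tendsto_pow_atTop_nhds_top_iff.2 (by simp)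
  · refine tendsto_of_tendsto_of_tendsto_of_le_of_le (g := fun k : ℕ =>
      s * expNeg (((2 : ℝ≥0∞) ^ k)⁻¹ * s)) (h := fun _ => s) ?_ tendsto_const_nhds ?_
      (fun k => dyadic_quotient_le s k)
    · have h := (continuous_expNeg.tendsto 0).comp (tendsto_two_pow_inv_mul hs)
      rw [expNeg_zero] at h
      simpa using ENNReal.Tendsto.const_mul h (Or.inr hs)
    · intro k
      calc s * expNeg (((2 : ℝ≥0∞) ^ k)⁻¹ * s)
          = (2 : ℝ≥0∞) ^ k * ((((2 : ℝ≥0∞) ^ k)⁻¹ * s) * expNeg (((2 : ℝ≥0∞) ^ k)⁻¹ * s)) := by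
            rw [← mul_assoc, ← mul_assoc, ENNReal.mul_inv_cancel (by simp) (by simp), one_mul]
        _ ≤ (2 : ℝ≥0∞) ^ k * (1 - expNeg (((2 : ℝ≥0∞) ^ k)⁻¹ * s)) :=
            mul_le_mul_right (mul_expNeg_le _) _

/-! ### The Laplace functional of a Poisson point process -/

/-- The generating function, summed as an exponential series; z = exp(-a) yields the Laplace
transform of a Poisson count. -/
lemma lintegral_pow_poissonMeasure (r : ℝ≥0) {z : ℝ≥0∞} (hz : z ≤ 1) :
    ∫⁻ n, z ^ n ∂(poissonMeasure r) = expNeg (r * (1 - z)) := by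
  have hzt : z ≠ ∞ := (hz.trans_lt ENNReal.one_lt_top).ne
  lift z to ℝ≥0 using hzt
  have hz' : z ≤ 1 := by exact_mod_cast hz
  have hz'' : (z : ℝ) ≤ 1 := by exact_mod_cast hz'
  have hs : HasSum (fun n : ℕ => Real.exp (-r) * r ^ n / (n.factorial : ℝ) * (z : ℝ) ^ n)
      (Real.exp (-(r * (1 - z)))) := by
    have h := (NormedSpace.expSeries_div_hasSum_exp (𝔸 := ℝ) ((r : ℝ) * z)).mul_left
      (Real.exp (-r))
    rw [← Real.exp_eq_exp_ℝ, ← Real.exp_add] at h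
    convert! h using 2
    · rw [mul_pow]; ring
    · ring
  have e : (r : ℝ≥0∞) * (1 - z) = ENNReal.ofReal (r * (1 - z)) := by
    rw [ENNReal.ofReal_mul r.coe_nonneg, ENNReal.ofReal_coe_nnreal, ENNReal.ofReal_sub _ z.coe_nonneg]
    simp
  rw [e, expNeg_ofReal (mul_nonneg r.coe_nonneg (by linarith)), ← hs.tsum_eq,
    ENNReal.ofReal_tsum_of_nonneg (fun n => by positivity) hs.summable, poissonMeasure,
    lintegral_sum_measure]
  refine tsum_congr fun n => ?_
  rw [lintegral_smul_measure, lintegral_dirac, smul_eq_mul, ENNReal.ofReal_mul (by positivity),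
    ENNReal.ofReal_pow z.coe_nonneg, ENNReal.ofReal_coe_nnreal]

/-- Monotone convergence for the counting measure. -/
lemma tendsto_tsum_of_monotone {ι : Type*} {f : ℕ → ι → ℝ≥0∞} {g : ι → ℝ≥0∞}
    (hf : ∀ i, Monotone fun n => f n i) (hg : ∀ i, Tendsto (fun n => f n i) atTop (𝓝 (g i))) :
    Tendsto (fun n => ∑' i, f n i) atTop (𝓝 (∑' i, g i)) := by
  let _ : MeasurableSpace ι := ⊤
  simp_rw [← lintegral_count]
  exact lintegral_tendsto_of_tendsto_of_monotone (fun n => measurable_from_top.aemeasurable)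
    (Eventually.of_forall hf) (Eventually.of_forall hg)

lemma tsum_indicator_eq_count {Ω : Type*} (x : ℕ → Ω → Plane) (B : Set Plane) (ω : Ω) :
    ∑' j, B.indicator (1 : Plane → ℝ≥0∞) (x j ω) = (count x B ω : ℝ≥0∞) := by
  rw [count, ← ENNReal.tsum_set_one, tsum_subtype {i | x i ω ∈ B} (fun _ => (1 : ℝ≥0∞))]
  rfl

section PoissonProcess

variable {Ω : Type*} [MeasurableSpace Ω] {P : Measure Ω} {x : ℕ → Ω → Plane} {lam : ℝ}

lemma IsHPPP.measurable_count (hx : IsHPPP x lam P) {B : Set Plane} (hB : MeasurableSet B) :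
    Measurable (count x B) := by
  have h1 : Measurable fun ω => (count x B ω : ℝ≥0∞) := by
    simp_rw [← tsum_indicator_eq_count]
    exact Measurable.tsum fun j => (measurable_one.indicator hB).comp (hx.measurable j)
  refine measurable_to_countable' fun n => ?_
  have : count x B ⁻¹' {n} = (fun ω => (count x B ω : ℝ≥0∞)) ⁻¹' {(n : ℝ≥0∞)} := by
    ext ω; simp
  rw [this]
  exact h1 (measurableSet_singleton _)

/-- The model prescribes only the probabilities of finite counts. Since these already add up to 1,
the value ⊤ has probability 0 and the two laws on `ℕ∞` agree. -/
lemma IsHPPP.map_count [IsProbabilityMeasure P] (hx : IsHPPP x lam P) {B : Set Plane}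
    (hB : MeasurableSet B) (hB' : volume B ≠ ∞) :
    P.map (count x B) =
      (poissonMeasure (lam * (volume B).toReal).toNNReal).map (Nat.cast : ℕ → ℕ∞) := by
  have hm := hx.measurable_count hB
  set r := (lam * (volume B).toReal).toNNReal
  have hc : Measurable (Nat.cast : ℕ → ℕ∞) := measurable_from_top
  have : IsProbabilityMeasure (P.map (count x B)) := Measure.isProbabilityMeasure_map hm.aemeasurable
  have : IsProbabilityMeasure ((poissonMeasure r).map (Nat.cast : ℕ → ℕ∞)) :=
    Measure.isProbabilityMeasure_map hc.aemeasurable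
  have h1 : ∀ n : ℕ, P.map (count x B) {(n : ℕ∞)} = poissonMeasure r {n} := fun n => by
    rw [Measure.map_apply hm (measurableSet_singleton _)]
    exact hx.poisson B hB hB' n
  have h2 : ∀ n : ℕ, (poissonMeasure r).map (Nat.cast : ℕ → ℕ∞) {(n : ℕ∞)} = poissonMeasure r {n} :=
    fun n => by
      rw [Measure.map_apply hc (measurableSet_singleton _)]
      congr 1; ext m; simp
  have htop : ({⊤} : Set ℕ∞) = (Set.range (Nat.cast : ℕ → ℕ∞))ᶜ := by
    ext n; induction n using ENat.recTopCoe <;> simp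
  have key : ∀ μ : Measure ℕ∞, IsProbabilityMeasure μ →
      (∀ n : ℕ, μ {(n : ℕ∞)} = poissonMeasure r {n}) → μ {⊤} = 0 := by
    intro μ _ hμ
    rw [htop, prob_compl_eq_zero_iff (by trivial), ← Set.iUnion_singleton_eq_range,
      measure_iUnion (fun i j hij => by simpa using hij) (fun _ => measurableSet_singleton _)]
    simp_rw [hμ]
    rw [← measure_iUnion (fun i j hij => by simpa using hij) (fun _ => measurableSet_singleton _),
      Set.iUnion_of_singleton, measure_univ]
  refine Measure.ext_of_singleton fun n => ?_
  induction n using ENat.recTopCoe with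
  | top => rw [key _ inferInstance h1, key _ inferInstance h2]
  | coe n => rw [h1, h2]

lemma IsHPPP.ae_count_ne_top [IsProbabilityMeasure P] (hx : IsHPPP x lam P) {B : Set Plane}
    (hB : MeasurableSet B) (hB' : volume B ≠ ∞) : ∀ᵐ ω ∂P, count x B ω ≠ ⊤ := by
  have hm := hx.measurable_count hB
  have h : ∀ᵐ n ∂(P.map (count x B)), n ≠ ⊤ := by
    rw [hx.map_count hB hB', ae_map_iff measurable_from_top.aemeasurable (by trivial)]
    exact Eventually.of_forall fun n => by simp
  exact ae_of_ae_map hm.aemeasurable h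

lemma IsHPPP.lintegral_expNeg_mul_count [IsProbabilityMeasure P] (hx : IsHPPP x lam P) (hlam : 0 ≤ lam)
    {B : Set Plane} (hB : MeasurableSet B) (hB' : volume B ≠ ∞) (a : ℝ≥0∞) :
    ∫⁻ ω, expNeg (a * (count x B ω : ℝ≥0∞)) ∂P =
      expNeg (ENNReal.ofReal lam * ((1 - expNeg a) * volume B)) := by
  have hm := hx.measurable_count hB
  have h := lintegral_map (μ := P) (f := fun n : ℕ∞ => expNeg (a * (n : ℝ≥0∞)))
    measurable_from_top hm
  rw [← h, hx.map_count hB hB', lintegral_map measurable_from_top measurable_from_top]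
  simp only [ENat.toENNReal_coe, mul_comm a, expNeg_natCast_mul]
  rw [lintegral_pow_poissonMeasure _ (expNeg_le_one a), ← ENNReal.ofReal_coe_nnreal,
    Real.coe_toNNReal _ (by positivity), ENNReal.ofReal_mul hlam, ENNReal.ofReal_toReal hB',
    mul_comm (1 - expNeg a), mul_assoc]

lemma simpleFunc_eq_sum (φ : SimpleFunc Plane ℝ≥0∞) (y : Plane) :
    φ y = ∑ a ∈ φ.range with a ≠ 0, a * (φ ⁻¹' {a}).indicator (1 : Plane → ℝ≥0∞) y := by
  classical
  by_cases h : φ y = 0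
  · rw [h, Finset.sum_eq_zero]
    intro a ha
    have : φ y ≠ a := by rw [h]; exact (Finset.mem_filter.1 ha).2.symm
    simp [Set.indicator, this]
  · rw [Finset.sum_eq_single (φ y)]
    · simp [Set.indicator]
    · intro a _ ha
      simp [Set.indicator, ha.symm]
    · intro hn
      exact absurd (Finset.mem_filter.2 ⟨φ.mem_range_self y, h⟩) hn

lemma one_sub_expNeg_simpleFunc (φ : SimpleFunc Plane ℝ≥0∞) (y : Plane) :
    1 - expNeg (φ y) = ∑ a ∈ φ.range with a ≠ 0,
      (1 - expNeg a) * (φ ⁻¹' {a}).indicator (1 : Plane → ℝ≥0∞) y := by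
  classical
  by_cases h : φ y = 0
  · rw [h, Finset.sum_eq_zero]
    · simp [expNeg_zero]
    intro a ha
    have : φ y ≠ a := by rw [h]; exact (Finset.mem_filter.1 ha).2.symm
    simp [Set.indicator, this]
  · rw [Finset.sum_eq_single (φ y)]
    · simp [Set.indicator]
    · intro a _ ha
      simp [Set.indicator, ha.symm]
    · intro hn
      exact absurd (Finset.mem_filter.2 ⟨φ.mem_range_self y, h⟩) hn

/-- The level sets of φ are disjoint, so their counts are independent and the exponential of the sum
factorises into Laplace transforms of Poisson variables. The level 0 contributes nothing and is left
out, since its area may be infinite. -/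
lemma IsHPPP.laplace_simpleFunc [IsProbabilityMeasure P] (hx : IsHPPP x lam P) (hlam : 0 ≤ lam)
    (φ : SimpleFunc Plane ℝ≥0∞) (hφ : ∀ a ≠ 0, volume (φ ⁻¹' {a}) ≠ ∞) :
    ∫⁻ ω, expNeg (∑' j, φ (x j ω)) ∂P =
      expNeg (ENNReal.ofReal lam * ∫⁻ y, (1 - expNeg (φ y))) := by
  classical
  set S : Finset ℝ≥0∞ := φ.range.filter (fun a => a ≠ 0) with hS
  have hmS : ∀ a, MeasurableSet (φ ⁻¹' {a}) := fun a => φ.measurableSet_fiber a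
  have h1 : ∀ ω, expNeg (∑' j, φ (x j ω)) =
      ∏ a : S, expNeg (a.1 * (count x (φ ⁻¹' {a.1}) ω : ℝ≥0∞)) := by
    intro ω
    rw [← expNeg_finset_sum]
    congr 1
    simp_rw [simpleFunc_eq_sum φ, ← hS]
    rw [Summable.tsum_finsetSum (fun _ _ => ENNReal.summable), ← Finset.sum_coe_sort]
    simp_rw [ENNReal.tsum_mul_left, tsum_indicator_eq_count]
  have hind : iIndepFun (fun (a : S) => count x (φ ⁻¹' {a.1})) P := by
    have h := hx.indep S.card (fun j => φ ⁻¹' {(S.equivFin.symm j).1}) (fun j => hmS _) (by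
      intro i j hij
      refine Disjoint.preimage _ (Set.disjoint_singleton.2 fun h => hij ?_)
      exact S.equivFin.symm.injective (Subtype.ext h))
    have := iIndepFun.precomp (g := S.equivFin) S.equivFin.injective h
    simpa [Function.comp_def] using this
  have hind2 : iIndepFun (fun (a : S) ω => expNeg (a.1 * (count x (φ ⁻¹' {a.1}) ω : ℝ≥0∞))) P :=
    hind.comp (fun (a : S) (n : ℕ∞) => expNeg (a.1 * (n : ℝ≥0∞))) fun _ => measurable_from_top
  simp_rw [h1]
  rw [lintegral_prod_eq_prod_lintegral_of_indepFun _ _ hind2 (fun a =>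
    (measurable_from_top (f := fun n : ℕ∞ => expNeg (a.1 * (n : ℝ≥0∞)))).comp
      (hx.measurable_count (hmS a.1)))]
  have h2 : ∀ a : S, ∫⁻ ω, expNeg (a.1 * (count x (φ ⁻¹' {a.1}) ω : ℝ≥0∞)) ∂P =
      expNeg (ENNReal.ofReal lam * ((1 - expNeg a.1) * volume (φ ⁻¹' {a.1}))) := fun a =>
    hx.lintegral_expNeg_mul_count hlam (hmS a.1) (hφ a.1 (Finset.mem_filter.1 a.2).2) a.1
  simp_rw [h2]
  rw [← expNeg_finset_sum, ← Finset.mul_sum]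
  congr 2
  simp_rw [one_sub_expNeg_simpleFunc φ, ← hS]
  rw [lintegral_finsetSum _ (fun a _ => (measurable_one.indicator (hmS a)).const_mul _),
    ← Finset.sum_coe_sort S]
  refine Finset.sum_congr rfl fun (a : S) _ => ?_
  rw [lintegral_const_mul _ (measurable_one.indicator (hmS a.1)), lintegral_indicator_one (hmS a.1)]

/-- The Laplace functional of a homogeneous Poisson point process. -/
lemma IsHPPP.laplace [IsProbabilityMeasure P] (hx : IsHPPP x lam P) (hlam : 0 ≤ lam)
    {u : Plane → ℝ≥0∞} (hu : Measurable u) :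
    ∫⁻ ω, expNeg (∑' j, u (x j ω)) ∂P =
      expNeg (ENNReal.ofReal lam * ∫⁻ y, (1 - expNeg (u y))) := by
  let B : ℕ → Set Plane := fun n => Metric.ball 0 n
  have hB : ∀ n, MeasurableSet (B n) := fun n => measurableSet_ball
  -- Restriction to growing balls gives the nonzero level sets finite area and keeps the
  -- approximation increasing. The left side then converges by domination by 1, the exponent on the
  -- right by monotone convergence.
  let φ : ℕ → SimpleFunc Plane ℝ≥0∞ := fun n => (SimpleFunc.eapprox u n).restrict (B n)
  have hφ : ∀ n y, φ n y = (B n).indicator (SimpleFunc.eapprox u n) y := fun n y => by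
    rw [SimpleFunc.restrict_apply _ (hB n)]
  have hmono : ∀ y, Monotone fun n => φ n y := by
    intro y m n hmn
    simp only [hφ]
    refine (Set.indicator_le_indicator_of_subset (Metric.ball_subset_ball (Nat.cast_le.2 hmn))
      (fun _ => zero_le) y).trans ?_
    exact Set.indicator_le_indicator (SimpleFunc.monotone_eapprox u hmn y)
  have hlim : ∀ y, Tendsto (fun n => φ n y) atTop (𝓝 (u y)) := by
    intro y
    refine (SimpleFunc.tendsto_eapprox hu y).congr' ?_
    obtain ⟨m, hm⟩ := exists_nat_gt ‖y‖
    filter_upwards [eventually_ge_atTop m] with n hn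
    rw [hφ, Set.indicator_of_mem]
    simp only [B, mem_ball_zero_iff]
    exact hm.trans_le (by exact_mod_cast hn)
  have hL : ∀ n, ∫⁻ ω, expNeg (∑' j, φ n (x j ω)) ∂P =
      expNeg (ENNReal.ofReal lam * ∫⁻ y, (1 - expNeg (φ n y))) := fun n =>
    hx.laplace_simpleFunc hlam (φ n) fun a ha => by
      refine ne_top_of_le_ne_top (measure_ball_lt_top (μ := volume) (x := (0 : Plane)) (r := n)).ne
        (measure_mono fun y hy => ?_)
      by_contra hn
      exact ha (by rw [← show φ n y = a from hy, hφ, Set.indicator_of_notMem hn])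
  have hl : Tendsto (fun n => ∫⁻ ω, expNeg (∑' j, φ n (x j ω)) ∂P) atTop
      (𝓝 (∫⁻ ω, expNeg (∑' j, u (x j ω)) ∂P)) := by
    refine tendsto_lintegral_of_dominated_convergence (fun _ => 1) (fun n => ?_)
      (fun n => Eventually.of_forall fun ω => expNeg_le_one _) (by simp)
      (Eventually.of_forall fun ω => ?_)
    · exact measurable_expNeg.comp
        (Measurable.tsum fun j => (φ n).measurable.comp (hx.measurable j))
    · refine (continuous_expNeg.tendsto _).comp ?_
      exact tendsto_tsum_of_monotone (fun j => hmono (x j ω)) (fun j => hlim (x j ω))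
  have hr : Tendsto (fun n => expNeg (ENNReal.ofReal lam * ∫⁻ y, (1 - expNeg (φ n y)))) atTop
      (𝓝 (expNeg (ENNReal.ofReal lam * ∫⁻ y, (1 - expNeg (u y))))) := by
    refine (continuous_expNeg.tendsto _).comp (ENNReal.Tendsto.const_mul ?_ (Or.inr (by simp)))
    refine lintegral_tendsto_of_tendsto_of_monotone (fun n =>
      (measurable_const.sub (measurable_expNeg.comp (φ n).measurable)).aemeasurable)
      (Eventually.of_forall fun y m n hmn => tsub_le_tsub_left (antitone_expNeg (hmono y hmn)) _)
      (Eventually.of_forall fun y => ?_)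
    exact ENNReal.Tendsto.sub tendsto_const_nhds ((continuous_expNeg.tendsto _).comp (hlim y))
      (Or.inl (by simp))
  exact tendsto_nhds_unique hl (by simpa only [hL] using hr)

end PoissonProcess

/-! ### The Mecke formula -/

section Mecke

variable {Ω : Type*} [MeasurableSpace Ω] {P : Measure Ω} {x : ℕ → Ω → Plane} {lam : ℝ}

lemma one_sub_expNeg_add (a b : ℝ≥0∞) :
    1 - expNeg (a + b) = (1 - expNeg a) + expNeg a * (1 - expNeg b) := by
  rw [expNeg_add, ENNReal.mul_sub (fun _ _ => expNeg_ne_top a), mul_one,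
    tsub_add_tsub_cancel (expNeg_le_one a) (mul_le_of_le_one_right' (expNeg_le_one b))]

lemma IsHPPP.measurable_tsum (hx : IsHPPP x lam P) {u : Plane → ℝ≥0∞} (hu : Measurable u) :
    Measurable fun ω => ∑' i, u (x i ω) :=
  Measurable.tsum fun i => hu.comp (hx.measurable i)

lemma IsHPPP.measurable_tsum_ite (hx : IsHPPP x lam P) {u : Plane → ℝ≥0∞} (hu : Measurable u)
    (j : ℕ) : Measurable fun ω => ∑' i, if i = j then 0 else u (x i ω) :=
  Measurable.tsum fun i => by
    by_cases h : i = j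
    · simp [h]
    · simp only [h, if_false]
      exact hu.comp (hx.measurable i)

/-- This is the derivative at t = 0 of the Laplace functional of u + t f. Along t = 2⁻ᵏ the
difference quotients increase, so monotone convergence moves the limit inside both the expectation
and the plane integral. Finiteness of ∫ f exp(-u) makes the increment of the exponent tend to 0. -/
lemma IsHPPP.mecke_all [IsProbabilityMeasure P] (hx : IsHPPP x lam P) (hlam : 0 ≤ lam)
    {f u : Plane → ℝ≥0∞} (hf : Measurable f) (hu : Measurable u)
    (hfu : ∫⁻ y, f y * expNeg (u y) ≠ ∞) :
    ∫⁻ ω, (∑' j, f (x j ω)) * expNeg (∑' i, u (x i ω)) ∂P =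
      ENNReal.ofReal lam * (∫⁻ y, f y * expNeg (u y)) *
        expNeg (ENNReal.ofReal lam * ∫⁻ y, (1 - expNeg (u y))) := by
  set l := ENNReal.ofReal lam with hl
  have hl' : l ≠ ∞ := ENNReal.ofReal_ne_top
  set L := expNeg (l * ∫⁻ y, (1 - expNeg (u y))) with hL
  have hLt : L ≠ ∞ := expNeg_ne_top _
  set c := ∫⁻ y, f y * expNeg (u y) with hc
  let t : ℕ → ℝ≥0∞ := fun k => ((2 : ℝ≥0∞) ^ k)⁻¹
  -- The increment of the Laplace exponent from u to u + t f, by the identity `one_sub_expNeg_add`.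
  let ck : ℕ → ℝ≥0∞ := fun k => ∫⁻ y, expNeg (u y) * (1 - expNeg (t k * f y))
  have hmS := hx.measurable_tsum hf
  have hmU := hx.measurable_tsum hu
  have hmeS : ∀ k, Measurable fun ω => expNeg (t k * ∑' j, f (x j ω)) := fun k =>
    measurable_expNeg.comp (hmS.const_mul _)
  have hmef : ∀ k, Measurable fun y => expNeg (u y) * (1 - expNeg (t k * f y)) := fun k =>
    (measurable_expNeg.comp hu).mul (measurable_const.sub (measurable_expNeg.comp (hf.const_mul _)))
  have h1 : ∀ k, ∫⁻ ω, (2 : ℝ≥0∞) ^ k * (1 - expNeg (t k * ∑' j, f (x j ω))) *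
      expNeg (∑' i, u (x i ω)) ∂P = (2 : ℝ≥0∞) ^ k * (1 - expNeg (l * ck k)) * L := by
    intro k
    have e1 : ∀ ω, expNeg (t k * ∑' j, f (x j ω)) * expNeg (∑' i, u (x i ω)) =
        expNeg (∑' j, (u (x j ω) + t k * f (x j ω))) := by
      intro ω
      rw [ENNReal.tsum_add, ENNReal.tsum_mul_left, expNeg_add, mul_comm]
    have e2 : ∫⁻ ω, expNeg (t k * ∑' j, f (x j ω)) * expNeg (∑' i, u (x i ω)) ∂P =
        expNeg (l * ck k) * L := by
      simp_rw [e1]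
      rw [hx.laplace hlam (u := fun y => u y + t k * f y) (hu.add (hf.const_mul _))]
      simp_rw [one_sub_expNeg_add]
      rw [lintegral_add_right _ (hmef k), mul_add, expNeg_add, mul_comm]
    have e3 : ∫⁻ ω, expNeg (∑' i, u (x i ω)) ∂P = L := hx.laplace hlam hu
    simp_rw [mul_assoc]
    rw [lintegral_const_mul _ (by fun_prop)]
    congr 1
    simp_rw [ENNReal.sub_mul (fun _ _ => expNeg_ne_top _), one_mul]
    rw [lintegral_sub (by fun_prop) (e2 ▸ ENNReal.mul_ne_top (expNeg_ne_top _) hLt)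
      (Eventually.of_forall fun ω => mul_le_of_le_one_left' (expNeg_le_one _)), e2, e3]
    rw [ENNReal.sub_mul (fun _ _ => hLt), one_mul]
  have h2 : Tendsto (fun k => ∫⁻ ω, (2 : ℝ≥0∞) ^ k * (1 - expNeg (t k * ∑' j, f (x j ω))) *
      expNeg (∑' i, u (x i ω)) ∂P) atTop
      (𝓝 (∫⁻ ω, (∑' j, f (x j ω)) * expNeg (∑' i, u (x i ω)) ∂P)) := by
    refine lintegral_tendsto_of_tendsto_of_monotone (fun k => (((measurable_const.sub
      (hmeS k)).const_mul _).mul (measurable_expNeg.comp hmU)).aemeasurable)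
      (Eventually.of_forall fun ω m n hmn => ?_) (Eventually.of_forall fun ω => ?_)
    · exact mul_le_mul_left (monotone_dyadic_quotient _ hmn) _
    · exact ENNReal.Tendsto.mul_const (tendsto_dyadic_quotient _) (Or.inr (expNeg_ne_top _))
  have hck : Tendsto (fun k => (2 : ℝ≥0∞) ^ k * ck k) atTop (𝓝 c) := by
    have : ∀ k, (2 : ℝ≥0∞) ^ k * ck k =
        ∫⁻ y, ((2 : ℝ≥0∞) ^ k * (1 - expNeg (t k * f y))) * expNeg (u y) := fun k => by
      rw [← lintegral_const_mul _ (hmef k)]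
      refine lintegral_congr fun y => ?_
      ring
    simp_rw [this]
    refine lintegral_tendsto_of_tendsto_of_monotone (fun k => (((measurable_const.sub
      (measurable_expNeg.comp (hf.const_mul _))).const_mul _).mul
        (measurable_expNeg.comp hu)).aemeasurable)
      (Eventually.of_forall fun ω m n hmn => ?_) (Eventually.of_forall fun ω => ?_)
    · exact mul_le_mul_left (monotone_dyadic_quotient _ hmn) _
    · exact ENNReal.Tendsto.mul_const (tendsto_dyadic_quotient _) (Or.inr (expNeg_ne_top _))
  have hck0 : Tendsto ck atTop (𝓝 0) := by
    refine tendsto_of_tendsto_of_tendsto_of_le_of_le tendsto_const_nhds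
      (tendsto_two_pow_inv_mul hfu) (fun _ => zero_le) fun k => ?_
    rw [hc, ← lintegral_const_mul _ (by fun_prop)]
    refine lintegral_mono fun y => ?_
    calc expNeg (u y) * (1 - expNeg (t k * f y)) ≤ expNeg (u y) * (t k * f y) := by
          gcongr; exact one_sub_expNeg_le _
      _ = _ := by ring
  -- Squeeze 1 - exp(-v) between v exp(-v) and v for v = l · ck k, which tends to 0.
  have h3 : Tendsto (fun k => (2 : ℝ≥0∞) ^ k * (1 - expNeg (l * ck k))) atTop (𝓝 (l * c)) := by
    have hup : Tendsto (fun k => l * ((2 : ℝ≥0∞) ^ k * ck k)) atTop (𝓝 (l * c)) :=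
      ENNReal.Tendsto.const_mul hck (Or.inr hl')
    have hlo : Tendsto (fun k => l * ((2 : ℝ≥0∞) ^ k * ck k) * expNeg (l * ck k)) atTop
        (𝓝 (l * c)) := by
      have h0 : Tendsto (fun k => expNeg (l * ck k)) atTop (𝓝 1) := by
        have := (continuous_expNeg.tendsto _).comp (ENNReal.Tendsto.const_mul hck0 (Or.inr hl'))
        rwa [mul_zero, expNeg_zero] at this
      have := ENNReal.Tendsto.mul hup (Or.inr ENNReal.one_ne_top) h0
        (Or.inr (ENNReal.mul_ne_top hl' hfu))
      rwa [mul_one] at this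
    refine tendsto_of_tendsto_of_tendsto_of_le_of_le hlo hup (fun k => ?_) (fun k => ?_)
    · calc l * ((2 : ℝ≥0∞) ^ k * ck k) * expNeg (l * ck k)
          = (2 : ℝ≥0∞) ^ k * ((l * ck k) * expNeg (l * ck k)) := by ring
        _ ≤ (2 : ℝ≥0∞) ^ k * (1 - expNeg (l * ck k)) := mul_le_mul_right (mul_expNeg_le _) _
    · calc (2 : ℝ≥0∞) ^ k * (1 - expNeg (l * ck k)) ≤ (2 : ℝ≥0∞) ^ k * (l * ck k) :=
            mul_le_mul_right (one_sub_expNeg_le _) _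
        _ = l * ((2 : ℝ≥0∞) ^ k * ck k) := by ring
  refine tendsto_nhds_unique h2 ?_
  simp_rw [h1]
  exact ENNReal.Tendsto.mul_const h3 (Or.inr hLt)

lemma IsHPPP.campbell [IsProbabilityMeasure P] (hx : IsHPPP x lam P) (hlam : 0 ≤ lam)
    {f : Plane → ℝ≥0∞} (hf : Measurable f) (hf' : ∫⁻ y, f y ≠ ∞) :
    ∫⁻ ω, ∑' j, f (x j ω) ∂P = ENNReal.ofReal lam * ∫⁻ y, f y := by
  have := hx.mecke_all hlam hf (u := fun _ => 0) measurable_const (by simpa [expNeg_zero] using hf')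
  simpa [expNeg_zero] using this

/-- Dividing f by exp(-u) cancels the distinguished point's own factor. This needs u to be finite
only where f does not vanish; elsewhere u may be infinite, which is what the nearest-point penalty
requires. -/
lemma IsHPPP.mecke_fixed [IsProbabilityMeasure P] (hx : IsHPPP x lam P) (hlam : 0 ≤ lam)
    {f u : Plane → ℝ≥0∞} (hf : Measurable f) (hu : Measurable u) (hf' : ∫⁻ y, f y ≠ ∞)
    (hfu : ∀ y, f y ≠ 0 → u y ≠ ∞) :
    ∫⁻ ω, ∑' j, f (x j ω) * expNeg (∑' i, if i = j then 0 else u (x i ω)) ∂P =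
      ENNReal.ofReal lam * (∫⁻ y, f y) *
        expNeg (ENNReal.ofReal lam * ∫⁻ y, (1 - expNeg (u y))) := by
  have hcancel : ∀ y, f y / expNeg (u y) * expNeg (u y) = f y := by
    intro y
    by_cases h : f y = 0
    · simp [h]
    · exact ENNReal.div_mul_cancel (expNeg_ne_zero (hfu y h)) (expNeg_ne_top _)
  have h := hx.mecke_all hlam (f := fun y => f y / expNeg (u y)) (u := u)
    (hf.div (measurable_expNeg.comp hu)) hu (by simpa only [hcancel] using hf')
  simp only [hcancel] at h
  rw [← h]
  refine lintegral_congr fun ω => ?_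
  rw [← ENNReal.tsum_mul_right]
  refine tsum_congr fun j => ?_
  rw [ENNReal.summable.tsum_eq_add_tsum_ite' (f := fun i => u (x i ω)) j, expNeg_add, ← mul_assoc,
    hcancel]

/-- The penalty may now depend on the distinguished point through a countable label: split f along
the fibres of q and apply `IsHPPP.mecke_fixed` on each. -/
lemma IsHPPP.mecke_countable [IsProbabilityMeasure P] (hx : IsHPPP x lam P) (hlam : 0 ≤ lam)
    {ι : Type*} [Countable ι] [MeasurableSpace ι] [MeasurableSingletonClass ι]
    {q : Plane → ι} (hq : Measurable q) {f : Plane → ℝ≥0∞} (hf : Measurable f)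
    (hf' : ∫⁻ y, f y ≠ ∞) {u : ι → Plane → ℝ≥0∞} (hu : ∀ c, Measurable (u c))
    (hfu : ∀ y, f y ≠ 0 → u (q y) y ≠ ∞) :
    ∫⁻ ω, ∑' j, f (x j ω) * expNeg (∑' i, if i = j then 0 else u (q (x j ω)) (x i ω)) ∂P =
      ENNReal.ofReal lam * ∫⁻ y, f y *
        expNeg (ENNReal.ofReal lam * ∫⁻ z, (1 - expNeg (u (q y) z))) := by
  classical
  have hms : ∀ c, MeasurableSet (q ⁻¹' {c}) := fun c => hq (measurableSet_singleton c)
  let fc : ι → Plane → ℝ≥0∞ := fun c => (q ⁻¹' {c}).indicator f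
  have hfc : ∀ c, Measurable (fc c) := fun c => hf.indicator (hms c)
  have hdec : ∀ (y : Plane) (g : ι → ℝ≥0∞), f y * g (q y) = ∑' c, fc c y * g c := by
    intro y g
    rw [tsum_eq_single (q y)]
    · simp [fc]
    · intro c hc
      have : y ∉ q ⁻¹' {c} := fun h => hc (Set.mem_singleton_iff.1 h).symm
      simp [fc, this]
  have hfin : ∀ c, ∫⁻ y, fc c y ≠ ∞ := fun c =>
    ne_top_of_le_ne_top hf' (lintegral_mono fun y => Set.indicator_le_self _ _ _)
  have hfix := fun c => hx.mecke_fixed hlam (hfc c) (hu c) (hfin c) (fun y hy => by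
    have hmem : y ∈ q ⁻¹' {c} := by
      by_contra hn
      exact hy (Set.indicator_of_notMem hn _)
    have hy' : f y ≠ 0 := by simpa [fc, Set.indicator_of_mem hmem] using hy
    have := hfu y hy'
    rwa [Set.mem_singleton_iff.1 hmem] at this)
  have e1 : ∀ ω, ∑' j, f (x j ω) * expNeg (∑' i, if i = j then 0 else u (q (x j ω)) (x i ω)) =
      ∑' c, ∑' j, fc c (x j ω) * expNeg (∑' i, if i = j then 0 else u c (x i ω)) := by
    intro ω
    rw [ENNReal.tsum_comm]
    exact tsum_congr fun j => hdec (x j ω) fun c =>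
      expNeg (∑' i, if i = j then 0 else u c (x i ω))
  simp_rw [e1]
  have hm : ∀ c, Measurable fun ω => ∑' j, fc c (x j ω) *
      expNeg (∑' i, if i = j then 0 else u c (x i ω)) := fun c =>
    Measurable.tsum fun j => ((hfc c).comp (hx.measurable j)).mul
      (hx.measurable_tsum_ite (hu c) j).expNeg
  rw [lintegral_tsum fun c => (hm c).aemeasurable]
  simp_rw [hfix]
  have e2 := fun y => hdec y fun c => expNeg (ENNReal.ofReal lam * ∫⁻ z, (1 - expNeg (u c z)))
  simp_rw [e2]
  rw [lintegral_tsum fun c => ((hfc c).mul_const _).aemeasurable, ← ENNReal.tsum_mul_left]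
  refine tsum_congr fun c => ?_
  rw [lintegral_mul_const _ (hfc c), mul_assoc]

end Mecke

/-! ### The nearest point of a Poisson point process and the other points -/

section Nearest

variable {Ω : Type*} [MeasurableSpace Ω] {P : Measure Ω} {x : ℕ → Ω → Plane} {lam : ℝ}

lemma IsHPPP.ae_finite_ball [IsProbabilityMeasure P] (hx : IsHPPP x lam P) (m : ℝ) :
    ∀ᵐ ω ∂P, {i | x i ω ∈ Metric.ball (0 : Plane) m}.Finite := by
  filter_upwards [hx.ae_count_ne_top measurableSet_ball
    (measure_ball_lt_top (μ := volume) (x := (0 : Plane)) (r := m)).ne] with ω hω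
  exact Set.encard_ne_top_iff.1 hω

lemma lintegral_ne_top_of_supported_ball {f : Plane → ℝ≥0∞} {m : ℝ} (hf1 : ∀ y, f y ≤ 1)
    (hfm : ∀ y ∉ Metric.ball (0 : Plane) m, f y = 0) : ∫⁻ y, f y ≠ ∞ := by
  have h : ∀ y, f y ≤ (Metric.ball (0 : Plane) m).indicator 1 y := by
    intro y
    by_cases hy : y ∈ Metric.ball (0 : Plane) m
    · simpa [hy] using hf1 y
    · simp [hfm y hy]
  refine ne_top_of_le_ne_top ?_ (lintegral_mono h)
  rw [lintegral_indicator_one measurableSet_ball]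
  exact measure_ball_lt_top.ne

/-- Dominated convergence with bound ∑ f(x_j), whose mean is finite by Campbell's formula. As f
lives on a ball, almost surely only finitely many terms matter, so pointwise limits can be taken
term by term. -/
lemma IsHPPP.tendsto_lintegral_tsum_mul [IsProbabilityMeasure P] (hx : IsHPPP x lam P) (hlam : 0 ≤ lam)
    {f : Plane → ℝ≥0∞} {m : ℝ} (hf : Measurable f) (hf1 : ∀ y, f y ≤ 1)
    (hfm : ∀ y ∉ Metric.ball (0 : Plane) m, f y = 0) {g : ℕ → ℕ → Ω → ℝ≥0∞} {G : ℕ → Ω → ℝ≥0∞}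
    (hg : ∀ n j, Measurable (g n j)) (hg1 : ∀ n j ω, g n j ω ≤ 1)
    (hgG : ∀ᵐ ω ∂P, ∀ j, x j ω ∈ Metric.ball (0 : Plane) m →
      Tendsto (fun n => g n j ω) atTop (𝓝 (G j ω))) :
    Tendsto (fun n => ∫⁻ ω, ∑' j, f (x j ω) * g n j ω ∂P) atTop
      (𝓝 (∫⁻ ω, ∑' j, f (x j ω) * G j ω ∂P)) := by
  have hft := lintegral_ne_top_of_supported_ball hf1 hfm
  refine tendsto_lintegral_of_dominated_convergence (fun ω => ∑' j, f (x j ω))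
    (fun n => Measurable.tsum fun j => (hf.comp (hx.measurable j)).mul (hg n j))
    (fun n => Eventually.of_forall fun ω => ENNReal.tsum_le_tsum fun j =>
      mul_le_of_le_one_right' (hg1 n j ω)) ?_ ?_
  · rw [hx.campbell hlam hf hft]
    exact ENNReal.mul_ne_top ENNReal.ofReal_ne_top hft
  · filter_upwards [hx.ae_finite_ball m, hgG] with ω hfin hω
    have hz : ∀ (k : ℕ → ℝ≥0∞), ∑' j, f (x j ω) * k j = ∑ j ∈ hfin.toFinset, f (x j ω) * k j := by
      intro k
      refine tsum_eq_sum fun j hj => ?_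
      rw [hfm, zero_mul]
      simpa using hj
    rw [hz]
    simp_rw [fun n => hz fun j => g n j ω]
    refine tendsto_finsetSum _ fun j hj => ?_
    refine ENNReal.Tendsto.const_mul (hω j (by simpa using hj)) (Or.inr ?_)
    exact ((hf1 _).trans_lt ENNReal.one_lt_top).ne

/-- `∞` when `y` is closer to the origin than `x`, and `w` otherwise: adding it up over the points
of a process and applying `exp (-·)` forces `x` to be nearest to the origin. -/
def nearestPenalty (w : Plane → Plane → ℝ≥0∞) (x y : Plane) : ℝ≥0∞ :=
  (if ‖y‖ < ‖x‖ then ∞ else 0) + w x y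

lemma measurable_nearestPenalty {w : Plane → Plane → ℝ≥0∞} (hw : Measurable (Function.uncurry w)) :
    Measurable (Function.uncurry (nearestPenalty w)) := by
  unfold nearestPenalty Function.uncurry
  refine Measurable.add (Measurable.ite ?_ measurable_const measurable_const) hw
  exact measurableSet_lt (by fun_prop) (by fun_prop)

/-- The dependence of the penalty on the distinguished point is discretised to countably many
labels, `IsHPPP.mecke_countable` is applied, and the discretisation is refined. Continuity of w in
its first argument handles the w term; the discontinuous term with ∞ is handled by rounding the
norm. -/
lemma IsHPPP.mecke_bounded [IsProbabilityMeasure P] (hx : IsHPPP x lam P) (hlam : 0 ≤ lam)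
    {f : Plane → ℝ≥0∞} {m : ℝ} (hf : Measurable f) (hf1 : ∀ y, f y ≤ 1)
    (hfm : ∀ y ∉ Metric.ball (0 : Plane) m, f y = 0)
    {w : Plane → Plane → ℝ≥0∞} (hw : Measurable (Function.uncurry w))
    (hwc : ∀ y, Continuous fun a => w a y) (hwt : ∀ a y, w a y ≠ ∞)
    (hwm : ∀ a, ∀ y ∉ Metric.ball (0 : Plane) m, w a y = 0) :
    ∫⁻ ω, ∑' j, f (x j ω) *
        expNeg (∑' i, if i = j then 0 else nearestPenalty w (x j ω) (x i ω)) ∂P =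
      ENNReal.ofReal lam * ∫⁻ y, f y *
        expNeg (ENNReal.ofReal lam * ∫⁻ z, (1 - expNeg (nearestPenalty w y z))) := by
  let e : ℕ → Plane := TopologicalSpace.denseSeq Plane
  -- The norm is rounded down to a multiple of 1/n. Rounding down keeps a point's penalty on itself
  -- finite, creates no penalty where ‖y‖ ≥ ‖a‖, and still detects ‖y‖ < ‖a‖ for large n.
  let q : ℕ → Plane → ℕ × ℕ := fun n a => (SimpleFunc.nearestPtInd e n a, ⌊‖a‖ * n⌋₊)
  have hq : ∀ n, Measurable (q n) := fun n =>
    (SimpleFunc.nearestPtInd e n).measurable.prodMk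
      (Nat.measurable_floor.comp (by fun_prop))
  let u : ℕ → ℕ × ℕ → Plane → ℝ≥0∞ := fun n c y =>
    (if ‖y‖ < c.2 / n then ∞ else 0) + w (e c.1) y
  have hw' : ∀ a, Measurable (w a) := fun a => hw.comp measurable_prodMk_left
  have hu : ∀ n c, Measurable (u n c) := fun n c =>
    Measurable.add (Measurable.ite (measurableSet_lt (by fun_prop) (by fun_prop))
      measurable_const measurable_const) (hw' _)
  have hfloor : ∀ (n : ℕ) (a : Plane), (⌊‖a‖ * n⌋₊ : ℝ) / n ≤ ‖a‖ := by
    intro n a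
    rcases Nat.eq_zero_or_pos n with rfl | hn
    · simp
    · rw [div_le_iff₀ (by exact_mod_cast hn)]
      exact Nat.floor_le (by positivity)
  have hft := lintegral_ne_top_of_supported_ball hf1 hfm
  have hpt : ∀ a y, Tendsto (fun n => u n (q n a) y) atTop (𝓝 (nearestPenalty w a y)) := by
    intro a y
    refine Tendsto.add ?_ ?_
    · by_cases hy : ‖y‖ < ‖a‖
      · rw [if_pos hy]
        refine tendsto_const_nhds.congr' ?_
        have h := (tendsto_nat_floor_mul_div_atTop (R := ℝ) (norm_nonneg a)).comp
          tendsto_natCast_atTop_atTop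
        filter_upwards [h.eventually (lt_mem_nhds hy)] with n hn
        exact (if_pos hn).symm
      · rw [if_neg hy]
        refine tendsto_const_nhds.congr fun n => ?_
        exact (if_neg fun h => hy (h.trans_le (hfloor n a))).symm
    · exact ((hwc y).tendsto a).comp (SimpleFunc.tendsto_nearestPt
        (by rw [(TopologicalSpace.denseRange_denseSeq Plane).closure_range]; trivial))
  have hsupp : ∀ n, ∀ a ∈ Metric.ball (0 : Plane) m, ∀ y ∉ Metric.ball (0 : Plane) m,
      u n (q n a) y = 0 := by
    intro n a ha y hy
    have h1 : ¬ ‖y‖ < (⌊‖a‖ * n⌋₊ : ℝ) / n := fun h => hy (by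
      rw [mem_ball_zero_iff] at *
      exact (h.trans_le (hfloor n a)).trans ha)
    simp only [u, q, hwm _ y hy, add_zero, ite_eq_right_iff]
    exact fun h => absurd h h1
  have hut : ∀ n y, u n (q n y) y ≠ ∞ := fun n y => by
    simp only [u, q]
    rw [if_neg (not_lt.2 (hfloor n y)), zero_add]
    exact hwt _ _
  clear_value u q
  have hmeq := fun n => hx.mecke_countable hlam (hq n) hf hft (hu n) (fun y _ => hut n y)
  have hjm : ∀ n, Measurable fun p : (ℕ × ℕ) × Plane => u n p.1 p.2 := fun n =>
    measurable_from_prod_countable_right (hu n)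
  have hmg : ∀ n j, Measurable fun ω => expNeg
      (∑' i, if i = j then 0 else u n (q n (x j ω)) (x i ω)) := by
    intro n j
    refine Measurable.expNeg (Measurable.tsum fun i => ?_)
    by_cases h : i = j
    · simp [h]
    · simp only [h, if_false]
      exact (hjm n).comp (((hq n).comp (hx.measurable j)).prodMk (hx.measurable i))
  have hl := hx.tendsto_lintegral_tsum_mul hlam hf hf1 hfm hmg (fun _ _ _ => expNeg_le_one _)
    (G := fun j ω => expNeg (∑' i, if i = j then 0 else nearestPenalty w (x j ω) (x i ω))) (by
      filter_upwards [hx.ae_finite_ball m] with ω hfin j hj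
      refine (continuous_expNeg.tendsto _).comp ?_
      have hsupp' : ∀ y ∉ Metric.ball (0 : Plane) m, nearestPenalty w (x j ω) y = 0 := fun y hy =>
        tendsto_nhds_unique (hpt _ y) (by simp_rw [hsupp _ _ hj y hy]; exact tendsto_const_nhds)
      rw [tsum_eq_sum (s := hfin.toFinset) (fun i hi => by
        rw [hsupp' _ (by simpa using hi), ite_self])]
      have : ∀ n, ∑' i, (if i = j then 0 else u n (q n (x j ω)) (x i ω)) =
          ∑ i ∈ hfin.toFinset, (if i = j then 0 else u n (q n (x j ω)) (x i ω)) := fun n =>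
        tsum_eq_sum (fun i hi => by
          rw [hsupp _ _ hj _ (by simpa using hi), ite_self])
      simp_rw [this]
      refine tendsto_finsetSum _ fun i _ => ?_
      by_cases h : i = j
      · simp [h]
      · simpa [h] using hpt _ _)
  refine tendsto_nhds_unique hl ?_
  simp_rw [hmeq]
  refine ENNReal.Tendsto.const_mul ?_ (Or.inr ENNReal.ofReal_ne_top)
  refine tendsto_lintegral_of_dominated_convergence f (fun n => ?_)
    (fun n => Eventually.of_forall fun y => mul_le_of_le_one_right' (expNeg_le_one _)) hft
    (Eventually.of_forall fun y => ?_)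
  · refine hf.mul ?_
    exact (measurable_of_countable (fun c => expNeg (ENNReal.ofReal lam *
      ∫⁻ z, (1 - expNeg (u n c z))))).comp (hq n)
  · by_cases hy : y ∈ Metric.ball (0 : Plane) m
    · refine ENNReal.Tendsto.const_mul ?_ (Or.inr ((hf1 _).trans_lt ENNReal.one_lt_top).ne)
      refine (continuous_expNeg.tendsto _).comp
        (ENNReal.Tendsto.const_mul ?_ (Or.inr ENNReal.ofReal_ne_top))
      refine tendsto_lintegral_of_dominated_convergence ((Metric.ball (0 : Plane) m).indicator 1)
        (fun n => measurable_const.sub (hu n _).expNeg) (fun n => Eventually.of_forall fun z => ?_)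
        (by rw [lintegral_indicator_one measurableSet_ball]; exact measure_ball_lt_top.ne)
        (Eventually.of_forall fun z => ?_)
      · by_cases hz : z ∈ Metric.ball (0 : Plane) m
        · simp [hz]
        · simp [hsupp n y hy z hz, expNeg_zero]
      · exact ENNReal.Tendsto.sub tendsto_const_nhds ((continuous_expNeg.tendsto _).comp (hpt y z))
          (Or.inl (by simp))
    · simp [hfm y hy]

/-- A family of functions `w n` on pairs of points which increase to `W` and to which
`IsHPPP.mecke_bounded` applies. -/
structure PairApprox (w : ℕ → Plane → Plane → ℝ≥0∞) (W : Plane → Plane → ℝ≥0∞) : Prop where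
  measurable : ∀ n, Measurable (Function.uncurry (w n))
  continuous : ∀ n y, Continuous fun a => w n a y
  ne_top : ∀ n a y, w n a y ≠ ∞
  support : ∀ (n : ℕ) (a : Plane), ∀ y ∉ Metric.ball (0 : Plane) (n : ℝ), w n a y = 0
  mono : ∀ a y, Monotone fun n => w n a y
  tendsto : ∀ a y, Tendsto (fun n => w n a y) atTop (𝓝 (W a y))

lemma PairApprox.measurable_limit {w : ℕ → Plane → Plane → ℝ≥0∞} {W : Plane → Plane → ℝ≥0∞}
    (h : PairApprox w W) : Measurable (Function.uncurry W) :=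
  measurable_of_tendsto_metrizable h.measurable
    (tendsto_pi_nhds.2 fun p => h.tendsto p.1 p.2)

lemma IsHPPP.measurable_tsum_pair (hx : IsHPPP x lam P) {w : Plane → Plane → ℝ≥0∞}
    (hw : Measurable (Function.uncurry w)) (j : ℕ) :
    Measurable fun ω => ∑' i, if i = j then 0 else w (x j ω) (x i ω) :=
  Measurable.tsum fun i => by
    by_cases h : i = j
    · simp [h]
    · simp only [h, if_false]
      exact hw.comp ((hx.measurable j).prodMk (hx.measurable i))

/-- Two limits remove the truncations: for f cut off to a ball, w n increases to W; then the ball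
exhausts the plane. -/
lemma IsHPPP.mecke_nearest [IsProbabilityMeasure P] (hx : IsHPPP x lam P) (hlam : 0 ≤ lam)
    {f : Plane → ℝ≥0∞} (hf : Measurable f) (hf1 : ∀ y, f y ≤ 1)
    {w : ℕ → Plane → Plane → ℝ≥0∞} {W : Plane → Plane → ℝ≥0∞} (h : PairApprox w W) :
    ∫⁻ ω, ∑' j, f (x j ω) *
        expNeg (∑' i, if i = j then 0 else nearestPenalty W (x j ω) (x i ω)) ∂P =
      ENNReal.ofReal lam * ∫⁻ y, f y *
        expNeg (ENNReal.ofReal lam * ∫⁻ z, (1 - expNeg (nearestPenalty W y z))) := by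
  have hvm : ∀ n, Measurable (Function.uncurry (nearestPenalty (w n))) := fun n =>
    measurable_nearestPenalty (h.measurable n)
  have hVm : Measurable (Function.uncurry (nearestPenalty W)) :=
    measurable_nearestPenalty h.measurable_limit
  have hvmono : ∀ a y, Monotone fun n => nearestPenalty (w n) a y := fun a y m n hmn =>
    add_le_add_right (h.mono a y hmn) _
  have hvlim : ∀ a y, Tendsto (fun n => nearestPenalty (w n) a y) atTop
      (𝓝 (nearestPenalty W a y)) := fun a y => tendsto_const_nhds.add (h.tendsto a y)
  have hm1 : ∀ {w : Plane → Plane → ℝ≥0∞}, Measurable (Function.uncurry w) →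
      Measurable fun y => expNeg (ENNReal.ofReal lam * ∫⁻ z, (1 - expNeg (w y z))) := by
    intro w hw
    have : Measurable fun p : Plane × Plane => 1 - expNeg (w p.1 p.2) :=
      measurable_const.sub hw.expNeg
    exact (this.lintegral_prod_right'.const_mul _).expNeg
  let fN : ℕ → Plane → ℝ≥0∞ := fun N => (Metric.ball (0 : Plane) N).indicator f
  have hfN : ∀ N, Measurable (fN N) := fun N => hf.indicator measurableSet_ball
  have hfN1 : ∀ N y, fN N y ≤ 1 := fun N y => (Set.indicator_le_self _ _ _).trans (hf1 y)
  have hfmono : ∀ y, Monotone fun N => fN N y := fun y m n hmn =>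
    Set.indicator_le_indicator_of_subset (Metric.ball_subset_ball (Nat.cast_le.2 hmn))
      (fun _ => zero_le) y
  have hflim : ∀ y, Tendsto (fun N => fN N y) atTop (𝓝 (f y)) := by
    intro y
    refine tendsto_const_nhds.congr' ?_
    obtain ⟨m, hm⟩ := exists_nat_gt ‖y‖
    filter_upwards [eventually_ge_atTop m] with n hn
    refine (Set.indicator_of_mem ?_ _).symm
    rw [mem_ball_zero_iff]
    exact hm.trans_le (by exact_mod_cast hn)
  have hN : ∀ N, ∫⁻ ω, ∑' j, fN N (x j ω) *
        expNeg (∑' i, if i = j then 0 else nearestPenalty W (x j ω) (x i ω)) ∂P =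
      ENNReal.ofReal lam * ∫⁻ y, fN N y *
        expNeg (ENNReal.ofReal lam * ∫⁻ z, (1 - expNeg (nearestPenalty W y z))) := by
    intro N
    have hsupp : ∀ y ∉ Metric.ball (0 : Plane) N, fN N y = 0 := fun y hy =>
      Set.indicator_of_notMem hy _
    have hft := lintegral_ne_top_of_supported_ball (hfN1 N) hsupp
    have hb : ∀ n, ∫⁻ ω, ∑' j, fN N (x j ω) *
          expNeg (∑' i, if i = j then 0 else nearestPenalty (w n) (x j ω) (x i ω)) ∂P =
        ENNReal.ofReal lam * ∫⁻ y, fN N y *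
          expNeg (ENNReal.ofReal lam * ∫⁻ z, (1 - expNeg (nearestPenalty (w n) y z))) := fun n =>
      -- A common ball is needed that supports both the cut-off f and w n.
      hx.mecke_bounded hlam (m := max N n) (hfN N) (hfN1 N)
        (fun y hy => hsupp y fun hy' => hy (Metric.ball_subset_ball (le_max_left _ _) hy'))
        (h.measurable n) (h.continuous n) (h.ne_top n)
        (fun a y hy => h.support n a y fun hy' =>
          hy (Metric.ball_subset_ball (le_max_right _ _) hy'))
    have hl := hx.tendsto_lintegral_tsum_mul hlam (hfN N) (hfN1 N) hsupp
      (fun n j => (hx.measurable_tsum_pair (hvm n) j).expNeg) (fun _ _ _ => expNeg_le_one _)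
      (G := fun j ω => expNeg (∑' i, if i = j then 0 else nearestPenalty W (x j ω) (x i ω)))
      (Eventually.of_forall fun ω j _ => by
        refine (continuous_expNeg.tendsto _).comp (tendsto_tsum_of_monotone (fun i => ?_)
          (fun i => ?_))
        · by_cases hij : i = j
          · simp [hij, monotone_const]
          · simpa [hij] using hvmono _ _
        · by_cases hij : i = j
          · simp [hij]
          · simpa [hij] using hvlim _ _)
    refine tendsto_nhds_unique hl ?_
    simp_rw [hb]
    refine ENNReal.Tendsto.const_mul ?_ (Or.inr ENNReal.ofReal_ne_top)
    refine tendsto_lintegral_of_dominated_convergence (fN N) (fun n => (hfN N).mul (hm1 (hvm n)))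
      (fun n => Eventually.of_forall fun y => mul_le_of_le_one_right' (expNeg_le_one _)) hft
      (Eventually.of_forall fun y => ?_)
    refine ENNReal.Tendsto.const_mul ?_ (Or.inr ((hfN1 N _).trans_lt ENNReal.one_lt_top).ne)
    refine (continuous_expNeg.tendsto _).comp
      (ENNReal.Tendsto.const_mul ?_ (Or.inr ENNReal.ofReal_ne_top))
    refine lintegral_tendsto_of_tendsto_of_monotone (fun n => (measurable_const.sub
      ((hvm n).comp measurable_prodMk_left).expNeg).aemeasurable)
      (Eventually.of_forall fun z m n hmn => tsub_le_tsub_left (antitone_expNeg (hvmono y z hmn)) _)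
      (Eventually.of_forall fun z => ?_)
    exact ENNReal.Tendsto.sub tendsto_const_nhds
      ((continuous_expNeg.tendsto _).comp (hvlim y z)) (Or.inl (by simp))
  have hl : Tendsto (fun N => ∫⁻ ω, ∑' j, fN N (x j ω) *
        expNeg (∑' i, if i = j then 0 else nearestPenalty W (x j ω) (x i ω)) ∂P) atTop
      (𝓝 (∫⁻ ω, ∑' j, f (x j ω) *
        expNeg (∑' i, if i = j then 0 else nearestPenalty W (x j ω) (x i ω)) ∂P)) := by
    refine lintegral_tendsto_of_tendsto_of_monotone (fun N => (Measurable.tsum fun j =>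
      ((hfN N).comp (hx.measurable j)).mul (hx.measurable_tsum_pair hVm j).expNeg).aemeasurable)
      (Eventually.of_forall fun ω m n hmn => ENNReal.tsum_le_tsum fun j =>
        mul_le_mul_left (hfmono _ hmn) _) (Eventually.of_forall fun ω => ?_)
    exact tendsto_tsum_of_monotone (fun j m n hmn => mul_le_mul_left (hfmono _ hmn) _)
      (fun j => ENNReal.Tendsto.mul_const (hflim _) (Or.inr (expNeg_ne_top _)))
  refine tendsto_nhds_unique hl ?_
  simp_rw [hN]
  refine ENNReal.Tendsto.const_mul ?_ (Or.inr ENNReal.ofReal_ne_top)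
  refine lintegral_tendsto_of_tendsto_of_monotone (fun N =>
    ((hfN N).mul (hm1 hVm)).aemeasurable)
    (Eventually.of_forall fun y m n hmn => mul_le_mul_left (hfmono _ hmn) _)
    (Eventually.of_forall fun y => ?_)
  exact ENNReal.Tendsto.mul_const (hflim _) (Or.inr (expNeg_ne_top _))

end Nearest

/-! ### Uniqueness of the nearest point and its joint law with the other points. -/

section NearestPoint

variable {Ω : Type*} [MeasurableSpace Ω] {P : Measure Ω} {x : ℕ → Ω → Plane} {lam : ℝ}

/-- A planar Gaussian integral; it says that the density of the nearest point has total mass 1. -/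
lemma lintegral_expNeg_volume_ball (hlam : 0 < lam) :
    ENNReal.ofReal lam * ∫⁻ y : Plane, expNeg (ENNReal.ofReal lam *
      volume (Metric.ball (0 : Plane) ‖y‖)) = 1 := by
  have h1 : ∀ y : Plane, expNeg (ENNReal.ofReal lam * volume (Metric.ball (0 : Plane) ‖y‖)) =
      ENNReal.ofReal (Real.exp (-(lam * Real.pi) * ‖y‖ ^ 2)) := by
    intro y
    rw [EuclideanSpace.volume_ball_fin_two, ← ENNReal.ofReal_pow (norm_nonneg y),
      ← ENNReal.ofReal_mul (by positivity),
      ← ENNReal.ofReal_mul hlam.le, expNeg_ofReal (by positivity)]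
    congr 2
    ring
  simp_rw [h1]
  have hb : 0 < lam * Real.pi := mul_pos hlam Real.pi_pos
  have hint := GaussianFourier.integral_rexp_neg_mul_sq_norm (V := Plane) hb
  rw [finrank_euclideanSpace_fin] at hint
  rw [← ofReal_integral_eq_lintegral_ofReal _ (Eventually.of_forall fun y => (Real.exp_pos _).le),
    hint, ← ENNReal.ofReal_mul hlam.le]
  · norm_num
    field_simp
  -- Integrability comes from the value of the Bochner integral: it would be 0 for a non-integrable
  -- function, but it is positive.
  · by_contra h
    rw [integral_undef h] at hint
    have : (0 : ℝ) < (Real.pi / (lam * Real.pi)) ^ (((2 : ℕ) : ℝ) / 2) := by positivity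
    exact this.ne hint

lemma pairApprox_zero : PairApprox (fun _ _ _ => 0) (fun _ _ => 0) where
  measurable _ := measurable_const
  continuous _ _ := continuous_const
  ne_top _ _ _ := by simp
  support _ _ _ _ := rfl
  mono _ _ := monotone_const
  tendsto _ _ := tendsto_const_nhds

lemma tsum_ite_top_eq (p : ℕ → Prop) [DecidablePred p] (j : ℕ) :
    expNeg (∑' i, if i = j then 0 else (if p i then (∞ : ℝ≥0∞) else 0)) =
      open scoped Classical in if ∀ i, i ≠ j → ¬ p i then 1 else 0 := by
  classical
  split_ifs with h
  · rw [ENNReal.tsum_eq_zero.2, expNeg_zero]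
    intro i
    by_cases hi : i = j
    · simp [hi]
    · simp [hi, h i hi]
  · push Not at h
    obtain ⟨i, hi, hpi⟩ := h
    have : ∑' i, (if i = j then 0 else (if p i then (∞ : ℝ≥0∞) else 0)) = ∞ := by
      refine top_le_iff.1 (le_trans ?_ (ENNReal.le_tsum i))
      simp [hi, hpi]
    rw [this, expNeg_top]

/-- Let T j indicate that no other point is strictly closer to the origin than x_j. By the Mecke
formula the expected number of such j is the total mass of the nearest-point density, namely 1. The
ordering gives T 0 = 1, so all other T j vanish almost surely, and then some point, hence also x_0,
is strictly closer than x_j. -/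
lemma IsHPPP.ae_nearest [IsProbabilityMeasure P] (hx : IsHPPP x lam P) (hlam : 0 < lam)
    (hord : ∀ᵐ ω ∂P, Monotone fun i => ‖x i ω‖) :
    ∀ᵐ ω ∂P, ∀ j ≠ 0, ‖x 0 ω‖ < ‖x j ω‖ := by
  let T : ℕ → Ω → ℝ≥0∞ := fun j ω =>
    expNeg (∑' i, if i = j then 0 else nearestPenalty (fun _ _ => 0) (x j ω) (x i ω))
  have hT : ∀ j, Measurable (T j) := fun j =>
    (hx.measurable_tsum_pair (measurable_nearestPenalty measurable_const) j).expNeg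
  have hT' : ∀ j ω, T j ω = open scoped Classical in
      if ∀ i, i ≠ j → ¬ ‖x i ω‖ < ‖x j ω‖ then 1 else 0 := by
    intro j ω
    classical
    simp only [T, nearestPenalty, add_zero]
    exact tsum_ite_top_eq (fun i => ‖x i ω‖ < ‖x j ω‖) j
  have hint : ∫⁻ ω, ∑' j, T j ω ∂P = 1 := by
    have h := hx.mecke_nearest hlam.le (f := fun _ => 1) measurable_const (fun _ => le_rfl)
      pairApprox_zero
    simp only [one_mul] at h
    refine h.trans ?_
    refine Eq.trans ?_ (lintegral_expNeg_volume_ball hlam)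
    congr 1
    refine lintegral_congr fun y => ?_
    congr 2
    rw [← lintegral_indicator_one measurableSet_ball]
    refine lintegral_congr fun z => ?_
    by_cases hz : ‖z‖ < ‖y‖
    · simp [nearestPenalty, hz, expNeg_top]
    · simp [nearestPenalty, hz, expNeg_zero]
  have hT0 : ∀ᵐ ω ∂P, T 0 ω = 1 := by
    filter_upwards [hord] with ω hω
    rw [hT', if_pos]
    exact fun i _ => not_lt.2 (hω (Nat.zero_le i))
  have hone : ∀ᵐ ω ∂P, (1 : ℝ≥0∞) = ∑' j, T j ω := by
    refine ae_eq_of_ae_le_of_lintegral_le (f := fun _ => 1) (g := fun ω => ∑' j, T j ω) ?_ (by simp)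
      (Measurable.tsum hT).aemeasurable (by simp [hint])
    filter_upwards [hT0] with ω hω
    exact hω ▸ ENNReal.le_tsum 0
  filter_upwards [hord, hT0, hone] with ω hω h0 h1 j hj
  have hTj : T j ω = 0 := by
    have h2 : T 0 ω + T j ω ≤ 1 := by
      rw [h1]
      have := ENNReal.sum_le_tsum (f := fun j => T j ω) {0, j}
      rwa [Finset.sum_pair hj.symm] at this
    rw [h0] at h2
    have h3 : (1 : ℝ≥0∞) + T j ω ≤ 1 + 0 := by simpa using h2
    exact le_zero_iff.1 ((ENNReal.add_le_add_iff_left ENNReal.one_ne_top).1 h3)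
  rw [hT'] at hTj
  have : ¬ ∀ i, i ≠ j → ¬ ‖x i ω‖ < ‖x j ω‖ := fun h => by
    rw [if_pos h] at hTj
    exact one_ne_zero hTj
  push Not at this
  obtain ⟨i, _, hi⟩ := this
  exact (hω (Nat.zero_le i)).trans_lt hi

/-- The joint law of the nearest point of a Poisson point process and of all the other points,
expressed by Laplace functionals. -/
lemma IsHPPP.nearest_formula [IsProbabilityMeasure P] (hx : IsHPPP x lam P) (hlam : 0 < lam)
    (hord : ∀ᵐ ω ∂P, Monotone fun i => ‖x i ω‖)
    {f : Plane → ℝ≥0∞} (hf : Measurable f) (hf1 : ∀ y, f y ≤ 1)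
    {w : ℕ → Plane → Plane → ℝ≥0∞} {W : Plane → Plane → ℝ≥0∞} (h : PairApprox w W) :
    ∫⁻ ω, f (x 0 ω) * expNeg (∑' i, if i = 0 then 0 else W (x 0 ω) (x i ω)) ∂P =
      ENNReal.ofReal lam * ∫⁻ y, f y *
        expNeg (ENNReal.ofReal lam * ∫⁻ z, (1 - expNeg (nearestPenalty W y z))) := by
  rw [← hx.mecke_nearest hlam.le hf hf1 h]
  refine lintegral_congr_ae ?_
  filter_upwards [hx.ae_nearest hlam hord] with ω hω
  -- For j ≠ 0 the point x_0 is strictly closer than x_j and contributes an infinite penalty, so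
  -- only j = 0 survives in the Mecke sum.
  rw [tsum_eq_single (f := fun j => f (x j ω) *
    expNeg (∑' i, if i = j then 0 else nearestPenalty W (x j ω) (x i ω))) 0]
  · congr 2
    refine tsum_congr fun i => ?_
    by_cases hi : i = 0
    · simp [hi]
    · simp only [hi, if_false, nearestPenalty]
      rw [if_neg (not_lt.2 (hω i hi).le), zero_add]
  · intro j hj
    have : ∑' i, (if i = j then 0 else nearestPenalty W (x j ω) (x i ω)) = ∞ := by
      refine top_le_iff.1 (le_trans ?_ (ENNReal.le_tsum 0))
      simp [hj.symm, nearestPenalty, hω j hj]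
    rw [this, expNeg_top, mul_zero]

end NearestPoint

/-! ### Integrals over a disk seen from a point of its boundary -/

section Disk

/-- The fundamental theorem of calculus with one-sided limits at the endpoints, so that it also
covers primitives composed with the tangent on (-π/2, π/2). -/
lemma lintegral_Ioo_of_hasDerivAt {a b : ℝ} (hab : a < b) {G g : ℝ → ℝ} {A B : ℝ}
    (hg : ContinuousOn g (Set.Icc a b)) (hg0 : ∀ t ∈ Set.Icc a b, 0 ≤ g t)
    (hG : ∀ t ∈ Set.Ioo a b, HasDerivAt G (g t) t)
    (hA : Tendsto G (𝓝[>] a) (𝓝 A)) (hB : Tendsto G (𝓝[<] b) (𝓝 B)) :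
    ∫⁻ t in Set.Ioo a b, ENNReal.ofReal (g t) = ENNReal.ofReal (B - A) := by
  have hint : IntervalIntegrable g volume a b :=
    (hg.mono (by rw [Set.uIcc_of_le hab.le])).intervalIntegrable
  have h := intervalIntegral.integral_eq_sub_of_hasDerivAt_of_tendsto hab hG hint hA hB
  rw [intervalIntegral.integral_of_le hab.le, integral_Ioc_eq_integral_Ioo] at h
  rw [← h, ofReal_integral_eq_lintegral_ofReal]
  · exact hg.integrableOn_Icc.mono_set Set.Ioo_subset_Icc_self
  · filter_upwards [ae_restrict_mem measurableSet_Ioo] with t ht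
    exact hg0 t (Set.Ioo_subset_Icc_self ht)

/-- A primitive of `t ↦ 1 / ((t² + 1)² + b²)`, where `p² = 1 + b²`, `q² = 2p - 2`, `m² = 2p + 2`. -/
def quarticPrimitive (p q m t : ℝ) : ℝ :=
  1 / (4 * p * q) * Real.log ((t ^ 2 + q * t + p) / (t ^ 2 - q * t + p)) +
    1 / (2 * p * m) * (Real.arctan ((2 * t + q) / m) + Real.arctan ((2 * t - q) / m))

/-- Since 2p - q² = 2, the quartic factors as (t² + qt + p)(t² - qt + p). Partial fractions give the
logarithm, and completing the square, with 4p - q² = m², gives the arctangents. -/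
lemma hasDerivAt_quarticPrimitive {p q m : ℝ} (hp : 0 < p) (hq : 0 < q) (hm : 0 < m)
    (hq2 : q ^ 2 = 2 * p - 2) (hm2 : m ^ 2 = 2 * p + 2) (t : ℝ) :
    HasDerivAt (quarticPrimitive p q m) (1 / ((t ^ 2 + 1) ^ 2 + (p ^ 2 - 1))) t := by
  have hD1 : 0 < t ^ 2 + q * t + p := by nlinarith [sq_nonneg (2 * t + q)]
  have hD2 : 0 < t ^ 2 - q * t + p := by nlinarith [sq_nonneg (2 * t - q)]
  have h1 : HasDerivAt (fun t : ℝ => t ^ 2 + q * t + p) (2 * t + q) t := by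
    have := ((hasDerivAt_pow 2 t).add ((hasDerivAt_id t).const_mul q)).add_const p
    simpa using this
  have h2 : HasDerivAt (fun t : ℝ => t ^ 2 - q * t + p) (2 * t - q) t := by
    have := ((hasDerivAt_pow 2 t).sub ((hasDerivAt_id t).const_mul q)).add_const p
    simpa using this
  have h3 := (h1.div h2 hD2.ne').log (div_pos hD1 hD2).ne'
  have h4 : HasDerivAt (fun t : ℝ => (2 * t + q) / m) (2 / m) t := by
    have := (((hasDerivAt_id t).const_mul 2).add_const q).div_const m
    simpa using this
  have h5 : HasDerivAt (fun t : ℝ => (2 * t - q) / m) (2 / m) t := by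
    have := (((hasDerivAt_id t).const_mul 2).sub_const q).div_const m
    simpa using this
  have h6 := (h3.const_mul (1 / (4 * p * q))).add ((h4.arctan.add h5.arctan).const_mul
    (1 / (2 * p * m)))
  refine HasDerivAt.congr_deriv h6 ?_
  have e1 : 1 + ((2 * t + q) / m) ^ 2 = 4 * (t ^ 2 + q * t + p) / m ^ 2 := by
    field_simp; nlinarith
  have e2 : 1 + ((2 * t - q) / m) ^ 2 = 4 * (t ^ 2 - q * t + p) / m ^ 2 := by
    field_simp; nlinarith
  have e3 : (t ^ 2 + 1) ^ 2 + (p ^ 2 - 1) = (t ^ 2 + q * t + p) * (t ^ 2 - q * t + p) := by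
    linear_combination t ^ 2 * hq2
  rw [e1, e2, e3, Pi.div_apply]
  obtain ⟨D1, h1d⟩ : ∃ D, D = t ^ 2 + q * t + p := ⟨_, rfl⟩
  obtain ⟨D2, h2d⟩ : ∃ D, D = t ^ 2 - q * t + p := ⟨_, rfl⟩
  simp only [← h1d, ← h2d] at hD1 hD2 ⊢
  field_simp
  rw [h1d, h2d]
  ring

/-- In the variable 1/t the argument of the logarithm tends to 1, so only the arctangents survive.
The general filter covers both +∞ and -∞. -/
lemma tendsto_quarticPrimitive {p q m : ℝ} {l : Filter ℝ} {c : ℝ}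
    (hl0 : Tendsto (fun t : ℝ => t⁻¹) l (𝓝 0)) (hlne : ∀ᶠ t in l, t ≠ 0)
    (hc : ∀ q : ℝ, Tendsto (fun t : ℝ => Real.arctan ((2 * t + q) / m)) l (𝓝 c)) :
    Tendsto (quarticPrimitive p q m) l (𝓝 (1 / (p * m) * c)) := by
  have h1 : Tendsto (fun t : ℝ => (t ^ 2 + q * t + p) / (t ^ 2 - q * t + p)) l (𝓝 1) := by
    have hcont : ContinuousAt (fun s : ℝ => (1 + q * s + p * s ^ 2) / (1 - q * s + p * s ^ 2)) 0 := by
      refine ContinuousAt.div (by fun_prop) (by fun_prop) (by norm_num)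
    have h := hcont.tendsto.comp hl0
    norm_num at h
    refine h.congr' ?_
    filter_upwards [hlne] with t ht
    have e : ∀ q : ℝ, t ^ 2 + q * t + p = t ^ 2 * (1 + q * t⁻¹ + p * t⁻¹ ^ 2) := by
      intro q; field_simp
    have e' : t ^ 2 - q * t + p = t ^ 2 * (1 - q * t⁻¹ + p * t⁻¹ ^ 2) := by
      field_simp
    simp only [Function.comp]
    rw [e, e', mul_div_mul_left _ _ (pow_ne_zero 2 ht)]
  have h2 := (h1.log one_ne_zero).const_mul (1 / (4 * p * q))
  have h3 := ((hc q).add (hc (-q))).const_mul (1 / (2 * p * m))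
  have h4 := h2.add h3
  rw [Real.log_one, mul_zero, zero_add] at h4
  have e : 1 / (p * m) * c = 1 / (2 * p * m) * (c + c) := by
    rw [mul_assoc 2 p m]
    ring
  rw [e]
  refine h4.congr fun t => ?_
  simp [quarticPrimitive, sub_eq_add_neg]

/-- The substitution t = tan θ reduces this to the quartic integral over the real line. -/
lemma lintegral_cos_sq_div {b : ℝ} (hb : 0 < b) :
    ∫⁻ θ in Set.Ioo (-(Real.pi / 2)) (Real.pi / 2),
      ENNReal.ofReal (Real.cos θ ^ 2 / (1 + b ^ 2 * Real.cos θ ^ 4)) =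
    ENNReal.ofReal (Real.pi / (√(1 + b ^ 2) * √(2 * √(1 + b ^ 2) + 2))) := by
  set p := √(1 + b ^ 2) with hp
  have hp2 : p ^ 2 = 1 + b ^ 2 := Real.sq_sqrt (by positivity)
  have hp1 : 1 < p := by
    rw [hp, Real.lt_sqrt (by norm_num)]; nlinarith
  set m := √(2 * p + 2) with hm
  have hm2 : m ^ 2 = 2 * p + 2 := Real.sq_sqrt (by linarith)
  have hm0 : 0 < m := Real.sqrt_pos.2 (by linarith)
  set q := √(2 * p - 2) with hq
  have hq2 : q ^ 2 = 2 * p - 2 := Real.sq_sqrt (by linarith)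
  have hq0 : 0 < q := Real.sqrt_pos.2 (by linarith)
  have hlin : ∀ q : ℝ, ∀ l : Filter ℝ, (Tendsto (fun t : ℝ => t) l atTop →
      Tendsto (fun t : ℝ => Real.arctan ((2 * t + q) / m)) l (𝓝 (Real.pi / 2))) ∧
      (Tendsto (fun t : ℝ => t) l atBot →
      Tendsto (fun t : ℝ => Real.arctan ((2 * t + q) / m)) l (𝓝 (-(Real.pi / 2)))) := by
    intro q l
    constructor
    · intro h
      exact (tendsto_nhds_of_tendsto_nhdsWithin Real.tendsto_arctan_atTop).comp
        ((tendsto_atTop_add_const_right _ q (h.const_mul_atTop two_pos)).atTop_div_const hm0)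
    · intro h
      exact (tendsto_nhds_of_tendsto_nhdsWithin Real.tendsto_arctan_atBot).comp
        ((tendsto_atBot_add_const_right _ q (h.const_mul_atBot two_pos)).atBot_div_const hm0)
  have hden : ∀ θ : ℝ, 0 < 1 + b ^ 2 * Real.cos θ ^ 4 := fun θ => by positivity
  have htop := tendsto_quarticPrimitive (p := p) (q := q) (m := m) tendsto_inv_atTop_zero
    (eventually_ne_atTop 0) (fun q => (hlin q atTop).1 tendsto_id)
  have hbot := tendsto_quarticPrimitive (p := p) (q := q) (m := m) tendsto_inv_atBot_zero
    (eventually_ne_atBot 0) (fun q => (hlin q atBot).2 tendsto_id)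
  rw [lintegral_Ioo_of_hasDerivAt (G := fun θ => quarticPrimitive p q m (Real.tan θ))
    (by linarith [Real.pi_pos]) ?_ (fun θ _ => by have := hden θ; positivity) ?_
    (hbot.comp Real.tendsto_tan_neg_pi_div_two) (htop.comp Real.tendsto_tan_pi_div_two)]
  · congr 1
    field_simp
    ring
  · exact (ContinuousOn.div (by fun_prop) (by fun_prop) fun θ _ => (hden θ).ne')
  · intro θ hθ
    have hcos : 0 < Real.cos θ := Real.cos_pos_of_mem_Ioo hθ
    have h := (hasDerivAt_quarticPrimitive (by linarith) hq0 hm0 hq2 hm2 (Real.tan θ)).comp θ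
      (Real.hasDerivAt_tan hcos.ne')
    refine h.congr_deriv ?_
    have ht : Real.tan θ ^ 2 + 1 = 1 / Real.cos θ ^ 2 := by
      rw [Real.tan_eq_sin_div_cos, div_pow, eq_div_iff (by positivity), add_mul,
        div_mul_cancel₀ _ (by positivity), one_mul, Real.sin_sq_add_cos_sq]
    rw [ht, hp2]
    have := hden θ
    have e : (1 / Real.cos θ ^ 2) ^ 2 + (1 + b ^ 2 - 1) =
        (1 + b ^ 2 * Real.cos θ ^ 4) / Real.cos θ ^ 4 := by
      field_simp
      ring
    rw [e]
    field_simp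

/-- With p = √(1 + b²), s = √((p - 1)/2) and m = √(2p + 2) one has b = s m and 1 + s² = m²/4, which
is what differentiating arctan s needs. -/
lemma lintegral_inv_sqrt {A : ℝ} (hA : 0 < A) :
    ∫⁻ b in Set.Ioo 0 A, ENNReal.ofReal (Real.pi / (√(1 + b ^ 2) * √(2 * √(1 + b ^ 2) + 2))) =
      ENNReal.ofReal (Real.pi * Real.arctan √((√(1 + A ^ 2) - 1) / 2)) := by
  have hc : Continuous fun b : ℝ => Real.pi * Real.arctan √((√(1 + b ^ 2) - 1) / 2) := by
    have := Real.continuous_arctan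
    fun_prop
  have hpos : ∀ b : ℝ, 0 < √(1 + b ^ 2) * √(2 * √(1 + b ^ 2) + 2) := fun b => by positivity
  have h0 := hc.tendsto' 0 0 (by simp)
  rw [lintegral_Ioo_of_hasDerivAt hA ?_ (fun b _ => by positivity) ?_
    (h0.mono_left nhdsWithin_le_nhds) ((hc.tendsto A).mono_left nhdsWithin_le_nhds), sub_zero]
  · exact (ContinuousOn.div (by fun_prop) (by fun_prop) fun b _ => (hpos b).ne')
  · intro b hb
    set p := √(1 + b ^ 2) with hp
    have hp2 : p ^ 2 = 1 + b ^ 2 := Real.sq_sqrt (by positivity)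
    have hb0 : 0 < b := hb.1
    have hp1 : 1 < p := by
      rw [hp, Real.lt_sqrt (by norm_num)]; nlinarith
    set m := √(2 * p + 2) with hm
    have hm2 : m ^ 2 = 2 * p + 2 := Real.sq_sqrt (by linarith)
    have hm0 : 0 < m := Real.sqrt_pos.2 (by linarith)
    set s := √((p - 1) / 2) with hs
    have hs2 : s ^ 2 = (p - 1) / 2 := Real.sq_sqrt (by linarith)
    have hs0 : 0 < s := Real.sqrt_pos.2 (by linarith)
    have hbs : b = s * m := by
      have : b ^ 2 = (s * m) ^ 2 := by rw [mul_pow, hs2, hm2]; nlinarith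
      exact (pow_left_inj₀ hb0.le (by positivity) two_ne_zero).1 this
    have h1 : HasDerivAt (fun b : ℝ => 1 + b ^ 2) (2 * b) b := by
      simpa using (hasDerivAt_pow 2 b).const_add 1
    have h2 := h1.sqrt (by positivity)
    have h3 := ((h2.sub_const 1).div_const 2).sqrt (by rw [← hp]; linarith)
    have h4 := h3.arctan.const_mul Real.pi
    refine h4.congr_deriv ?_
    rw [← hp, ← hs, hs2]
    have e : 1 + (p - 1) / 2 = m ^ 2 / 4 := by rw [hm2]; ring
    rw [e]
    have hp0 : p ≠ 0 := by linarith
    field_simp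
    rw [hbs]
    ring

/-- Write the integrand as an integral over b from 0 to A of its derivative in the parameter,
exchange by Tonelli, and evaluate first in θ, then in b. -/
lemma lintegral_arctan_cos_sq {A : ℝ} (hA : 0 < A) :
    ∫⁻ θ in Set.Ioo (-(Real.pi / 2)) (Real.pi / 2), ENNReal.ofReal (Real.arctan (A * Real.cos θ ^ 2)) =
      ENNReal.ofReal (Real.pi * Real.arctan √((√(1 + A ^ 2) - 1) / 2)) := by
  have h1 : ∀ θ : ℝ, ENNReal.ofReal (Real.arctan (A * Real.cos θ ^ 2)) =
      ∫⁻ b in Set.Ioo 0 A, ENNReal.ofReal (Real.cos θ ^ 2 / (1 + b ^ 2 * Real.cos θ ^ 4)) := by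
    intro θ
    have hc : Continuous fun b : ℝ => Real.arctan (b * Real.cos θ ^ 2) := by
      have := Real.continuous_arctan
      fun_prop
    have hpos : ∀ b : ℝ, 0 < 1 + b ^ 2 * Real.cos θ ^ 4 := fun b => by positivity
    rw [lintegral_Ioo_of_hasDerivAt hA ?_ (fun b _ => by have := hpos b; positivity) ?_
      ((hc.tendsto' 0 0 (by simp)).mono_left nhdsWithin_le_nhds)
      ((hc.tendsto A).mono_left nhdsWithin_le_nhds), sub_zero]
    · exact (ContinuousOn.div (by fun_prop) (by fun_prop) fun b _ => (hpos b).ne')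
    · intro b _
      have h := ((hasDerivAt_id b).mul_const (Real.cos θ ^ 2)).arctan
      refine h.congr_deriv ?_
      have e : 1 + (id b * Real.cos θ ^ 2) ^ 2 = 1 + b ^ 2 * Real.cos θ ^ 4 := by
        simp only [id]; ring
      rw [e, one_mul]
      ring
  simp_rw [h1]
  rw [lintegral_lintegral_swap (by
    refine Measurable.aemeasurable ?_
    unfold Function.uncurry
    fun_prop)]
  rw [← lintegral_inv_sqrt hA]
  exact setLIntegral_congr_fun measurableSet_Ioo fun b hb => lintegral_cos_sq_div hb.1

end Disk

/-! ### Integrals over the disk and the plane, and the exponent they produce. -/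

section PlaneIntegrals

/-- Allows polar coordinates around the boundary point a: after translation by a, the centre of the
disk sits at -a and is moved to d on the positive real axis. The isometry is a coordinate
identification followed by a reflection. -/
lemma exists_linearIsometryEquiv_complex {a : Plane} {d : ℝ} (hd : 0 ≤ d) (ha : ‖a‖ = d) :
    ∃ T : ℂ ≃ₗᵢ[ℝ] Plane, T (d : ℂ) = -a := by
  let S : ℂ ≃ₗᵢ[ℝ] Plane := Complex.orthonormalBasisOneI.repr
  have h : ‖S (d : ℂ)‖ = ‖-a‖ := by
    rw [LinearIsometryEquiv.norm_map, norm_neg, ha, Complex.norm_real, Real.norm_of_nonneg hd]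
  exact ⟨S.trans (Submodule.reflection (ℝ ∙ (S (d : ℂ) - -a))ᗮ), Submodule.reflection_sub h⟩

lemma hasDerivAt_radialPrimitive {ξ : ℝ} (hξ : 0 < ξ) (r : ℝ) :
    HasDerivAt (fun r : ℝ => √ξ / 2 * Real.arctan (r ^ 2 / √ξ)) (r * (ξ / (ξ + r ^ 4))) r := by
  have hs : 0 < √ξ := Real.sqrt_pos.2 hξ
  have hden : 0 < ξ + r ^ 4 := by positivity
  have h := ((((hasDerivAt_pow 2 r).div_const √ξ).arctan).const_mul (√ξ / 2))
  refine h.congr_deriv ?_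
  have h2 : √ξ ^ 2 = ξ := Real.sq_sqrt hξ.le
  have e : 1 + (r ^ 2 / √ξ) ^ 2 = (ξ + r ^ 4) / ξ := by
    rw [div_pow, h2]
    field_simp
  rw [e]
  field_simp
  simp

lemma lintegral_radial_part {ξ : ℝ} (hξ : 0 < ξ) {R : ℝ} (hR : 0 < R) :
    ∫⁻ r in Set.Ioo 0 R, ENNReal.ofReal (r * (ξ / (ξ + r ^ 4))) =
      ENNReal.ofReal (√ξ / 2 * Real.arctan (R ^ 2 / √ξ)) := by
  have hs : 0 < √ξ := Real.sqrt_pos.2 hξ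
  have hc : Continuous fun r : ℝ => √ξ / 2 * Real.arctan (r ^ 2 / √ξ) := by
    have := Real.continuous_arctan
    fun_prop
  have hden : ∀ r : ℝ, 0 < ξ + r ^ 4 := fun r => by positivity
  rw [lintegral_Ioo_of_hasDerivAt hR ?_ (fun r hr => mul_nonneg hr.1 (div_nonneg hξ.le (hden r).le)) ?_
    ((hc.tendsto' 0 0 (by simp)).mono_left nhdsWithin_le_nhds)
    ((hc.tendsto R).mono_left nhdsWithin_le_nhds), sub_zero]
  · exact continuousOn_id.mul (ContinuousOn.div (by fun_prop) (by fun_prop) fun r _ => (hden r).ne')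
  · exact fun r _ => hasDerivAt_radialPrimitive hξ r

/-- The integral of `ξ / (ξ + ‖y - a‖⁴)` over the disk with centre `0` whose boundary contains
`a`. -/
lemma lintegral_disk {a : Plane} {d ξ : ℝ} (hd : 0 < d) (ha : ‖a‖ = d) (hξ : 0 < ξ) :
    ∫⁻ y in Metric.ball (0 : Plane) d, ENNReal.ofReal (ξ / (ξ + ‖y - a‖ ^ 4)) =
      ENNReal.ofReal (1 / 2 * Real.pi * √ξ *
        Real.arctan √(-(1 / 2) + 1 / 2 * √(1 + 16 * d ^ 4 / ξ))) := by
  obtain ⟨T, hT⟩ := exists_linearIsometryEquiv_complex hd.le ha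
  have hs : 0 < √ξ := Real.sqrt_pos.2 hξ
  set F : ℝ → ℝ≥0∞ := fun r => ENNReal.ofReal (ξ / (ξ + r ^ 4)) with hF
  have hFm : Measurable F := by fun_prop
  -- After translation and rotation the disk is |z - d| < d, with the origin on its boundary; its
  -- polar equation is r < 2d cos θ.
  have h1 : ∫⁻ y in Metric.ball (0 : Plane) d, F ‖y - a‖ =
      ∫⁻ z : ℂ, {z : ℂ | ‖z - d‖ < d}.indicator (fun z => F ‖z‖) z := by
    rw [← lintegral_indicator measurableSet_ball,
      ← lintegral_add_right_eq_self _ a, ← T.measurePreserving.lintegral_comp_emb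
        T.toMeasurableEquiv.measurableEmbedding]
    refine lintegral_congr fun z => ?_
    have e : ‖T z + a‖ = ‖z - d‖ := by
      rw [← LinearIsometryEquiv.norm_map T (z - d), map_sub, hT, sub_neg_eq_add]
    by_cases hz : ‖z - d‖ < d
    · rw [Set.indicator_of_mem (by simpa [e] using hz), Set.indicator_of_mem (by exact hz),
        add_sub_cancel_right, LinearIsometryEquiv.norm_map]
    · rw [Set.indicator_of_notMem (by simpa [e] using hz), Set.indicator_of_notMem (by exact hz)]
  rw [h1, ← Complex.lintegral_comp_polarCoord_symm]
  have h2 : ∀ p ∈ polarCoord.target, ENNReal.ofReal p.1 •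
      {z : ℂ | ‖z - d‖ < d}.indicator (fun z => F ‖z‖) (Complex.polarCoord.symm p) =
      {p : ℝ × ℝ | p.1 < 2 * d * Real.cos p.2}.indicator
        (fun p => ENNReal.ofReal (p.1 * (ξ / (ξ + p.1 ^ 4)))) p := by
    intro p hp
    have hp1 : 0 < p.1 := hp.1
    have hmem : ‖Complex.polarCoord.symm p - d‖ < d ↔ p.1 < 2 * d * Real.cos p.2 := by
      rw [← abs_of_pos hd, ← sq_lt_sq₀ (norm_nonneg _) (abs_nonneg _), sq_abs, abs_of_pos hd,
        Complex.sq_norm, Complex.normSq_apply, Complex.polarCoord_symm_apply]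
      simp only [Complex.sub_re, Complex.sub_im, Complex.mul_re, Complex.mul_im, Complex.ofReal_re,
        Complex.ofReal_im, Complex.add_re, Complex.add_im, Complex.I_re, Complex.I_im]
      ring_nf
      have := Real.sin_sq_add_cos_sq p.2
      constructor
      · intro h
        have h' : p.1 * (p.1 - 2 * d * Real.cos p.2) < 0 := by nlinarith
        nlinarith [neg_of_mul_neg_right h' hp1.le]
      · intro h
        have h' : p.1 * (p.1 - 2 * d * Real.cos p.2) < 0 :=
          mul_neg_of_pos_of_neg hp1 (by linarith)
        nlinarith
    by_cases h : p.1 < 2 * d * Real.cos p.2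
    · rw [Set.indicator_of_mem (by exact hmem.2 h), Set.indicator_of_mem (by exact h),
        Complex.norm_polarCoord_symm, abs_of_pos hp1, smul_eq_mul, ← ENNReal.ofReal_mul hp1.le]
    · rw [Set.indicator_of_notMem (by exact fun h' => h (hmem.1 h')),
        Set.indicator_of_notMem (by exact h), smul_zero]
  have hmt : MeasurableSet {p : ℝ × ℝ | p.1 < 2 * d * Real.cos p.2} :=
    measurableSet_lt (by fun_prop) (by fun_prop)
  have hmg : Measurable fun p : ℝ × ℝ => ENNReal.ofReal (p.1 * (ξ / (ξ + p.1 ^ 4))) := by fun_prop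
  rw [setLIntegral_congr_fun polarCoord.open_target.measurableSet h2, polarCoord_target,
    Measure.volume_eq_prod, ← Measure.prod_restrict,
    lintegral_prod_symm _ (hmg.indicator hmt).aemeasurable]
  -- When cos θ ≤ 0 no positive radius is admissible; otherwise the radial integral is an arctangent
  -- at R = 2d cos θ.
  have h3 : ∀ θ ∈ Set.Ioo (-Real.pi) Real.pi,
      ∫⁻ r in Set.Ioi 0, {p : ℝ × ℝ | p.1 < 2 * d * Real.cos p.2}.indicator
        (fun p => ENNReal.ofReal (p.1 * (ξ / (ξ + p.1 ^ 4)))) (r, θ) =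
      (Set.Ioo (-(Real.pi / 2)) (Real.pi / 2)).indicator (fun θ => ENNReal.ofReal (√ξ / 2) *
        ENNReal.ofReal (Real.arctan (4 * d ^ 2 / √ξ * Real.cos θ ^ 2))) θ := by
    intro θ hθ
    have e : ∫⁻ r in Set.Ioi 0, {p : ℝ × ℝ | p.1 < 2 * d * Real.cos p.2}.indicator
        (fun p => ENNReal.ofReal (p.1 * (ξ / (ξ + p.1 ^ 4)))) (r, θ) =
        ∫⁻ r in Set.Ioo 0 (2 * d * Real.cos θ), ENNReal.ofReal (r * (ξ / (ξ + r ^ 4))) := by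
      rw [← lintegral_indicator measurableSet_Ioi, ← lintegral_indicator measurableSet_Ioo]
      refine lintegral_congr fun r => ?_
      simp only [Set.indicator, Set.mem_Ioi, Set.mem_Ioo, Set.mem_ofPred_eq, ite_and]
    rw [e]
    by_cases hθ' : θ ∈ Set.Ioo (-(Real.pi / 2)) (Real.pi / 2)
    · have hcos := Real.cos_pos_of_mem_Ioo hθ'
      rw [Set.indicator_of_mem hθ', lintegral_radial_part hξ (by positivity),
        ← ENNReal.ofReal_mul (by positivity)]
      congr 3
      ring
    · rw [Set.indicator_of_notMem hθ']
      have hcos : Real.cos θ ≤ 0 := by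
        rcases le_or_gt θ (-(Real.pi / 2)) with h | h
        · rw [← Real.cos_neg]
          exact Real.cos_nonpos_of_pi_div_two_le_of_le (by linarith) (by linarith [hθ.1])
        · have : Real.pi / 2 ≤ θ := by
            by_contra h'
            exact hθ' ⟨h, not_le.1 h'⟩
          exact Real.cos_nonpos_of_pi_div_two_le_of_le this (by linarith [hθ.2])
      rw [Set.Ioo_eq_empty (not_lt.2 (by nlinarith)), Measure.restrict_empty, lintegral_zero_measure]
  rw [setLIntegral_congr_fun measurableSet_Ioo h3, lintegral_indicator measurableSet_Ioo,
    Measure.restrict_restrict measurableSet_Ioo, Set.inter_eq_left.2 (Set.Ioo_subset_Ioo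
      (by linarith [Real.pi_pos]) (by linarith [Real.pi_pos])),
    lintegral_const_mul _ (by
      have := Real.measurable_arctan
      fun_prop), lintegral_arctan_cos_sq (by positivity), ← ENNReal.ofReal_mul (by positivity)]
  congr 1
  have e : (√(1 + (4 * d ^ 2 / √ξ) ^ 2) - 1) / 2 = -(1 / 2) + 1 / 2 * √(1 + 16 * d ^ 4 / ξ) := by
    rw [div_pow, Real.sq_sqrt hξ.le, show (4 * d ^ 2) ^ 2 = 16 * d ^ 4 by ring]
    ring
  rw [e]
  ring

lemma lintegral_radial {g : ℝ → ℝ} (hg : ∀ r, 0 < r → 0 ≤ g r)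
    (hint : IntegrableOn (fun r => r * g r) (Set.Ioi 0)) (h0 : 0 ≤ g 0) :
    ∫⁻ y : Plane, ENNReal.ofReal (g ‖y‖) =
      ENNReal.ofReal (2 * Real.pi * ∫ r in Set.Ioi 0, r * g r) := by
  have h1 : Integrable fun y : Plane => g ‖y‖ := by
    rw [integrable_fun_norm_addHaar volume]
    simpa using hint
  rw [← ofReal_integral_eq_lintegral_ofReal h1 (Eventually.of_forall fun y => by
      rcases (norm_nonneg y).eq_or_lt with h | h
      · simp only [← h]; exact h0
      · exact hg _ h), integral_fun_norm_addHaar]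
  congr 1
  rw [finrank_euclideanSpace_fin, Measure.real, EuclideanSpace.volume_ball_fin_two]
  simp [Real.pi_nonneg]
  ring

/-- The integral of `ξ / (ξ + ‖y‖⁴)` over the plane. -/
lemma lintegral_plane {ξ : ℝ} (hξ : 0 < ξ) :
    ∫⁻ y : Plane, ENNReal.ofReal (ξ / (ξ + ‖y‖ ^ 4)) = ENNReal.ofReal (Real.pi ^ 2 * √ξ / 2) := by
  have hs : 0 < √ξ := Real.sqrt_pos.2 hξ
  have hc : Continuous fun r : ℝ => √ξ / 2 * Real.arctan (r ^ 2 / √ξ) := by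
    have := Real.continuous_arctan
    fun_prop
  have hden : ∀ r : ℝ, 0 < ξ + r ^ 4 := fun r => by positivity
  have hderiv : ∀ r ∈ Set.Ioi (0 : ℝ), HasDerivAt (fun r : ℝ => √ξ / 2 * Real.arctan (r ^ 2 / √ξ))
      (r * (ξ / (ξ + r ^ 4))) r := fun r _ => hasDerivAt_radialPrimitive hξ r
  have hpos : ∀ r ∈ Set.Ioi (0 : ℝ), 0 ≤ r * (ξ / (ξ + r ^ 4)) := fun r hr => by
    have := hden r
    have : 0 < r := hr
    positivity
  have hlim : Tendsto (fun r : ℝ => √ξ / 2 * Real.arctan (r ^ 2 / √ξ)) atTop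
      (𝓝 (√ξ / 2 * (Real.pi / 2))) := by
    refine Tendsto.const_mul _ ((tendsto_nhds_of_tendsto_nhdsWithin Real.tendsto_arctan_atTop).comp ?_)
    exact (tendsto_pow_atTop two_ne_zero).atTop_div_const hs
  have hint := integrableOn_Ioi_deriv_of_nonneg hc.continuousWithinAt hderiv hpos hlim
  have hval := integral_Ioi_of_hasDerivAt_of_nonneg hc.continuousWithinAt hderiv hpos hlim
  rw [lintegral_radial (g := fun r => ξ / (ξ + r ^ 4)) (fun r _ => by have := hden r; positivity)
    hint (by positivity), hval]
  congr 1
  simp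
  ring

/-- `-log` of the Laplace transform at `ξ x` of the fading power received at `x` from `y`. -/
def fadingWeight (ξ : Plane → ℝ) (x y : Plane) : ℝ≥0∞ :=
  if y = x then ∞ else ENNReal.ofReal (Real.log (1 + ξ x / ‖y - x‖ ^ 4))

/-- Bounded approximations of `fadingWeight`. -/
def fadingWeightApprox (ξ : Plane → ℝ) (n : ℕ) (x y : Plane) : ℝ≥0∞ :=
  (Metric.ball (0 : Plane) n).indicator
    (fun y => ENNReal.ofReal (Real.log (1 + ξ x / (‖y - x‖ ^ 4 + 1 / ((n : ℝ) + 1))))) y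

/-- exp(-log(1 + ξ/r⁴)) = r⁴/(ξ + r⁴); the value ∞ at y = x makes the formula hold at r = 0 as well.
-/
lemma one_sub_expNeg_fadingWeight {ξ : Plane → ℝ} {x : Plane} (hξ : 0 < ξ x) (y : Plane) :
    1 - expNeg (fadingWeight ξ x y) = ENNReal.ofReal (ξ x / (ξ x + ‖y - x‖ ^ 4)) := by
  unfold fadingWeight
  split_ifs with h
  · simp [h, expNeg_top, hξ.ne']
  · have hr : 0 < ‖y - x‖ ^ 4 := by
      have : 0 < ‖y - x‖ := norm_pos_iff.2 (sub_ne_zero.2 h)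
      positivity
    have h1 : 1 ≤ 1 + ξ x / ‖y - x‖ ^ 4 := by
      have : 0 < ξ x / ‖y - x‖ ^ 4 := by positivity
      linarith
    rw [expNeg_ofReal (Real.log_nonneg h1), Real.exp_neg, Real.exp_log (by linarith),
      ← ENNReal.ofReal_one, ← ENNReal.ofReal_sub _ (by positivity)]
    congr 1
    obtain ⟨s, hs⟩ : ∃ s, s = ‖y - x‖ ^ 4 := ⟨_, rfl⟩
    rw [← hs] at hr ⊢
    field_simp
    ring

/-- The term 1/(n + 1) in the denominator removes the singularity at y = a, so the approximations
are finite and continuous in a; the ball gives bounded support. Both truncations relax monotonically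
in n. -/
lemma pairApprox_fadingWeight {ξ : Plane → ℝ} (hξc : Continuous ξ) (hξ : ∀ x, 0 < ξ x) :
    PairApprox (fadingWeightApprox ξ) (fadingWeight ξ) where
  measurable n := by
    have h : Measurable fun p : Plane × Plane =>
        ENNReal.ofReal (Real.log (1 + ξ p.1 / (‖p.2 - p.1‖ ^ 4 + 1 / ((n : ℝ) + 1)))) := by
      have := hξc.measurable
      fun_prop
    exact h.indicator (measurable_snd (measurableSet_ball (x := (0 : Plane)) (ε := (n : ℝ))))
  continuous n y := by
    by_cases hy : y ∈ Metric.ball (0 : Plane) n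
    · simp only [fadingWeightApprox, Set.indicator_of_mem hy]
      refine ENNReal.continuous_ofReal.comp (Continuous.log ?_ fun a => ?_)
      · refine continuous_const.add (hξc.div (by fun_prop) fun a => ?_)
        positivity
      · have : 0 ≤ ξ a / (‖y - a‖ ^ 4 + 1 / ((n : ℝ) + 1)) := by
          have := hξ a
          positivity
        positivity
    · simp only [fadingWeightApprox, Set.indicator_of_notMem hy]
      exact continuous_const
  ne_top n a y := by
    unfold fadingWeightApprox Set.indicator
    split_ifs <;> simp
  support n a y hy := Set.indicator_of_notMem hy _
  mono a y m n hmn := by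
    have hmn' : (m : ℝ) ≤ n := Nat.cast_le.2 hmn
    refine (Set.indicator_le_indicator_of_subset (Metric.ball_subset_ball hmn')
      (fun _ => zero_le) y).trans (Set.indicator_le_indicator (ENNReal.ofReal_le_ofReal ?_))
    have := hξ a
    refine Real.log_le_log (by positivity) ?_
    gcongr
  tendsto a y := by
    have hev : ∀ᶠ n : ℕ in atTop, ENNReal.ofReal (Real.log (1 + ξ a / (‖y - a‖ ^ 4 +
        1 / ((n : ℝ) + 1)))) = fadingWeightApprox ξ n a y := by
      obtain ⟨m, hm⟩ := exists_nat_gt ‖y‖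
      filter_upwards [eventually_ge_atTop m] with n hn
      have hy : y ∈ Metric.ball (0 : Plane) n := by
        rw [mem_ball_zero_iff]
        exact hm.trans_le (by exact_mod_cast hn)
      rw [fadingWeightApprox, Set.indicator_of_mem hy]
    refine Tendsto.congr' hev ?_
    unfold fadingWeight
    split_ifs with h
    · refine ENNReal.tendsto_ofReal_nhds_top.2 (Real.tendsto_log_atTop.comp ?_)
      have : ∀ n : ℕ, 1 + ξ a / (‖y - a‖ ^ 4 + 1 / ((n : ℝ) + 1)) = 1 + ξ a * ((n : ℝ) + 1) := by
        intro n
        simp [h]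
      simp_rw [this]
      exact tendsto_atTop_add_const_left _ _ (Tendsto.const_mul_atTop (hξ a)
        (tendsto_atTop_add_const_right _ _ tendsto_natCast_atTop_atTop))
    · have hr : 0 < ‖y - a‖ ^ 4 := by
        have : 0 < ‖y - a‖ := norm_pos_iff.2 (sub_ne_zero.2 h)
        positivity
      refine ENNReal.tendsto_ofReal (Tendsto.log ?_ ?_)
      · refine Tendsto.const_add _ (Tendsto.div tendsto_const_nhds ?_ hr.ne')
        simpa using (tendsto_const_nhds (x := ‖y - a‖ ^ 4)).add (tendsto_one_div_add_atTop_nhds_zero_nat (𝕜 := ℝ))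
      · have := hξ a
        positivity

/-- The exponent of the Laplace transform of the interference from outside the disk of radius
`d`, at the argument `ξ` and for a receiver at distance `d` from the origin. -/
def exteriorExponent (ξ d : ℝ) : ℝ :=
  Real.pi ^ 2 * √ξ / 2 - 1 / 2 * Real.pi * √ξ * Real.arctan √(-(1 / 2) + 1 / 2 * √(1 + 16 * d ^ 4 / ξ))

lemma lintegral_plane_sub (a : Plane) {ξ : ℝ} (hξ : 0 < ξ) :
    ∫⁻ y : Plane, ENNReal.ofReal (ξ / (ξ + ‖y - a‖ ^ 4)) = ENNReal.ofReal (Real.pi ^ 2 * √ξ / 2) := by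
  rw [lintegral_sub_right_eq_self (fun y : Plane => ENNReal.ofReal (ξ / (ξ + ‖y‖ ^ 4))) a,
    lintegral_plane hξ]

/-- Inside the disk the penalty is infinite and the integrand is 1. This area term produces the
probability that the disk is empty; the fading acts only outside. -/
lemma lintegral_nearestPenalty {ξ : Plane → ℝ} {a : Plane} (hξ : 0 < ξ a) :
    ∫⁻ z, (1 - expNeg (nearestPenalty (fadingWeight ξ) a z)) =
      volume (Metric.ball (0 : Plane) ‖a‖) +
        ∫⁻ z in (Metric.ball (0 : Plane) ‖a‖)ᶜ, ENNReal.ofReal (ξ a / (ξ a + ‖z - a‖ ^ 4)) := by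
  have hB : MeasurableSet (Metric.ball (0 : Plane) ‖a‖) := measurableSet_ball
  rw [← lintegral_add_compl _ hB]
  congr 1
  · rw [← setLIntegral_one]
    refine setLIntegral_congr_fun hB fun z hz => ?_
    rw [mem_ball_zero_iff] at hz
    simp [nearestPenalty, hz, expNeg_top]
  · refine setLIntegral_congr_fun hB.compl fun z hz => ?_
    rw [Set.mem_compl_iff, mem_ball_zero_iff] at hz
    simp only [nearestPenalty, if_neg hz, zero_add]
    exact one_sub_expNeg_fadingWeight hξ z

/-- The exterior integral is the whole-plane integral minus the one over the disk. -/
lemma lintegral_nearestPenalty_eq {ξ : Plane → ℝ} {a : Plane} (ha : a ≠ 0) (hξ : 0 < ξ a) :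
    ∫⁻ z, (1 - expNeg (nearestPenalty (fadingWeight ξ) a z)) =
      ENNReal.ofReal (Real.pi * ‖a‖ ^ 2 + exteriorExponent (ξ a) ‖a‖) := by
  have hB : MeasurableSet (Metric.ball (0 : Plane) ‖a‖) := measurableSet_ball
  have hpos : 0 ≤ exteriorExponent (ξ a) ‖a‖ := by
    have h1 := (Real.arctan_lt_pi_div_two √(-(1 / 2) + 1 / 2 * √(1 + 16 * ‖a‖ ^ 4 / ξ a))).le
    have h2 : 0 ≤ 1 / 2 * Real.pi * √(ξ a) := by positivity
    have := mul_le_mul_of_nonneg_left h1 h2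
    have h3 : 0 ≤ Real.pi ^ 2 * √(ξ a) := by positivity
    unfold exteriorExponent
    nlinarith
  rw [lintegral_nearestPenalty hξ, ENNReal.ofReal_add (by positivity) hpos]
  congr 1
  · rw [EuclideanSpace.volume_ball_fin_two, ← ENNReal.ofReal_pow (norm_nonneg _),
      ← ENNReal.ofReal_mul (by positivity), mul_comm]
  · have h1 := lintegral_disk (norm_pos_iff.2 ha) rfl hξ
    have h2 := lintegral_plane_sub a hξ
    rw [← lintegral_add_compl _ hB, h1] at h2
    rw [exteriorExponent, ENNReal.ofReal_sub _ (by
      have := Real.arctan_nonneg.2 (Real.sqrt_nonneg (-(1 / 2) + 1 / 2 * √(1 + 16 * ‖a‖ ^ 4 / ξ a)))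
      positivity), ← h2, ENNReal.add_sub_cancel_left ENNReal.ofReal_ne_top]

/-- Enlarging the exterior to the whole plane gives a bound with no dependence on the radius beyond
the area term and no exceptional point a = 0; it suffices for the proximity estimate. -/
lemma lintegral_nearestPenalty_le {ξ : Plane → ℝ} {a : Plane} (hξ : 0 < ξ a) :
    ∫⁻ z, (1 - expNeg (nearestPenalty (fadingWeight ξ) a z)) ≤
      volume (Metric.ball (0 : Plane) ‖a‖) + ENNReal.ofReal (Real.pi ^ 2 * √(ξ a) / 2) := by
  rw [lintegral_nearestPenalty hξ, ← lintegral_plane_sub a hξ]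
  gcongr
  exact Measure.restrict_le_self

end PlaneIntegrals

/-! ### Laplace transform of the interference around the nearest point, and proximity of the other
points -/

section Interference

variable {Ω : Type*} [MeasurableSpace Ω] {P : Measure Ω} {x : ℕ → Ω → Plane} {lam : ℝ}

lemma exteriorExponent_nonneg (ξ d : ℝ) : 0 ≤ exteriorExponent ξ d := by
  have h1 := (Real.arctan_lt_pi_div_two √(-(1 / 2) + 1 / 2 * √(1 + 16 * d ^ 4 / ξ))).le
  have h2 : 0 ≤ 1 / 2 * Real.pi * √ξ := by positivity
  have := mul_le_mul_of_nonneg_left h1 h2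
  have h3 : 0 ≤ Real.pi ^ 2 * √ξ := by positivity
  unfold exteriorExponent
  nlinarith

lemma measurable_exteriorExponent {Ξ : ℝ → ℝ} (hΞ : Measurable Ξ) :
    Measurable fun d => exteriorExponent (Ξ d) d := by
  have := Real.measurable_arctan
  unfold exteriorExponent
  fun_prop

/-- Dominated by d exp(-lam π d²), since F ≤ 1 and the exterior exponent is nonnegative. -/
lemma integrableOn_radial {F Ξ : ℝ → ℝ} (hlam : 0 < lam) (hF : Measurable F)
    (hF0 : ∀ d, 0 ≤ F d) (hF1 : ∀ d, F d ≤ 1) (hΞ : Measurable Ξ) :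
    IntegrableOn (fun d => d * (F d * Real.exp (-(lam * (Real.pi * d ^ 2 + exteriorExponent (Ξ d) d)))))
      (Set.Ioi 0) := by
  have h := (integrable_mul_exp_neg_mul_sq (b := lam * Real.pi) (by positivity)).integrableOn
    (s := Set.Ioi 0)
  have hm := measurable_exteriorExponent hΞ
  refine Integrable.mono' h ?_ ?_
  · exact Measurable.aestronglyMeasurable (by fun_prop)
  · filter_upwards [ae_restrict_mem measurableSet_Ioi] with d hd
    have hd' : 0 < d := hd
    rw [Real.norm_of_nonneg (by have := hF0 d; positivity)]
    refine mul_le_mul_of_nonneg_left ?_ hd'.le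
    calc F d * Real.exp (-(lam * (Real.pi * d ^ 2 + exteriorExponent (Ξ d) d)))
        ≤ 1 * Real.exp (-(lam * (Real.pi * d ^ 2 + exteriorExponent (Ξ d) d))) := by
          gcongr; exact hF1 d
      _ ≤ Real.exp (-(lam * Real.pi) * d ^ 2) := by
          rw [one_mul]
          refine Real.exp_le_exp.2 ?_
          have := mul_nonneg hlam.le (exteriorExponent_nonneg (Ξ d) d)
          nlinarith

lemma IsHPPP.lintegral_radial_mul_expNeg [IsProbabilityMeasure P] (hx : IsHPPP x lam P)
    (hlam : 0 < lam) (hord : ∀ᵐ ω ∂P, Monotone fun i => ‖x i ω‖)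
    {F Ξ : ℝ → ℝ} (hF : Measurable F) (hF0 : ∀ d, 0 ≤ F d) (hF1 : ∀ d, F d ≤ 1)
    (hΞc : Continuous Ξ) (hΞ : ∀ d, 0 < Ξ d) :
    ∫⁻ ω, ENNReal.ofReal (F ‖x 0 ω‖) *
        expNeg (∑' i, if i = 0 then 0 else fadingWeight (fun y => Ξ ‖y‖) (x 0 ω) (x i ω)) ∂P =
      ENNReal.ofReal (2 * Real.pi * lam * ∫ d in Set.Ioi 0,
        d * (F d * Real.exp (-(lam * (Real.pi * d ^ 2 + exteriorExponent (Ξ d) d))))) := by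
  have h := hx.nearest_formula hlam hord (f := fun y => ENNReal.ofReal (F ‖y‖)) (by fun_prop)
    (fun y => ENNReal.ofReal_le_one.2 (hF1 _))
    (pairApprox_fadingWeight (ξ := fun y => Ξ ‖y‖) (by fun_prop) (fun y => hΞ _))
  rw [h]
  have e : ∀ᵐ y : Plane, ENNReal.ofReal (F ‖y‖) * expNeg (ENNReal.ofReal lam *
      ∫⁻ z, (1 - expNeg (nearestPenalty (fadingWeight fun y => Ξ ‖y‖) y z))) =
      ENNReal.ofReal (F ‖y‖ *
        Real.exp (-(lam * (Real.pi * ‖y‖ ^ 2 + exteriorExponent (Ξ ‖y‖) ‖y‖)))) := by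
    have h0 : ∀ᵐ y : Plane, y ≠ 0 := by simp [ae_iff, measure_singleton]
    filter_upwards [h0] with y hy
    have hnn := exteriorExponent_nonneg (Ξ ‖y‖) ‖y‖
    rw [lintegral_nearestPenalty_eq hy (hΞ _), ← ENNReal.ofReal_mul hlam.le,
      expNeg_ofReal (by positivity), ← ENNReal.ofReal_mul (hF0 _)]
  rw [lintegral_congr_ae e, lintegral_radial (g := fun d => F d *
    Real.exp (-(lam * (Real.pi * d ^ 2 + exteriorExponent (Ξ d) d))))
    (fun d _ => mul_nonneg (hF0 d) (Real.exp_pos _).le)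
    (integrableOn_radial hlam hF hF0 hF1 hΞc.measurable)
    (mul_nonneg (hF0 0) (Real.exp_pos _).le), ← ENNReal.ofReal_mul hlam.le]
  congr 1
  ring

/-- The probability that some other point of the process is within distance `s` of the point
nearest to the origin. -/
lemma IsHPPP.measure_exists_near_le [IsProbabilityMeasure P] (hx : IsHPPP x lam P)
    (hlam : 0 < lam) (hord : ∀ᵐ ω ∂P, Monotone fun i => ‖x i ω‖) {s : ℝ} (hs : 0 < s) :
    P {ω | ∃ i ≠ 0, ‖x i ω - x 0 ω‖ < s} ≤ ENNReal.ofReal (Real.pi ^ 2 * lam * s ^ 2) := by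
  -- With ξ = s⁴, a point at distance r < s from x_0 has s⁴/(s⁴ + r⁴) ≥ 1/2, so V ≤ 1/2 on the
  -- event. Markov's inequality for 1 - V then leaves a lower bound on E V, which the nearest-point
  -- formula supplies as exp(-A).
  set W := fadingWeight fun _ => s ^ 4 with hW
  have hs4 : 0 < s ^ 4 := by positivity
  have hap := pairApprox_fadingWeight (ξ := fun _ => s ^ 4) continuous_const fun _ => hs4
  have hsq : √(s ^ 4) = s ^ 2 := by
    rw [show s ^ 4 = (s ^ 2) ^ 2 by ring, Real.sqrt_sq (by positivity)]
  set V : Ω → ℝ≥0∞ := fun ω => expNeg (∑' i, if i = 0 then 0 else W (x 0 ω) (x i ω)) with hV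
  have hVm : Measurable V := (hx.measurable_tsum_pair hap.measurable_limit 0).expNeg
  have h := hx.nearest_formula hlam hord (f := fun _ => 1) measurable_const (fun _ => le_rfl) hap
  simp only [one_mul] at h
  set A := ENNReal.ofReal lam * ENNReal.ofReal (Real.pi ^ 2 * s ^ 2 / 2) with hA
  have hlow : expNeg A ≤ ∫⁻ ω, V ω ∂P := by
    rw [hV, h]
    calc expNeg A = ENNReal.ofReal lam * ∫⁻ y : Plane, expNeg (ENNReal.ofReal lam *
          volume (Metric.ball (0 : Plane) ‖y‖)) * expNeg A := by
          rw [lintegral_mul_const' _ _ (expNeg_ne_top A), ← mul_assoc,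
            lintegral_expNeg_volume_ball hlam, one_mul]
      _ ≤ _ := by
          gcongr with y
          rw [← expNeg_add, hA, ← mul_add]
          refine antitone_expNeg (mul_le_mul_right ?_ _)
          rw [← hsq]
          exact lintegral_nearestPenalty_le (ξ := fun _ => s ^ 4) (a := y) hs4
  have hsub : ∫⁻ ω, (1 - V ω) ∂P ≤ A := by
    rw [lintegral_sub hVm (ne_top_of_le_ne_top ENNReal.one_ne_top (by
      calc ∫⁻ ω, V ω ∂P ≤ ∫⁻ _, 1 ∂P := lintegral_mono fun ω => expNeg_le_one _
        _ = 1 := by simp)) (Eventually.of_forall fun ω => expNeg_le_one _)]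
    simp only [lintegral_const, measure_univ, mul_one]
    exact (tsub_le_tsub_left hlow _).trans (one_sub_expNeg_le A)
  have h2r : ∀ t : ℝ, 2 * ENNReal.ofReal t = ENNReal.ofReal (2 * t) := fun t => by
    rw [ENNReal.ofReal_mul two_pos.le, ENNReal.ofReal_ofNat]
  have hev : ∀ ω ∈ {ω | ∃ i ≠ 0, ‖x i ω - x 0 ω‖ < s}, 1 ≤ 2 * (1 - V ω) := by
    rintro ω ⟨i, hi, his⟩
    have h1 : V ω ≤ expNeg (W (x 0 ω) (x i ω)) := by
      refine antitone_expNeg (le_trans ?_ (ENNReal.le_tsum i))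
      simp [hi]
    have h2 : 1 - expNeg (W (x 0 ω) (x i ω)) ≤ 1 - V ω := tsub_le_tsub_left h1 _
    have h3 := one_sub_expNeg_fadingWeight (ξ := fun _ => s ^ 4) (x := x 0 ω) hs4 (x i ω)
    rw [← hW] at h3
    refine le_trans ?_ (mul_le_mul_right h2 2)
    rw [h3, h2r, ENNReal.one_le_ofReal]
    have h4 : ‖x i ω - x 0 ω‖ ^ 4 ≤ s ^ 4 := pow_le_pow_left₀ (norm_nonneg _) his.le 4
    have h5 : 0 ≤ ‖x i ω - x 0 ω‖ ^ 4 := by positivity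
    rw [← mul_div_assoc, le_div_iff₀ (by linarith)]
    linarith
  calc P {ω | ∃ i ≠ 0, ‖x i ω - x 0 ω‖ < s} ≤ P {ω | 1 ≤ 2 * (1 - V ω)} := measure_mono hev
    _ ≤ ∫⁻ ω, 2 * (1 - V ω) ∂P := by
        have := mul_meas_ge_le_lintegral (μ := P) (f := fun ω => 2 * (1 - V ω))
          ((measurable_const.sub hVm).const_mul 2) 1
        rwa [one_mul] at this
    _ ≤ 2 * A := by
        rw [lintegral_const_mul _ (by fun_prop)]
        gcongr
    _ = ENNReal.ofReal (Real.pi ^ 2 * lam * s ^ 2) := by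
        rw [hA, ← ENNReal.ofReal_mul hlam.le, h2r]
        congr 1
        ring

end Interference

/-! ### The exponential distribution -/

section Exponential

lemma lintegral_expMeasure (f : ℝ → ℝ≥0∞) :
    ∫⁻ t, f t ∂(expMeasure 1) = ∫⁻ t in Set.Ioi 0, ENNReal.ofReal (Real.exp (-t)) * f t := by
  have hm : Measurable (exponentialPDF 1) := (measurable_exponentialPDFReal 1).ennreal_ofReal
  have h : expMeasure 1 = volume.withDensity (exponentialPDF 1) := rfl
  rw [h, lintegral_withDensity_eq_lintegral_mul_non_measurable _ hm
    (Eventually.of_forall fun _ => ENNReal.ofReal_lt_top), ← lintegral_indicator measurableSet_Ioi]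
  have h0 : ∀ᵐ t : ℝ, t ≠ 0 := by simp [ae_iff, measure_singleton]
  refine lintegral_congr_ae ?_
  filter_upwards [h0] with t ht
  rw [Pi.mul_apply]
  rcases lt_or_gt_of_ne ht with h1 | h1
  · rw [exponentialPDF_of_neg h1, zero_mul, Set.indicator_of_notMem (by simpa using h1.le)]
  · rw [exponentialPDF_of_nonneg h1.le, Set.indicator_of_mem (by exact h1), one_mul, one_mul]

lemma lintegral_expMeasure_exp {s b : ℝ} (hs : 0 ≤ s) (hb : 0 ≤ b) :
    ∫⁻ t, (Set.Ici b).indicator (fun t => ENNReal.ofReal (Real.exp (-(s * t)))) t ∂(expMeasure 1) =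
      ENNReal.ofReal (Real.exp (-((1 + s) * b)) / (1 + s)) := by
  have h1 : ∫⁻ t, (Set.Ici b).indicator (fun t => ENNReal.ofReal (Real.exp (-(s * t)))) t
      ∂(expMeasure 1) = ∫⁻ t in Set.Ioi b, ENNReal.ofReal (Real.exp (-(1 + s) * t)) := by
    rw [lintegral_expMeasure, ← lintegral_indicator measurableSet_Ioi,
      ← lintegral_indicator measurableSet_Ioi]
    have h0 : ∀ᵐ t : ℝ, t ≠ b := by simp [ae_iff, measure_singleton]
    refine lintegral_congr_ae ?_
    filter_upwards [h0] with t ht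
    rcases lt_or_gt_of_ne ht with h2 | h2
    · have h3 : t ∉ Set.Ici b := not_le.2 h2
      have h4 : t ∉ Set.Ioi b := not_lt.2 h2.le
      by_cases h5 : t ∈ Set.Ioi (0 : ℝ)
      · rw [Set.indicator_of_mem h5, Set.indicator_of_notMem h3, Set.indicator_of_notMem h4, mul_zero]
      · rw [Set.indicator_of_notMem h5, Set.indicator_of_notMem h4]
    · have h5 : t ∈ Set.Ioi (0 : ℝ) := hb.trans_lt h2
      have h4 : t ∈ Set.Ioi b := h2
      rw [Set.indicator_of_mem h5, Set.indicator_of_mem (Set.Ioi_subset_Ici_self h4),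
        Set.indicator_of_mem h4, ← ENNReal.ofReal_mul (Real.exp_pos _).le, ← Real.exp_add]
      congr 2
      ring
  have hneg : -(1 + s) < 0 := by linarith
  rw [h1, ← ofReal_integral_eq_lintegral_ofReal (integrableOn_exp_mul_Ioi hneg b)
    (Eventually.of_forall fun t => (Real.exp_pos _).le), integral_exp_mul_Ioi hneg]
  congr 1
  rw [neg_mul, div_neg, neg_div, neg_neg]

lemma expMeasure_Ici {b : ℝ} (hb : 0 ≤ b) :
    expMeasure 1 (Set.Ici b) = ENNReal.ofReal (Real.exp (-b)) := by
  have h := lintegral_expMeasure_exp le_rfl hb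
  simp only [zero_mul, neg_zero, Real.exp_zero, ENNReal.ofReal_one, add_zero, one_mul, div_one] at h
  rw [← h, ← lintegral_indicator_one measurableSet_Ici]
  rfl

/-- exp(-b) - exp(-cb) ≤ (c - 1) b exp(-b) and b exp(-b) ≤ 1. The bound is uniform in b, which is
why the final constant does not depend on powers, rates or noise. -/
lemma expMeasure_Ico_le {b c : ℝ} (hb : 0 ≤ b) (hc : 1 ≤ c) :
    expMeasure 1 (Set.Ico b (c * b)) ≤ ENNReal.ofReal (c - 1) := by
  have : IsProbabilityMeasure (expMeasure 1) := isProbabilityMeasure_expMeasure one_pos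
  have hbc : b ≤ c * b := le_mul_of_one_le_left hb hc
  have h : Set.Ico b (c * b) = Set.Ici b \ Set.Ici (c * b) := by
    ext t; simp
  rw [h, measure_sdiff (Set.Ici_subset_Ici.2 hbc) measurableSet_Ici.nullMeasurableSet
    (measure_ne_top _ _), expMeasure_Ici hb, expMeasure_Ici (hb.trans hbc),
    ← ENNReal.ofReal_sub _ (Real.exp_pos _).le]
  refine ENNReal.ofReal_le_ofReal ?_
  have h1 : Real.exp (-(c * b)) = Real.exp (-b) * Real.exp (-((c - 1) * b)) := by
    rw [← Real.exp_add]; congr 1; ring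
  have h2 := Real.add_one_le_exp (-((c - 1) * b))
  have h3 : b * Real.exp (-b) ≤ 1 := by
    have h4 := Real.add_one_le_exp b
    have h5 : Real.exp b * Real.exp (-b) = 1 := by rw [← Real.exp_add]; simp
    nlinarith [Real.exp_pos (-b)]
  rw [h1]
  nlinarith [Real.exp_pos (-b), mul_le_mul_of_nonneg_left h3 (sub_nonneg.2 hc),
    mul_le_mul_of_nonneg_left h2 (Real.exp_pos (-b)).le]

end Exponential

/-! ### Independence of blocks of coordinates -/

section Independence

variable {Ω : Type*} [MeasurableSpace Ω] {P : Measure Ω}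

/-- Each masked family generates a σ-algebra contained in the supremum over its own block. Masking
by 0 instead of restricting keeps both families on the full index set. -/
lemma iIndepFun_indepFun_mask {ι β : Type*} [MeasurableSpace β] [Zero β]
    {f : ι → Ω → β} (hf : iIndepFun f P) (hfm : ∀ i, Measurable (f i)) (S : Set ι)
    [DecidablePred (· ∈ S)] :
    IndepFun (fun ω i => if i ∈ S then f i ω else 0) (fun ω i => if i ∈ S then 0 else f i ω) P := by
  rw [IndepFun_iff_Indep]
  have hle : ∀ i, MeasurableSpace.comap (f i) inferInstance ≤ (inferInstance : MeasurableSpace Ω) :=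
    fun i => (hfm i).comap_le
  have h := indep_iSup_of_disjoint hle hf.iIndep (S := S) (T := Sᶜ) disjoint_compl_right
  refine indep_of_indep_of_le h ?_ ?_
  · rw [MeasurableSpace.pi, MeasurableSpace.comap_iSup]
    refine iSup_le fun i => ?_
    rw [MeasurableSpace.comap_comp]
    by_cases hi : i ∈ S
    · refine le_trans (le_of_eq ?_) (le_iSup₂_of_le i hi le_rfl)
      congr 1
      ext ω
      simp [hi]
    · have : ((fun b : ι → β => b i) ∘ fun ω i => if i ∈ S then f i ω else 0) = fun _ => (0 : β) := by
        ext ω; simp [hi]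
      rw [this, MeasurableSpace.comap_const]
      exact bot_le
  · rw [MeasurableSpace.pi, MeasurableSpace.comap_iSup]
    refine iSup_le fun i => ?_
    rw [MeasurableSpace.comap_comp]
    by_cases hi : i ∈ S
    · have : ((fun b : ι → β => b i) ∘ fun ω i => if i ∈ S then 0 else f i ω) = fun _ => (0 : β) := by
        ext ω; simp [hi]
      rw [this, MeasurableSpace.comap_const]
      exact bot_le
    · refine le_trans (le_of_eq ?_) (le_iSup₂_of_le i (by exact hi) le_rfl)
      congr 1
      ext ω
      simp [hi]

variable {α β γ δ : Type*} [MeasurableSpace α] [MeasurableSpace β] [MeasurableSpace γ]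
  [MeasurableSpace δ] [IsProbabilityMeasure P]

/-- Both hypotheses express joint laws as product measures, and products of measures are
associative. -/
lemma indepFun_prodMk_of_indepFun {A : Ω → α} {B : Ω → β} {C : Ω → γ} (hA : Measurable A)
    (hB : Measurable B) (hC : Measurable C) (hAB : IndepFun A B P)
    (h : IndepFun (fun ω => (A ω, B ω)) C P) : IndepFun A (fun ω => (B ω, C ω)) P := by
  have hBC : IndepFun B C P := h.comp measurable_snd measurable_id
  have := Measure.isProbabilityMeasure_map (μ := P) hA.aemeasurable
  have := Measure.isProbabilityMeasure_map (μ := P) hB.aemeasurable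
  have := Measure.isProbabilityMeasure_map (μ := P) hC.aemeasurable
  rw [indepFun_iff_map_prod_eq_prod_map_map hA.aemeasurable (hB.prodMk hC).aemeasurable,
    (indepFun_iff_map_prod_eq_prod_map_map hB.aemeasurable hC.aemeasurable).1 hBC,
    ← Measure.prodAssoc_prod,
    ← (indepFun_iff_map_prod_eq_prod_map_map hA.aemeasurable hB.aemeasurable).1 hAB,
    ← (indepFun_iff_map_prod_eq_prod_map_map (hA.prodMk hB).aemeasurable hC.aemeasurable).1 h,
    Measure.map_map MeasurableEquiv.prodAssoc.measurable ((hA.prodMk hB).prodMk hC)]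
  rfl

/-- Repeated regrouping of the four mutually independent variables; A, B will be the two blocks of
offsets and C, D those of fading coefficients. -/
lemma indepFun_prodMk_prodMk {A : Ω → α} {B : Ω → β} {C : Ω → γ} {D : Ω → δ} (hA : Measurable A)
    (hB : Measurable B) (hC : Measurable C) (hD : Measurable D) (hAB : IndepFun A B P)
    (hCD : IndepFun C D P) (h : IndepFun (fun ω => (A ω, B ω)) (fun ω => (C ω, D ω)) P) :
    IndepFun (fun ω => (A ω, C ω)) (fun ω => (B ω, D ω)) P := by
  have h1 : IndepFun A (fun ω => (B ω, (C ω, D ω))) P :=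
    indepFun_prodMk_of_indepFun hA hB (hC.prodMk hD) hAB h
  have h2 : IndepFun C (fun ω => (D ω, B ω)) P :=
    indepFun_prodMk_of_indepFun hC hD hB hCD (h.comp measurable_snd measurable_id).symm
  have h3 : IndepFun C (fun ω => ((B ω, D ω), A ω)) P := by
    have h4 : IndepFun (fun ω => (C ω, (B ω, D ω))) A P :=
      (h1.comp measurable_id (ψ := fun p : β × γ × δ => (p.2.1, (p.1, p.2.2))) (by fun_prop)).symm
    exact indepFun_prodMk_of_indepFun hC (hB.prodMk hD) hA
      (h2.comp measurable_id (ψ := fun p : δ × β => (p.2, p.1)) (by fun_prop)) h4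
  have h5 : IndepFun (fun ω => (B ω, D ω)) (fun ω => (A ω, C ω)) P :=
    indepFun_prodMk_of_indepFun (hB.prodMk hD) hA hC
      (h1.comp measurable_id (ψ := fun p : β × γ × δ => (p.1, p.2.2)) (by fun_prop)).symm h3.symm
  exact h5.symm

lemma lintegral_indepFun {U : Ω → α} {R : Ω → β} (hU : Measurable U) (hR : Measurable R)
    (h : IndepFun U R P) {Φ : α × β → ℝ≥0∞} (hΦ : Measurable Φ) :
    ∫⁻ ω, Φ (U ω, R ω) ∂P = ∫⁻ ω, ∫⁻ u, Φ (u, R ω) ∂(P.map U) ∂P := by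
  have := Measure.isProbabilityMeasure_map (μ := P) hU.aemeasurable
  have := Measure.isProbabilityMeasure_map (μ := P) hR.aemeasurable
  rw [← lintegral_map hΦ (hU.prodMk hR),
    (indepFun_iff_map_prod_eq_prod_map_map hU.aemeasurable hR.aemeasurable).1 h,
    lintegral_prod_symm _ hΦ.aemeasurable,
    lintegral_map (f := fun b => ∫⁻ u, Φ (u, b) ∂(P.map U)) hΦ.lintegral_prod_left' hR]

end Independence

/-! ### The network as a random configuration -/

/-- Locations of the base stations, relative locations of the users, and fading coefficients. -/
abbrev Config (K : ℕ) : Type :=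
  (ℕ → Plane) × (ℕ × Fin K → Plane) × (ℕ × Option (ℕ × Fin K) → ℂ)

namespace Config

variable {K : ℕ}

open scoped Classical in
/-- The users' locations with index in `S` and the fading coefficients with index in `T`, the
others being replaced by `0`. -/
def keep (S : Set (ℕ × Fin K)) (T : Set (ℕ × Option (ℕ × Fin K))) (θ : Config K) :
    (ℕ × Fin K → Plane) × (ℕ × Option (ℕ × Fin K) → ℂ) :=
  (fun p => if p ∈ S then θ.2.1 p else 0, fun q => if q ∈ T then θ.2.2 q else 0)

open scoped Classical in
/-- The configuration with the users' locations with index in `S` and the fading coefficients with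
index in `T` replaced by `0`. -/
def drop (S : Set (ℕ × Fin K)) (T : Set (ℕ × Option (ℕ × Fin K))) (θ : Config K) : Config K :=
  (θ.1, fun p => if p ∈ S then 0 else θ.2.1 p, fun q => if q ∈ T then 0 else θ.2.2 q)

lemma measurable_mask {α ι β : Type*} [MeasurableSpace α] [MeasurableSpace β] [Zero β]
    {f : α → ι → β} (hf : Measurable f) (p : ι → Prop) [DecidablePred p] :
    Measurable fun a i => if p i then f a i else 0 := by
  refine measurable_pi_lambda _ fun i => ?_
  by_cases h : p i
  · simp only [h, if_true]
    exact (measurable_pi_apply i).comp hf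
  · simp [h]

lemma measurable_mask_not {α ι β : Type*} [MeasurableSpace α] [MeasurableSpace β] [Zero β]
    {f : α → ι → β} (hf : Measurable f) (p : ι → Prop) [DecidablePred p] :
    Measurable fun a i => if p i then 0 else f a i := by
  refine measurable_pi_lambda _ fun i => ?_
  by_cases h : p i
  · simp [h]
  · simp only [h, if_false]
    exact (measurable_pi_apply i).comp hf

lemma measurable_keep (S : Set (ℕ × Fin K)) (T : Set (ℕ × Option (ℕ × Fin K))) :
    Measurable (keep S T) := by
  classical
  exact (measurable_mask (by fun_prop) _).prodMk (measurable_mask (by fun_prop) _)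

lemma measurable_drop (S : Set (ℕ × Fin K)) (T : Set (ℕ × Option (ℕ × Fin K))) :
    Measurable (drop S T) := by
  classical
  exact measurable_fst.prodMk ((measurable_mask_not (by fun_prop) _).prodMk
    (measurable_mask_not (by fun_prop) _))

end Config

namespace Network

variable {Ω : Type*} [MeasurableSpace Ω] {K : ℕ} {lam Rc : ℝ} {P : Measure Ω}
  (M : Network K lam Rc P)

/-- The random configuration of the network. -/
def config (ω : Ω) : Config K :=
  (fun i => M.x i ω, fun p => M.y p.1 p.2 ω, fun q => M.h q.1 q.2 ω)

lemma measurable_config : Measurable M.config :=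
  (measurable_pi_lambda _ fun i => M.hppp.measurable i).prodMk
    ((measurable_pi_lambda _ fun (p : ℕ × Fin K) => M.y_measurable p.1 p.2).prodMk
      (measurable_pi_lambda _ fun (q : ℕ × Option (ℕ × Fin K)) => M.h_measurable q.1 q.2))

/-- All conditioning rests on this: any chosen offsets and fading coefficients can be integrated out
while the rest is held fixed. The base stations always belong to the part held fixed. -/
lemma indepFun_keep_drop [IsProbabilityMeasure P] (S : Set (ℕ × Fin K))
    (T : Set (ℕ × Option (ℕ × Fin K))) :
    IndepFun (fun ω => (M.config ω).keep S T) (fun ω => (M.config ω).drop S T) P := by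
  classical
  have hYm : Measurable fun ω (p : ℕ × Fin K) => M.y p.1 p.2 ω :=
    measurable_pi_lambda _ fun p => M.y_measurable p.1 p.2
  have hHm : Measurable fun ω (q : ℕ × Option (ℕ × Fin K)) => M.h q.1 q.2 ω :=
    measurable_pi_lambda _ fun q => M.h_measurable q.1 q.2
  have hXm : Measurable fun ω i => M.x i ω := measurable_pi_lambda _ fun i => M.hppp.measurable i
  have hAm := Config.measurable_mask hYm (· ∈ S)
  have hBm := Config.measurable_mask_not hYm (· ∈ S)
  have hCm := Config.measurable_mask hHm (· ∈ T)
  have hDm := Config.measurable_mask_not hHm (· ∈ T)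
  have hAB := iIndepFun_indepFun_mask M.y_indep (fun p => M.y_measurable p.1 p.2) S
  have hCD := iIndepFun_indepFun_mask M.h_indep (fun q => M.h_measurable q.1 q.2) T
  have hYH := M.y_h_indep.comp
    ((Config.measurable_mask measurable_id (· ∈ S)).prodMk
      (Config.measurable_mask_not measurable_id (· ∈ S)))
    ((Config.measurable_mask measurable_id (· ∈ T)).prodMk
      (Config.measurable_mask_not measurable_id (· ∈ T)))
  have h1 := indepFun_prodMk_prodMk hAm hBm hCm hDm hAB hCD hYH
  have h2 := M.x_indep.symm.comp
    (φ := fun p : (ℕ × Fin K → Plane) × (ℕ × Option (ℕ × Fin K) → ℂ) =>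
      (((fun i => if i ∈ S then p.1 i else 0, fun i => if i ∈ T then p.2 i else 0) :
        (ℕ × Fin K → Plane) × (ℕ × Option (ℕ × Fin K) → ℂ)),
       ((fun i => if i ∈ S then 0 else p.1 i, fun i => if i ∈ T then 0 else p.2 i) :
        (ℕ × Fin K → Plane) × (ℕ × Option (ℕ × Fin K) → ℂ))))
    (((Config.measurable_mask measurable_fst _).prodMk
      (Config.measurable_mask measurable_snd _)).prodMk
      ((Config.measurable_mask_not measurable_fst _).prodMk
      (Config.measurable_mask_not measurable_snd _))) measurable_id
  have h3 := indepFun_prodMk_of_indepFun (hAm.prodMk hCm) (hBm.prodMk hDm) hXm h1 h2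
  have h4 := h3.comp measurable_id
    (ψ := fun p : ((ℕ × Fin K → Plane) × (ℕ × Option (ℕ × Fin K) → ℂ)) × (ℕ → Plane) =>
      ((p.2, p.1.1, p.1.2) : Config K)) (by fun_prop)
  convert! h4 using 1

/-- Integrating out one fading power. -/
lemma lintegral_fading [IsProbabilityMeasure P] (q : ℕ × Option (ℕ × Fin K))
    {Φ : ℝ × Config K → ℝ≥0∞} (hΦ : Measurable Φ) :
    ∫⁻ ω, Φ (‖M.h q.1 q.2 ω‖ ^ 2, (M.config ω).drop ∅ {q}) ∂P =
      ∫⁻ ω, ∫⁻ t, Φ (t, (M.config ω).drop ∅ {q}) ∂(expMeasure 1) ∂P := by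
  have h := (M.indepFun_keep_drop ∅ {q}).comp
    (φ := fun p : (ℕ × Fin K → Plane) × (ℕ × Option (ℕ × Fin K) → ℂ) => ‖p.2 q‖ ^ 2)
    (by fun_prop) measurable_id
  have hU : ((fun p : (ℕ × Fin K → Plane) × (ℕ × Option (ℕ × Fin K) → ℂ) => ‖p.2 q‖ ^ 2) ∘
      fun ω => (M.config ω).keep ∅ {q}) = fun ω => ‖M.h q.1 q.2 ω‖ ^ 2 := by
    ext ω; simp [Config.keep, config]
  rw [hU] at h
  have hm := M.h_measurable q.1 q.2
  have := lintegral_indepFun (P := P) (by fun_prop) ((Config.measurable_drop ∅ {q}).comp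
    M.measurable_config) h hΦ
  rwa [M.h_rayleigh] at this

end Network

/-! ### Channel gains -/

section Gain

lemma gain_eq (h : ℂ) (r : ℝ) :
    gain h r = ENNReal.ofReal (‖h‖ ^ 2) / ENNReal.ofReal (r ^ 4) := by
  rw [gain, pathLoss, ENNReal.ofReal_pow (norm_nonneg h), ofReal_norm]

lemma measurable_gain : Measurable fun p : ℂ × ℝ => gain p.1 p.2 := by
  unfold gain pathLoss
  fun_prop

lemma measurable_gain_comp {α : Type*} [MeasurableSpace α] {f : α → ℂ} {g : α → ℝ} (hf : Measurable f)
    (hg : Measurable g) : Measurable fun a => gain (f a) (g a) := by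
  have := measurable_gain.comp (hf.prodMk hg)
  exact this

lemma expMeasure_ae_pos : ∀ᵐ t ∂(expMeasure 1), (0 : ℝ) < t := by
  have := isProbabilityMeasure_expMeasure (r := 1) one_pos
  have h1 : expMeasure 1 (Set.Ici (0 : ℝ)) = 1 := by
    rw [expMeasure_Ici le_rfl]; simp
  have h2 : expMeasure 1 {(0 : ℝ)} = 0 := by
    have : expMeasure 1 ≪ (volume : Measure ℝ) := by
      unfold expMeasure gammaMeasure
      exact withDensity_absolutelyContinuous _ _
    exact this (by simp)
  have h3 : ∀ᵐ t ∂(expMeasure 1), t ∈ Set.Ici (0 : ℝ) :=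
    (prob_compl_eq_zero_iff measurableSet_Ici).2 h1
  have h4 : ∀ᵐ t ∂(expMeasure 1), t ≠ (0 : ℝ) := by
    rw [ae_iff]; simpa using h2
  filter_upwards [h3, h4] with t h h'
  exact lt_of_le_of_ne h (Ne.symm h')

lemma expMeasure_gain_eq (r : ℝ) (hr : 0 < r) (v : ℝ≥0∞) :
    ∀ᵐ t ∂(expMeasure 1), ENNReal.ofReal t / ENNReal.ofReal (r ^ 4) ≠ v := by
  have hac : expMeasure 1 ≪ (volume : Measure ℝ) := by
    unfold expMeasure gammaMeasure
    exact withDensity_absolutelyContinuous _ _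
  have h4 : ∀ᵐ t ∂(expMeasure 1), t ≠ (v * ENNReal.ofReal (r ^ 4)).toReal := by
    rw [ae_iff]
    exact hac (by simp)
  filter_upwards [h4, expMeasure_ae_pos] with t h h' hv
  apply h
  rw [← hv, ENNReal.div_mul_cancel (by positivity) ENNReal.ofReal_ne_top,
    ENNReal.toReal_ofReal h'.le]

lemma expMeasure_gain_ge (r : ℝ) (v : ℝ≥0∞) :
    expMeasure 1 {t | v ≤ ENNReal.ofReal t / ENNReal.ofReal (r ^ 4)} =
      expNeg (v * ENNReal.ofReal (r ^ 4)) := by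
  have := isProbabilityMeasure_expMeasure (r := 1) one_pos
  rcases eq_or_ne r 0 with rfl | hr
  · simp only [ne_eq, OfNat.ofNat_ne_zero, not_false_eq_true, zero_pow, ENNReal.ofReal_zero,
      mul_zero, expNeg_zero]
    rw [← mem_ae_iff_prob_eq_one (measurableSet_le measurable_const (by fun_prop))]
    filter_upwards [expMeasure_ae_pos] with t ht
    rw [ENNReal.div_zero (by positivity)]
    exact le_top
  · have hr4 : 0 < r ^ 4 := by positivity
    have h0 : ENNReal.ofReal (r ^ 4) ≠ 0 := by positivity
    have hset : ∀ t, v ≤ ENNReal.ofReal t / ENNReal.ofReal (r ^ 4) ↔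
        v * ENNReal.ofReal (r ^ 4) ≤ ENNReal.ofReal t := fun t =>
      ENNReal.le_div_iff_mul_le (Or.inl h0) (Or.inl ENNReal.ofReal_ne_top)
    simp only [hset]
    generalize v * ENNReal.ofReal (r ^ 4) = a
    rcases eq_or_ne a ⊤ with rfl | ha
    · simp [expNeg_top]
    · lift a to ℝ≥0 using ha
      have hae : {t : ℝ | (a : ℝ≥0∞) ≤ ENNReal.ofReal t} =ᵐ[expMeasure 1] Set.Ici (a : ℝ) := by
        filter_upwards [expMeasure_ae_pos] with t ht
        refine propext ?_
        change (a : ℝ≥0∞) ≤ ENNReal.ofReal t ↔ (a : ℝ) ≤ t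
        rw [← ENNReal.ofReal_coe_nnreal, ENNReal.ofReal_le_ofReal_iff ht.le]
      rw [measure_congr hae, expMeasure_Ici a.coe_nonneg, ← ENNReal.ofReal_coe_nnreal,
        expNeg_ofReal a.coe_nonneg]

lemma expMeasure_gain_Ico_le (r : ℝ) (v : ℝ≥0∞) {c : ℝ} (hc : 1 ≤ c) :
    expMeasure 1 {t | v ≤ ENNReal.ofReal t / ENNReal.ofReal (r ^ 4) ∧
      ENNReal.ofReal t / ENNReal.ofReal (r ^ 4) < ENNReal.ofReal c * v} ≤
      ENNReal.ofReal (c - 1) := by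
  rcases eq_or_ne r 0 with rfl | hr
  -- A link of length 0 has infinite gain almost surely, which is never strictly below anything.
  · refine le_trans (le_of_eq ?_) zero_le
    refine measure_eq_zero_iff_ae_notMem.2 ?_
    filter_upwards [expMeasure_ae_pos] with t ht h
    simp only [ne_eq, OfNat.ofNat_ne_zero, not_false_eq_true, zero_pow,
      ENNReal.ofReal_zero] at h
    rw [ENNReal.div_zero (by positivity)] at h
    exact not_top_lt h.2
  · have hr4 : 0 < r ^ 4 := by positivity
    have h0 : ENNReal.ofReal (r ^ 4) ≠ 0 := by positivity
    rcases eq_or_ne v ⊤ with rfl | hv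
    · refine le_trans (le_of_eq ?_) zero_le
      rw [measure_eq_zero_iff_ae_notMem]
      refine Eventually.of_forall fun t h => ?_
      exact (ENNReal.div_lt_top ENNReal.ofReal_ne_top h0).not_ge h.1
    · lift v to ℝ≥0 using hv
      refine le_trans (measure_mono_ae ?_)
        (expMeasure_Ico_le (b := v * r ^ 4) (by positivity) hc)
      filter_upwards [expMeasure_ae_pos] with t ht h
      change _ ∧ _ at h
      rw [← ENNReal.ofReal_coe_nnreal, ← ENNReal.ofReal_div_of_pos hr4,
        ← ENNReal.ofReal_mul (by positivity), ENNReal.ofReal_le_ofReal_iff (by positivity),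
        ENNReal.ofReal_lt_ofReal_iff_of_nonneg (by positivity), le_div_iff₀ hr4,
        div_lt_iff₀ hr4] at h
      exact ⟨h.1, by linarith [h.2]⟩

end Gain

/-! ### The selected users -/

section Selection

variable {ι : Type*} [Finite ι] [Inhabited ι]

open scoped Classical in
/-- An index at which `v` is maximal. -/
def argmax (v : ι → ℝ≥0∞) : ι :=
  if h : ∃ k, ∀ l, v l ≤ v k then h.choose else default

lemma le_argmax (v : ι → ℝ≥0∞) (l : ι) : v l ≤ v (argmax v) := by
  have h : ∃ k, ∀ l, v l ≤ v k := Finite.exists_max v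
  rw [argmax, dif_pos h]
  exact h.choose_spec l

/-- The choice depends on v only through the finite table of comparisons v l ≤ v k, and every
function of that table is measurable. -/
lemma measurable_argmax [MeasurableSpace ι] : Measurable (argmax : (ι → ℝ≥0∞) → ι) := by
  classical
  let A : (ι → ℝ≥0∞) → (ι × ι → Bool) := fun v p => decide (v p.1 ≤ v p.2)
  let F : (ι × ι → Bool) → ι := fun b =>
    if h : ∃ k, ∀ l, b (l, k) = true then h.choose else default
  have hA : Measurable A := by
    refine measurable_pi_lambda _ fun p => measurable_to_bool ?_
    have : (fun v : ι → ℝ≥0∞ => A v p) ⁻¹' {true} = {v | v p.1 ≤ v p.2} := by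
      ext v; simp [A]
    rw [this]
    exact measurableSet_le (measurable_pi_apply _) (measurable_pi_apply _)
  have hF : Measurable F := measurable_of_finite F
  have : (argmax : (ι → ℝ≥0∞) → ι) = F ∘ A := by
    ext v
    simp [argmax, F, A]
  rw [this]
  exact hF.comp hA

end Selection

namespace Config

variable {K : ℕ}

/-- The composite channel gain by which user `k` of cluster `j` is judged. -/
def cellGain (j : ℕ) (θ : Config K) (k : Fin K) : ℝ≥0∞ :=
  gain (θ.2.2 (j, some (j, k))) ‖θ.2.1 (j, k)‖

/-- The user selected in cluster `j`. -/
def sel [NeZero K] (j : ℕ) (θ : Config K) : Fin K := argmax (θ.cellGain j)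

/-- The interference at the nearest base station when the offsets of the interfering users are
multiplied by `s`. -/
def interf [NeZero K] (s : ℝ) (θ : Config K) : ℝ≥0∞ :=
  ∑' j, if j = 0 then 0 else
    gain (θ.2.2 (0, some (j, θ.sel j))) ‖s • θ.2.1 (j, θ.sel j) + θ.1 j - θ.1 0‖

/-- The received power of the CoMP user. -/
def power (φ : ℝ) (θ : Config K) : ℝ≥0∞ :=
  ENNReal.ofReal φ * gain (θ.2.2 (0, none)) ‖θ.1 0‖

lemma measurable_cellGain (j : ℕ) (k : Fin K) : Measurable fun θ : Config K => θ.cellGain j k := by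
  unfold cellGain
  exact measurable_gain_comp (by fun_prop) (by fun_prop)

lemma measurable_power (φ : ℝ) : Measurable (power φ : Config K → ℝ≥0∞) := by
  unfold power
  exact (measurable_gain_comp (by fun_prop) (by fun_prop)).const_mul _

lemma cellGain_drop {S : Set (ℕ × Fin K)} {T : Set (ℕ × Option (ℕ × Fin K))} {j : ℕ} {k : Fin K}
    (hS : (j, k) ∉ S) (hT : (j, some (j, k)) ∉ T) (θ : Config K) :
    (θ.drop S T).cellGain j k = θ.cellGain j k := by
  simp [cellGain, drop, hS, hT]

lemma measurable_apply_sel {α β : Type*} [MeasurableSpace α] [MeasurableSpace β]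
    {f : α → Fin K → β} (hf : ∀ k, Measurable fun a => f a k) {g : α → Fin K} (hg : Measurable g) :
    Measurable fun a => f a (g a) := by
  have : Measurable (Function.uncurry f) := measurable_from_prod_countable_left fun k => hf k
  exact this.comp (measurable_id.prodMk hg)

variable [NeZero K]

lemma measurable_sel (j : ℕ) : Measurable (sel j : Config K → Fin K) :=
  measurable_argmax.comp (measurable_pi_lambda _ fun k => measurable_cellGain j k)

lemma measurable_interf (s : ℝ) : Measurable (interf s : Config K → ℝ≥0∞) := by
  refine Measurable.tsum fun j => ?_
  by_cases hj : j = 0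
  · simp [hj]
  · simp only [hj, if_false]
    exact measurable_apply_sel (f := fun (θ : Config K) k =>
      gain (θ.2.2 (0, some (j, k))) ‖s • θ.2.1 (j, k) + θ.1 j - θ.1 0‖)
      (fun k => measurable_gain_comp (by fun_prop) (by fun_prop)) (measurable_sel j)

lemma sel_drop {S : Set (ℕ × Fin K)} {T : Set (ℕ × Option (ℕ × Fin K))} {j : ℕ}
    (hS : ∀ k, (j, k) ∉ S) (hT : ∀ k, (j, some (j, k)) ∉ T) (θ : Config K) :
    (θ.drop S T).sel j = θ.sel j := by
  have : (θ.drop S T).cellGain j = θ.cellGain j :=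
    funext fun k => cellGain_drop (hS k) (hT k) θ
  rw [sel, sel, this]

lemma interf_drop {S : Set (ℕ × Fin K)} {T : Set (ℕ × Option (ℕ × Fin K))}
    (hS : ∀ j ≠ 0, ∀ k, (j, k) ∉ S) (hT : ∀ j ≠ 0, ∀ k, (j, some (j, k)) ∉ T)
    (hT0 : ∀ j ≠ 0, ∀ k, (0, some (j, k)) ∉ T) (s : ℝ) (θ : Config K) :
    (θ.drop S T).interf s = θ.interf s := by
  unfold interf
  refine tsum_congr fun j => ?_
  by_cases hj : j = 0
  · simp [hj]
  · rw [if_neg hj, if_neg hj, sel_drop (hS j hj) (hT j hj)]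
    simp [drop, hS j hj, hT0 j hj]

end Config

namespace Network

variable {Ω : Type*} [MeasurableSpace Ω] {K : ℕ} {lam Rc : ℝ} {P : Measure Ω}
  (M : Network K lam Rc P)

lemma ae_offset :
    ∀ᵐ ω ∂P, ∀ j k, M.y j k ω ≠ 0 ∧ ‖M.y j k ω‖ ≤ Rc := by
  rw [ae_all_iff]; intro j
  rw [ae_all_iff]; intro k
  have hu : P.map (M.y j k) = ProbabilityTheory.cond volume (Metric.closedBall 0 Rc) :=
    M.y_uniform j k
  have h : ∀ᵐ v ∂(P.map (M.y j k)), v ≠ 0 ∧ ‖v‖ ≤ Rc := by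
    rw [hu]
    have h1 : ∀ᵐ v ∂(ProbabilityTheory.cond volume (Metric.closedBall (0 : Plane) Rc)),
        v ∈ Metric.closedBall (0 : Plane) Rc := ae_cond_mem measurableSet_closedBall
    have h2 : ∀ᵐ v ∂(ProbabilityTheory.cond volume (Metric.closedBall (0 : Plane) Rc)),
        v ≠ 0 := by
      rw [ae_iff]
      exact cond_absolutelyContinuous (by simp)
    filter_upwards [h1, h2] with v hv hv'
    exact ⟨hv', by simpa using hv⟩
  exact ae_of_ae_map (M.y_measurable j k).aemeasurable h

/-- By Campbell's formula the expected number of points at the origin is 0. -/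
lemma ae_nearest_ne_zero [IsProbabilityMeasure P] (hlam : 0 ≤ lam) :
    ∀ᵐ ω ∂P, M.x 0 ω ≠ 0 := by
  have hm : Measurable (({0} : Set Plane).indicator (1 : Plane → ℝ≥0∞)) :=
    measurable_one.indicator (measurableSet_singleton 0)
  have h0 : ∫⁻ y, ({0} : Set Plane).indicator (1 : Plane → ℝ≥0∞) y = 0 := by
    rw [lintegral_indicator_one (measurableSet_singleton 0)]
    simp
  have h := M.hppp.campbell hlam hm (by rw [h0]; simp)
  have hm' : Measurable fun ω => ∑' j, ({0} : Set Plane).indicator (1 : Plane → ℝ≥0∞) (M.x j ω) :=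
    Measurable.tsum fun j => hm.comp (M.hppp.measurable j)
  rw [h0, mul_zero, lintegral_eq_zero_iff hm'] at h
  filter_upwards [h] with ω hω hx
  have := ENNReal.tsum_eq_zero.1 hω 0
  simp [hx] at this

/-- Given everything except one user's fading, that user's gain has no atoms (its offset is
nonzero), so it almost surely differs from any other gain of the cluster. -/
lemma ae_cellGain_injective [IsProbabilityMeasure P] :
    ∀ᵐ ω ∂P, ∀ j, Function.Injective ((M.config ω).cellGain j) := by
  classical
  have key : ∀ j k l, k ≠ l → ∀ᵐ ω ∂P,
      (M.config ω).cellGain j k ≠ (M.config ω).cellGain j l := by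
    intro j k l hkl
    let q : ℕ × Option (ℕ × Fin K) := (j, some (j, k))
    let B : Set (ℝ × Config K) := {p | p.2.2.1 (j, k) ≠ 0 ∧
      ENNReal.ofReal p.1 / ENNReal.ofReal (‖p.2.2.1 (j, k)‖ ^ 4) = p.2.cellGain j l}
    have hB : MeasurableSet B := by
      refine MeasurableSet.inter ?_ (measurableSet_eq_fun (by fun_prop)
        ((Config.measurable_cellGain j l).comp measurable_snd))
      exact (measurableSet_eq_fun (by fun_prop) measurable_const).compl
    have h := M.lintegral_fading q (Φ := B.indicator 1) (measurable_one.indicator hB)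
    have h0 : ∫⁻ ω, ∫⁻ t, B.indicator 1 (t, (M.config ω).drop ∅ {q}) ∂(expMeasure 1) ∂P = 0 := by
      refine lintegral_eq_zero_of_ae_eq_zero (Eventually.of_forall fun ω => ?_)
      refine lintegral_eq_zero_of_ae_eq_zero ?_
      by_cases hy : ((M.config ω).drop ∅ {q}).2.1 (j, k) = 0
      · exact Eventually.of_forall fun t => Set.indicator_of_notMem (fun h => h.1 hy) _
      · filter_upwards [expMeasure_gain_eq ‖((M.config ω).drop ∅ {q}).2.1 (j, k)‖
          (norm_pos_iff.2 hy) (((M.config ω).drop ∅ {q}).cellGain j l)] with t ht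
        exact Set.indicator_of_notMem (fun h => ht h.2) _
    have hq := M.h_measurable q.1 q.2
    have hd := (Config.measurable_drop ∅ {q}).comp M.measurable_config
    have hm : Measurable fun ω => B.indicator (1 : ℝ × Config K → ℝ≥0∞)
        (‖M.h q.1 q.2 ω‖ ^ 2, (M.config ω).drop ∅ {q}) :=
      Measurable.comp (g := B.indicator (1 : ℝ × Config K → ℝ≥0∞)) (measurable_one.indicator hB)
        ((by fun_prop : Measurable fun ω => ‖M.h q.1 q.2 ω‖ ^ 2).prodMk hd)
    rw [h0, lintegral_eq_zero_iff hm] at h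
    filter_upwards [h, M.ae_offset] with ω hω hy heq
    rw [Pi.zero_apply, Set.indicator_apply_eq_zero] at hω
    refine one_ne_zero (hω ⟨?_, ?_⟩)
    · simpa [Config.drop, config] using (hy j k).1
    · rw [Config.cellGain_drop (by simp) (by simp [q, hkl.symm]), ← heq, Config.cellGain, gain_eq]
      simp [Config.drop, config, q]
  have : ∀ᵐ ω ∂P, ∀ j k l, k ≠ l → (M.config ω).cellGain j k ≠ (M.config ω).cellGain j l := by
    simp only [ae_all_iff]
    exact key
  filter_upwards [this] with ω hω j k l h
  by_contra hkl
  exact hω j k l hkl h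

/-- The model allows any measurable maximiser, which might carry extra randomness. Ties being null,
it coincides with a fixed function of the configuration, to which the independence statements apply.
-/
lemma ae_kstar_eq_sel [IsProbabilityMeasure P] [NeZero K] :
    ∀ᵐ ω ∂P, ∀ j, M.kstar j ω = (M.config ω).sel j := by
  filter_upwards [M.ae_cellGain_injective, M.kstar_max] with ω hinj hmax j
  refine hinj j (le_antisymm (le_argmax _ _) (hmax j _))

lemma interference_eq [NeZero K] {ω : Ω} (h : ∀ j, M.kstar j ω = (M.config ω).sel j)
    (u : ℕ → Ω → Plane) (s : ℝ)
    (hu : ∀ j, u j ω = s • M.y j (M.kstar j ω) ω + M.x j ω) :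
    M.interference u ω = (M.config ω).interf s := by
  have h1 : (M.config ω).interf s = ∑' j, ({j | j ≠ 0} : Set ℕ).indicator (fun j =>
      gain (M.h 0 (some (j, M.kstar j ω)) ω) ‖u j ω - M.x 0 ω‖) j := by
    refine tsum_congr fun j => ?_
    rw [Set.indicator_apply]
    by_cases hj : j = 0 <;> simp [hj, config, hu, h]
  rw [h1, ← tsum_subtype]
  rfl

end Network

/-! ### Chebyshev quadrature -/

section Chebyshev

/-- In the angle variable the Chebyshev nodes are the midpoints of N equal subintervals, so the
quadrature is a midpoint Riemann sum and converges by uniform continuity. The summation index starts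
at 0, hence n + 1. -/
lemma tendsto_midpoint_sum {F : ℝ → ℝ} (hF : Continuous F) {L : ℝ} (hL : 0 < L) :
    Tendsto (fun N : ℕ => ∑ n ∈ Finset.range N,
      L / N * F ((2 * ((n : ℝ) + 1) - 1) / (2 * (N : ℝ)) * L)) atTop
      (𝓝 (∫ t in (0 : ℝ)..L, F t)) := by
  rw [Metric.tendsto_atTop]
  intro ε hε
  have huc : UniformContinuousOn F (Set.Icc 0 L) :=
    isCompact_Icc.uniformContinuousOn_of_continuous hF.continuousOn
  rw [Metric.uniformContinuousOn_iff] at huc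
  obtain ⟨δ, hδ, hδF⟩ := huc (ε / (2 * L)) (by positivity)
  obtain ⟨N₀, hN₀⟩ := exists_nat_gt (L / δ)
  refine ⟨N₀ + 1, fun N hN => ?_⟩
  have hNpos : (0 : ℝ) < N := by
    have : 0 < N := by omega
    exact_mod_cast this
  have hstep : L / N < δ := by
    rw [div_lt_iff₀ hNpos]
    rw [div_lt_iff₀ hδ] at hN₀
    have : (N₀ : ℝ) < N := by exact_mod_cast (by omega : N₀ < N)
    nlinarith
  have hsum : ∫ t in (0 : ℝ)..L, F t =
      ∑ n ∈ Finset.range N, ∫ t in (n : ℝ) * (L / N)..((n + 1 : ℕ) : ℝ) * (L / N), F t := by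
    rw [intervalIntegral.sum_integral_adjacent_intervals
      (fun k _ => hF.intervalIntegrable _ _)]
    congr 1
    · simp
    · field_simp
  rw [hsum, dist_eq_norm, ← Finset.sum_sub_distrib]
  refine lt_of_le_of_lt (norm_sum_le _ _) ?_
  have hterm : ∀ n ∈ Finset.range N, ‖L / N * F ((2 * ((n : ℝ) + 1) - 1) / (2 * (N : ℝ)) * L) -
      ∫ t in (n : ℝ) * (L / N)..((n + 1 : ℕ) : ℝ) * (L / N), F t‖ ≤ ε / (2 * L) * (L / N) := by
    intro n hn
    have hn' : ((n : ℝ) + 1) ≤ N := by exact_mod_cast Finset.mem_range.1 hn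
    set s := L / N with hs
    have hs0 : 0 < s := by positivity
    have hNs : N * s = L := by rw [hs]; field_simp
    set m := (2 * ((n : ℝ) + 1) - 1) / (2 * (N : ℝ)) * L with hm
    have hm' : m = ((n : ℝ) + 1 / 2) * s := by rw [hm, hs]; field_simp; ring
    have hconst : s * F m = ∫ t in (n : ℝ) * s..((n + 1 : ℕ) : ℝ) * s, F m := by
      rw [intervalIntegral.integral_const, smul_eq_mul]
      push_cast; ring
    rw [hconst, ← intervalIntegral.integral_sub (by simp) (hF.intervalIntegrable _ _)]
    refine (intervalIntegral.norm_integral_le_of_norm_le_const (C := ε / (2 * L)) ?_).trans ?_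
    · intro t ht
      rw [Set.uIoc_of_le (by push_cast; nlinarith)] at ht
      push_cast at ht
      have h1 : (n : ℝ) * s ≥ 0 := by positivity
      have h2 : ((n : ℝ) + 1) * s ≤ L := by rw [← hNs]; gcongr
      rw [← dist_eq_norm]
      refine (hδF m ⟨?_, ?_⟩ t ⟨?_, ?_⟩ ?_).le
      · rw [hm']; positivity
      · rw [hm']; nlinarith
      · linarith [ht.1]
      · linarith [ht.2]
      · rw [Real.dist_eq, hm', abs_lt]
        constructor <;> nlinarith [ht.1, ht.2]
    · rw [abs_of_nonneg (by push_cast; nlinarith)]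
      push_cast
      rw [show ((n : ℝ) + 1) * s - n * s = s by ring]
  refine lt_of_le_of_lt (Finset.sum_le_sum hterm) ?_
  rw [Finset.sum_const, Finset.card_range, nsmul_eq_mul]
  field_simp
  linarith

variable {N : ℕ}

lemma angle_mem (i : Fin N) : (2 * ((i : ℝ) + 1) - 1) / (2 * (N : ℝ)) * Real.pi ∈
    Set.Ioo 0 Real.pi := by
  have hi : ((i : ℝ) + 1) ≤ N := by exact_mod_cast i.2
  have hi0 : (0 : ℝ) ≤ i := by positivity
  constructor
  · have : 0 < 2 * ((i : ℝ) + 1) - 1 := by linarith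
    have : (0 : ℝ) < N := by linarith
    positivity
  · have hN : (0 : ℝ) < N := by linarith
    have : (2 * ((i : ℝ) + 1) - 1) / (2 * (N : ℝ)) < 1 := by
      rw [div_lt_one (by positivity)]; linarith
    nlinarith [Real.pi_pos]

lemma sqrt_one_sub_theta_sq (i : Fin N) :
    √(1 - theta N (i + 1) ^ 2) =
      Real.sin ((2 * ((i : ℝ) + 1) - 1) / (2 * (N : ℝ)) * Real.pi) := by
  have h := angle_mem i
  unfold theta
  push_cast
  rw [← Real.sin_sq, Real.sqrt_sq (Real.sin_nonneg_of_mem_Icc ⟨h.1.le, h.2.le⟩)]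

lemma neg_one_lt_theta (i : Fin N) : -1 < theta N (i + 1) := by
  have h := angle_mem i
  unfold theta
  push_cast
  rw [← Real.cos_pi]
  exact Real.cos_lt_cos_of_nonneg_of_le_pi h.1.le le_rfl h.2

lemma weight_nonneg (i : Fin N) : 0 ≤ weight N (i + 1) := by
  have := neg_one_lt_theta i
  have : 0 ≤ theta N (i + 1) + 1 := by linarith
  unfold weight
  have := Real.pi_pos
  positivity

lemma weight_le (i : Fin N) : weight N (i + 1) ≤ Real.pi / N := by
  have h1 : theta N (i + 1) + 1 ≤ 2 := by
    have := Real.cos_le_one ((2 * (((i : ℕ) + 1 : ℕ) : ℝ) - 1) / (2 * (N : ℝ)) * Real.pi)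
    unfold theta; linarith
  have h0 := neg_one_lt_theta i
  have h2 : √(1 - theta N (i + 1) ^ 2) ≤ 1 := by
    rw [sqrt_one_sub_theta_sq]; exact Real.sin_le_one _
  unfold weight
  calc Real.pi / (2 * N) * √(1 - theta N (i + 1) ^ 2) * (theta N (i + 1) + 1)
      ≤ Real.pi / (2 * N) * 1 * 2 := by
        have := Real.pi_pos
        gcongr
        linarith
    _ = Real.pi / N := by ring

lemma node_pos {Rc : ℝ} (hRc : 0 < Rc) (i : Fin N) : 0 < node Rc N (i + 1) := by
  have := neg_one_lt_theta i
  have : 0 < Rc / 2 * theta N (i + 1) + Rc / 2 := by nlinarith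
  unfold node
  positivity

lemma nodeT_zero (Rc : ℝ) : nodeT Rc N 0 = 0 := by simp [nodeT]

lemma nodeT_succ (Rc : ℝ) (i : Fin N) : nodeT Rc N i.succ = node Rc N (i + 1) := by
  simp [nodeT, Fin.succ_ne_zero]

lemma weightT_zero : weightT N 0 = 1 := by simp [weightT]

lemma weightT_succ (i : Fin N) : weightT N i.succ = -weight N (i + 1) := by
  simp [weightT, Fin.succ_ne_zero]

lemma nodeT_nonneg {Rc : ℝ} (hRc : 0 < Rc) (n : Fin (N + 1)) : 0 ≤ nodeT Rc N n := by
  induction n using Fin.cases with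
  | zero => rw [nodeT_zero]
  | succ i => rw [nodeT_succ]; exact (node_pos hRc i).le

lemma muOf_eq (Rc : ℝ) (k : Fin (N + 1) → ℕ) : muOf Rc N k = ∑ n, (k n : ℝ) * nodeT Rc N n := by
  rw [muOf, Finset.sum_filter]
  refine Finset.sum_congr rfl fun n _ => ?_
  by_cases h : k n = 0 <;> simp [h]

/-- k 0 ≠ K forces a nonzero multiplicity at some index n ≥ 1, and all those nodes are positive. The
excluded tuple is the one with μ = 0. -/
lemma muOf_pos {Rc : ℝ} (hRc : 0 < Rc) {K : ℕ} {k : Fin (N + 1) → ℕ} (hk : k ∈ tuples K N) :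
    0 < muOf Rc N k := by
  rw [tuples, Finset.mem_filter, Finset.mem_piAntidiag] at hk
  obtain ⟨⟨hsum, -⟩, h0⟩ := hk
  rw [muOf_eq]
  have : ∃ i : Fin N, k i.succ ≠ 0 := by
    by_contra! h
    rw [Fin.sum_univ_succ] at hsum
    simp [h] at hsum
    exact h0 hsum
  obtain ⟨i, hi⟩ := this
  refine Finset.sum_pos' (fun n _ => mul_nonneg (by positivity) (nodeT_nonneg hRc n))
    ⟨i.succ, Finset.mem_univ _, ?_⟩
  rw [nodeT_succ]
  exact mul_pos (by exact_mod_cast Nat.pos_of_ne_zero hi) (node_pos hRc i)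

/-- The quadrature approximation to the probability that a user's composite gain is below `t`. -/
def chebyshevSum (Rc : ℝ) (N : ℕ) (t : ℝ≥0∞) : ℝ :=
  ∑ n : Fin (N + 1), weightT N n * (expNeg (ENNReal.ofReal (nodeT Rc N n) * t)).toReal

lemma chebyshevSum_eq (Rc : ℝ) (N : ℕ) (t : ℝ≥0∞) :
    chebyshevSum Rc N t = 1 - ∑ i : Fin N, weight N (i + 1) *
      (expNeg (ENNReal.ofReal (node Rc N (i + 1)) * t)).toReal := by
  rw [chebyshevSum, Fin.sum_univ_succ, nodeT_zero, weightT_zero]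
  simp only [nodeT_succ, weightT_succ, ENNReal.ofReal_zero, zero_mul, expNeg_zero,
    ENNReal.toReal_one, mul_one, neg_mul, Finset.sum_neg_distrib, sub_eq_add_neg]

lemma expNeg_toReal_le_one (t : ℝ≥0∞) : (expNeg t).toReal ≤ 1 := by
  simpa using ENNReal.toReal_mono ENNReal.one_ne_top (expNeg_le_one t)

/-- Each of the N weights is at most π/N. The bound is crude but uniform in N and t, as dominated
convergence requires. -/
lemma abs_chebyshevSum_le (Rc : ℝ) (N : ℕ) (t : ℝ≥0∞) :
    |chebyshevSum Rc N t| ≤ 1 + Real.pi := by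
  have h0 : 0 ≤ ∑ i : Fin N, weight N (i + 1) *
      (expNeg (ENNReal.ofReal (node Rc N (i + 1)) * t)).toReal :=
    Finset.sum_nonneg fun i _ => mul_nonneg (weight_nonneg i) ENNReal.toReal_nonneg
  have h1 : ∑ i : Fin N, weight N (i + 1) *
      (expNeg (ENNReal.ofReal (node Rc N (i + 1)) * t)).toReal ≤ Real.pi := by
    calc _ ≤ ∑ i : Fin N, Real.pi / N := Finset.sum_le_sum fun i _ => by
            refine (mul_le_of_le_one_right (weight_nonneg i) (expNeg_toReal_le_one _)).trans
              (weight_le i)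
      _ ≤ Real.pi := by
          rw [Finset.sum_const, Finset.card_univ, Fintype.card_fin, nsmul_eq_mul]
          rcases eq_or_ne (N : ℝ) 0 with h | h
          · rw [h]; simp [Real.pi_nonneg]
          · exact (mul_div_cancel₀ _ h).le
  rw [chebyshevSum_eq, abs_le]
  constructor <;> linarith [Real.pi_pos]

lemma measurable_chebyshevSum (Rc : ℝ) (N : ℕ) : Measurable (chebyshevSum Rc N) := by
  unfold chebyshevSum
  fun_prop

/-- The multinomial theorem. The artificial index 0 has weight 1 and node 0, so the tuple (K, 0, …,
0) contributes exactly 1 and cancels. -/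
lemma one_sub_chebyshevSum_pow {Rc : ℝ} (hRc : 0 < Rc) (K N : ℕ) (t : ℝ≥0∞) :
    1 - chebyshevSum Rc N t ^ K = -∑ k ∈ tuples K N, (Nat.multinomial Finset.univ k : ℝ) *
      (∏ n with k n ≠ 0, weightT N n ^ k n) *
        (expNeg (ENNReal.ofReal (muOf Rc N k) * t)).toReal := by
  have hterm : ∀ k : Fin (N + 1) → ℕ,
      ∏ n, (weightT N n * (expNeg (ENNReal.ofReal (nodeT Rc N n) * t)).toReal) ^ k n =
        (∏ n with k n ≠ 0, weightT N n ^ k n) *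
          (expNeg (ENNReal.ofReal (muOf Rc N k) * t)).toReal := by
    intro k
    have h1 : ∏ n, weightT N n ^ k n = ∏ n with k n ≠ 0, weightT N n ^ k n := by
      rw [Finset.prod_filter]
      refine Finset.prod_congr rfl fun n _ => ?_
      by_cases h : k n = 0 <;> simp [h]
    simp_rw [mul_pow, Finset.prod_mul_distrib, h1]
    congr 1
    rw [muOf_eq, ENNReal.ofReal_sum_of_nonneg
      (fun n _ => mul_nonneg (by positivity) (nodeT_nonneg hRc n)), Finset.sum_mul,
      expNeg_finset_sum, ENNReal.toReal_prod]
    refine Finset.prod_congr rfl fun n _ => ?_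
    rw [ENNReal.ofReal_mul (by positivity), ENNReal.ofReal_natCast, mul_assoc,
      expNeg_natCast_mul, ENNReal.toReal_pow]
  have hsplit : (Finset.piAntidiag (Finset.univ : Finset (Fin (N + 1))) K).filter
      (fun k => ¬ k 0 ≠ K) = {Pi.single 0 K} := by
    ext k
    simp only [Finset.mem_filter, Finset.mem_piAntidiag, Finset.mem_singleton, not_not]
    constructor
    · rintro ⟨⟨hs, -⟩, h0⟩
      rw [Fin.sum_univ_succ, h0] at hs
      have hz : ∑ i : Fin N, k i.succ = 0 := by omega
      ext n
      induction n using Fin.cases with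
      | zero => simp [h0]
      | succ i =>
        have := (Finset.sum_eq_zero_iff.1 hz) i (Finset.mem_univ _)
        simp [this, Fin.succ_ne_zero]
    · rintro rfl
      simp
  rw [chebyshevSum, Finset.sum_pow_eq_sum_piAntidiag,
    ← Finset.sum_filter_add_sum_filter_not _ (fun k : Fin (N + 1) → ℕ => k 0 ≠ K), hsplit,
    Finset.sum_singleton]
  have hone : (Nat.multinomial Finset.univ (Pi.single 0 K : Fin (N + 1) → ℕ) : ℝ) *
      ∏ n, (weightT N n * (expNeg (ENNReal.ofReal (nodeT Rc N n) * t)).toReal) ^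
        (Pi.single 0 K : Fin (N + 1) → ℕ) n = 1 := by
    rw [Fin.prod_univ_succ]
    simp [weightT_zero, nodeT_zero, expNeg_zero, Fin.succ_ne_zero, Nat.multinomial,
      Nat.div_self (Nat.factorial_pos _), Fin.prod_univ_succ]
  rw [hone]
  simp only [tuples, hterm, mul_assoc]
  ring

/-- The integral to which the quadrature sums converge. -/
lemma lintegral_cond_closedBall {Rc z : ℝ} (hRc : 0 < Rc) (hz : 0 ≤ z) :
    ∫⁻ v, expNeg (ENNReal.ofReal z * ENNReal.ofReal (‖v‖ ^ 4))
        ∂(ProbabilityTheory.cond volume (Metric.closedBall (0 : Plane) Rc)) =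
      ENNReal.ofReal (∫ t in (0 : ℝ)..Real.pi, 1 / 2 * Real.sin t * (1 + Real.cos t) *
        Real.exp (-(z * (Rc / 2 * Real.cos t + Rc / 2) ^ 4))) := by
  -- The substitution r = Rc(1 + cos t)/2 turns the angular integral into the radial mean 2/Rc² ∫ r
  -- exp(-z r⁴) over the disk.
  have hsub : ∫ t in (0 : ℝ)..Real.pi, 1 / 2 * Real.sin t * (1 + Real.cos t) *
        Real.exp (-(z * (Rc / 2 * Real.cos t + Rc / 2) ^ 4)) =
      2 / Rc ^ 2 * ∫ r in (0 : ℝ)..Rc, r * Real.exp (-(z * r ^ 4)) := by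
    have h := intervalIntegral.integral_comp_mul_deriv (a := 0) (b := Real.pi)
      (f := fun t => Rc / 2 * Real.cos t + Rc / 2) (f' := fun t => Rc / 2 * (-Real.sin t))
      (g := fun r => r * Real.exp (-(z * r ^ 4)))
      (fun t _ => ((Real.hasDerivAt_cos t).const_mul _).add_const _)
      (by fun_prop) (by fun_prop)
    simp only [Real.cos_zero, Real.cos_pi] at h
    rw [show Rc / 2 * 1 + Rc / 2 = Rc by ring, show Rc / 2 * -1 + Rc / 2 = 0 by ring,
      intervalIntegral.integral_symm 0 Rc, eq_comm, neg_eq_iff_eq_neg] at h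
    rw [h, ← intervalIntegral.integral_neg, ← intervalIntegral.integral_const_mul]
    refine intervalIntegral.integral_congr fun t _ => ?_
    simp only [Function.comp]
    field_simp
    ring
  have hvol : volume (Metric.closedBall (0 : Plane) Rc) = ENNReal.ofReal (Real.pi * Rc ^ 2) := by
    rw [EuclideanSpace.volume_closedBall_fin_two, ENNReal.ofReal_mul Real.pi_nonneg,
      ENNReal.ofReal_pow hRc.le, mul_comm]
  have hI0 : 0 ≤ ∫ r in (0 : ℝ)..Rc, r * Real.exp (-(z * r ^ 4)) :=
    intervalIntegral.integral_nonneg hRc.le fun r hr => mul_nonneg hr.1 (Real.exp_pos _).le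
  rw [hsub, ProbabilityTheory.cond, lintegral_smul_measure, hvol,
    ← lintegral_indicator measurableSet_closedBall]
  have hfun : ∀ v : Plane, (Metric.closedBall (0 : Plane) Rc).indicator
      (fun v => expNeg (ENNReal.ofReal z * ENNReal.ofReal (‖v‖ ^ 4))) v =
      ENNReal.ofReal ((Set.Iic Rc).indicator (fun r => Real.exp (-(z * r ^ 4))) ‖v‖) := by
    intro v
    by_cases h : ‖v‖ ≤ Rc
    · rw [Set.indicator_of_mem (by simpa using h), Set.indicator_of_mem (by simpa using h),
        ← ENNReal.ofReal_mul hz, expNeg_ofReal (by positivity)]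
    · rw [Set.indicator_of_notMem (by simpa using h), Set.indicator_of_notMem (by simpa using h),
        ENNReal.ofReal_zero]
  have hmul : (fun r => r * (Set.Iic Rc).indicator (fun r => Real.exp (-(z * r ^ 4))) r) =
      (Set.Iic Rc).indicator fun r => r * Real.exp (-(z * r ^ 4)) := by
    ext r
    by_cases h : r ∈ Set.Iic Rc <;> simp [h]
  have hset : Set.Ioi (0 : ℝ) ∩ Set.Iic Rc = Set.Ioc 0 Rc := rfl
  simp_rw [hfun]
  rw [lintegral_radial, hmul, setIntegral_indicator measurableSet_Iic, hset,
    ← intervalIntegral.integral_of_le hRc.le, smul_eq_mul, ← ENNReal.ofReal_inv_of_pos (by positivity),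
    ← ENNReal.ofReal_mul (by positivity)]
  · congr 1
    have := Real.pi_pos
    generalize ∫ r in (0 : ℝ)..Rc, r * Real.exp (-(z * r ^ 4)) = J
    field_simp
  · exact fun r _ => Set.indicator_nonneg (fun _ _ => (Real.exp_pos _).le) _
  · rw [hmul, integrableOn_indicator_iff measurableSet_Iic, Set.inter_comm, hset]
    exact (Continuous.integrableOn_Icc (by fun_prop)).mono_set Set.Ioc_subset_Icc_self
  · exact Set.indicator_nonneg (fun _ _ => (Real.exp_pos _).le) _

lemma tendsto_chebyshevSum {Rc : ℝ} (hRc : 0 < Rc) (t : ℝ≥0∞) :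
    Tendsto (fun N => chebyshevSum Rc N t) atTop
      (𝓝 (1 - (∫⁻ v, expNeg (t * ENNReal.ofReal (‖v‖ ^ 4))
        ∂(ProbabilityTheory.cond volume (Metric.closedBall (0 : Plane) Rc))).toReal)) := by
  simp_rw [chebyshevSum_eq]
  refine Tendsto.const_sub _ ?_
  -- At an infinite threshold every quadrature term vanishes because the nodes are positive, and the
  -- limiting integral vanishes because the centre of the disk is a null set.
  rcases eq_or_ne t ⊤ with rfl | ht
  · have h0 : ∀ N : ℕ, ∑ i : Fin N, weight N (i + 1) *
        (expNeg (ENNReal.ofReal (node Rc N (i + 1)) * ⊤)).toReal = 0 := fun N =>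
      Finset.sum_eq_zero fun i _ => by
        rw [ENNReal.mul_top (by simpa using node_pos hRc i), expNeg_top]; simp
    have h1 : ∫⁻ v, expNeg (⊤ * ENNReal.ofReal (‖v‖ ^ 4))
        ∂(ProbabilityTheory.cond volume (Metric.closedBall (0 : Plane) Rc)) = 0 := by
      refine lintegral_eq_zero_of_ae_eq_zero ?_
      have h2 : ∀ᵐ v ∂(ProbabilityTheory.cond volume (Metric.closedBall (0 : Plane) Rc)),
          v ≠ 0 := by
        rw [ae_iff]
        exact cond_absolutelyContinuous (by simp)
      filter_upwards [h2] with v hv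
      have : 0 < ‖v‖ := norm_pos_iff.2 hv
      rw [ENNReal.top_mul (by positivity), expNeg_top, Pi.zero_apply]
    rw [h1]
    simp [h0]
  · lift t to ℝ≥0 using ht
    rw [← ENNReal.ofReal_coe_nnreal, lintegral_cond_closedBall hRc t.coe_nonneg,
      ENNReal.toReal_ofReal (intervalIntegral.integral_nonneg Real.pi_nonneg fun s hs =>
        mul_nonneg (mul_nonneg (by have := Real.sin_nonneg_of_mem_Icc hs; positivity)
          (by linarith [Real.neg_one_le_cos s])) (Real.exp_pos _).le)]
    refine (tendsto_midpoint_sum (F := fun s => 1 / 2 * Real.sin s * (1 + Real.cos s) *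
        Real.exp (-(t * (Rc / 2 * Real.cos s + Rc / 2) ^ 4))) (by fun_prop) Real.pi_pos).congr
      fun N => ?_
    rw [Finset.sum_range]
    refine Finset.sum_congr rfl fun i _ => ?_
    rw [← ENNReal.ofReal_mul (node_pos hRc i).le,
      expNeg_ofReal (mul_nonneg (node_pos hRc i).le t.coe_nonneg),
      ENNReal.toReal_ofReal (Real.exp_pos _).le, weight, sqrt_one_sub_theta_sq, node, theta]
    push_cast
    ring_nf

end Chebyshev

/-! ### Integrating out the fading -/

section Fading

variable {Ω : Type*} [MeasurableSpace Ω] {P : Measure Ω}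

/-- Independence handles the partial sums; dominated convergence passes to the infinite sum, which
may be ∞. -/
lemma lintegral_expNeg_tsum {X : ℕ → Ω → ℝ≥0∞} (hX : iIndepFun X P) (hm : ∀ j, Measurable (X j))
    {W : ℕ → ℝ≥0∞} (hW : ∀ j, ∫⁻ ω, expNeg (X j ω) ∂P = expNeg (W j)) :
    ∫⁻ ω, expNeg (∑' j, X j ω) ∂P = expNeg (∑' j, W j) := by
  have := hX.isProbabilityMeasure
  have h1 : Tendsto (fun n => ∫⁻ ω, expNeg (∑ j ∈ Finset.range n, X j ω) ∂P) atTop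
      (𝓝 (∫⁻ ω, expNeg (∑' j, X j ω) ∂P)) := by
    refine tendsto_lintegral_of_dominated_convergence (fun _ => 1) (fun n => by fun_prop)
      (fun n => Eventually.of_forall fun ω => expNeg_le_one _) (by simp)
      (Eventually.of_forall fun ω => ?_)
    exact (continuous_expNeg.tendsto _).comp ENNReal.summable.hasSum.tendsto_sum_nat
  have h2 : ∀ n, ∫⁻ ω, expNeg (∑ j ∈ Finset.range n, X j ω) ∂P =
      expNeg (∑ j ∈ Finset.range n, W j) := by
    intro n
    simp_rw [expNeg_finset_sum, ← hW]
    exact lintegral_prod_eq_prod_lintegral_of_indepFun _ (fun j ω => expNeg (X j ω))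
      (hX.comp (fun _ => expNeg) fun _ => measurable_expNeg) fun j => (hm j).expNeg
  simp_rw [h2] at h1
  exact tendsto_nhds_unique h1
    ((continuous_expNeg.tendsto _).comp ENNReal.summable.hasSum.tendsto_sum_nat)

/-- The Laplace transform of the power received over a link of length `r`. -/
lemma lintegral_expNeg_gain {ξ : ℝ} (hξ : 0 < ξ) (r : ℝ) :
    ∫⁻ t, expNeg (ENNReal.ofReal ξ * (ENNReal.ofReal t / ENNReal.ofReal (r ^ 4)))
        ∂(expMeasure 1) = ENNReal.ofReal (r ^ 4 / (ξ + r ^ 4)) := by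
  rcases eq_or_ne r 0 with rfl | hr
  · simp only [ne_eq, OfNat.ofNat_ne_zero, not_false_eq_true, zero_pow, ENNReal.ofReal_zero,
      zero_div]
    refine lintegral_eq_zero_of_ae_eq_zero ?_
    filter_upwards [expMeasure_ae_pos] with t ht
    rw [ENNReal.div_zero (by positivity), ENNReal.mul_top (by positivity), expNeg_top, Pi.zero_apply]
  · have hr4 : 0 < r ^ 4 := by positivity
    have h := lintegral_expMeasure_exp (s := ξ / r ^ 4) (b := 0) (by positivity) le_rfl
    rw [mul_zero, neg_zero, Real.exp_zero] at h
    rw [show r ^ 4 / (ξ + r ^ 4) = 1 / (1 + ξ / r ^ 4) by field_simp; ring, ← h]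
    refine lintegral_congr_ae ?_
    filter_upwards [expMeasure_ae_pos] with t ht
    rw [Set.indicator_of_mem (by exact ht.le), ← ENNReal.ofReal_div_of_pos hr4,
      ← ENNReal.ofReal_mul hξ.le, expNeg_ofReal (by positivity)]
    congr 3
    ring

lemma expNeg_fadingWeight {ξ : Plane → ℝ} {x : Plane} (hξ : 0 < ξ x) (y : Plane) :
    expNeg (fadingWeight ξ x y) = ENNReal.ofReal (‖y - x‖ ^ 4 / (ξ x + ‖y - x‖ ^ 4)) := by
  have h := one_sub_expNeg_fadingWeight hξ y
  have h1 := ENNReal.sub_sub_cancel ENNReal.one_ne_top (expNeg_le_one (fadingWeight ξ x y))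
  rw [← h1, h, ← ENNReal.ofReal_one, ← ENNReal.ofReal_sub _ (by positivity)]
  congr 1
  have : 0 < ξ x + ‖y - x‖ ^ 4 := by positivity
  field_simp
  ring

/-- Integrating out the fading of the CoMP user's signal at distance `d`, over the event that it
is received with power at least `ε₀ * (J + n)`. -/
lemma lintegral_power_ge {φ ε₀ ε₁ μ d : ℝ} (hφ : 0 < φ) (hε₀ : 0 < ε₀) (hε₁ : 0 < ε₁)
    (hμ : 0 < μ) (hd : 0 < d) (J : ℝ≥0∞) :
    ∫⁻ t, {t | ENNReal.ofReal ε₀ * J ≤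
        ENNReal.ofReal φ * (ENNReal.ofReal t / ENNReal.ofReal (d ^ 4))}.indicator
        (fun t => expNeg (ENNReal.ofReal μ * (ENNReal.ofReal ε₁ *
          (ENNReal.ofReal φ * (ENNReal.ofReal t / ENNReal.ofReal (d ^ 4)) + J)))) t
        ∂(expMeasure 1) =
      ENNReal.ofReal (d ^ 4 / (φ * ε₁ * μ + d ^ 4)) *
        expNeg (ENNReal.ofReal (xi φ ε₀ ε₁ μ d) * J) := by
  have hd4 : 0 < d ^ 4 := by positivity
  have hxi : 0 < xi φ ε₀ ε₁ μ d := by unfold xi; positivity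
  -- Infinite interference makes the event impossible, and the right side vanishes too.
  rcases eq_or_ne J ⊤ with rfl | hJ
  · rw [ENNReal.mul_top (a := ENNReal.ofReal (xi φ ε₀ ε₁ μ d)) (by positivity), expNeg_top,
      mul_zero, ENNReal.mul_top (by positivity)]
    refine lintegral_eq_zero_of_ae_eq_zero (Eventually.of_forall fun t => ?_)
    refine Set.indicator_of_notMem (fun h => ?_) _
    exact (ENNReal.mul_lt_top ENNReal.ofReal_lt_top
      (ENNReal.div_lt_top ENNReal.ofReal_ne_top (by positivity))).not_ge h
  · lift J to ℝ≥0 using hJ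
    obtain ⟨a, ha⟩ : ∃ a : ℝ, a = J := ⟨_, rfl⟩
    have ha0 : 0 ≤ a := ha ▸ J.coe_nonneg
    rw [← ENNReal.ofReal_coe_nnreal, ← ha]
    -- Once exp(-με₁a) is taken out, the variable t is weighted by exp(-st) on t ≥ b. The exponents
    -- combine as με₁a + (1 + s)b = ξ(d) a, which is where ξ comes from.
    have h := lintegral_expMeasure_exp (s := μ * ε₁ * φ / d ^ 4) (b := ε₀ * a * d ^ 4 / φ)
      (by positivity) (by positivity)
    have hrhs : ENNReal.ofReal (d ^ 4 / (φ * ε₁ * μ + d ^ 4)) *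
        expNeg (ENNReal.ofReal (xi φ ε₀ ε₁ μ d) * ENNReal.ofReal a) =
        ENNReal.ofReal (Real.exp (-(μ * ε₁ * a))) *
        ENNReal.ofReal (Real.exp (-((1 + μ * ε₁ * φ / d ^ 4) * (ε₀ * a * d ^ 4 / φ))) /
          (1 + μ * ε₁ * φ / d ^ 4)) := by
      rw [← ENNReal.ofReal_mul hxi.le, expNeg_ofReal (by positivity),
        ← ENNReal.ofReal_mul (by positivity), ← ENNReal.ofReal_mul (by positivity),
        mul_div_assoc', ← Real.exp_add]
      congr 1
      have : -(μ * ε₁ * a) + -((1 + μ * ε₁ * φ / d ^ 4) * (ε₀ * a * d ^ 4 / φ)) =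
          -(xi φ ε₀ ε₁ μ d * a) := by
        unfold xi; field_simp; ring
      rw [this]
      field_simp
      ring
    rw [hrhs, ← h, ← lintegral_const_mul' _ _ ENNReal.ofReal_ne_top]
    refine lintegral_congr_ae ?_
    filter_upwards [expMeasure_ae_pos] with t ht
    have hiff : ENNReal.ofReal ε₀ * ENNReal.ofReal a ≤
        ENNReal.ofReal φ * (ENNReal.ofReal t / ENNReal.ofReal (d ^ 4)) ↔
        ε₀ * a * d ^ 4 / φ ≤ t := by
      rw [← ENNReal.ofReal_div_of_pos hd4, ← ENNReal.ofReal_mul hε₀.le, ← ENNReal.ofReal_mul hφ.le,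
        ENNReal.ofReal_le_ofReal_iff (by positivity), mul_div_assoc', le_div_iff₀ hd4,
        div_le_iff₀ hφ, mul_comm φ]
    by_cases hb : ε₀ * a * d ^ 4 / φ ≤ t
    · rw [Set.indicator_of_mem (by exact hiff.2 hb), Set.indicator_of_mem (by exact hb),
        ← ENNReal.ofReal_div_of_pos hd4, ← ENNReal.ofReal_mul hφ.le,
        ← ENNReal.ofReal_add (by positivity) ha0, ← ENNReal.ofReal_mul hε₁.le,
        ← ENNReal.ofReal_mul hμ.le, expNeg_ofReal (by positivity),
        ← ENNReal.ofReal_mul (by positivity), ← Real.exp_add]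
      congr 2
      field_simp
      ring
    · rw [Set.indicator_of_notMem (s := {t | _ ≤ _}) (by exact fun h' => hb (hiff.1 h')),
        Set.indicator_of_notMem (s := Set.Ici _) (by exact hb), mul_zero]

end Fading

namespace Network

variable {Ω : Type*} [MeasurableSpace Ω] {K : ℕ} {lam Rc : ℝ} {P : Measure Ω}
  (M : Network K lam Rc P)

lemma lintegral_comp_gain (q : ℕ × Option (ℕ × Fin K)) (r : ℝ) {f : ℝ≥0∞ → ℝ≥0∞}
    (hf : Measurable f) :
    ∫⁻ ω, f (gain (M.h q.1 q.2 ω) r) ∂P =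
      ∫⁻ t, f (ENNReal.ofReal t / ENNReal.ofReal (r ^ 4)) ∂(expMeasure 1) := by
  have hq := M.h_measurable q.1 q.2
  rw [← M.h_rayleigh q.1 q.2, lintegral_map (by fun_prop) (by fun_prop)]
  simp_rw [gain_eq]

/-- The Laplace transform of the interference, for fixed base stations and selected users. -/
lemma lintegral_expNeg_tsum_gain [IsProbabilityMeasure P] (κ : ℕ → Fin K) {ξ : Plane → ℝ}
    (x : ℕ → Plane) (hξ : 0 < ξ (x 0)) :
    ∫⁻ ω, expNeg (ENNReal.ofReal (ξ (x 0)) * ∑' j, if j = 0 then 0 else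
        gain (M.h 0 (some (j, κ j)) ω) ‖x j - x 0‖) ∂P =
      expNeg (∑' j, if j = 0 then 0 else fadingWeight ξ (x 0) (x j)) := by
  simp_rw [← ENNReal.tsum_mul_left]
  have hinj : Function.Injective fun j : ℕ => ((0, some (j, κ j)) : ℕ × Option (ℕ × Fin K)) := by
    intro i j h
    simpa using (Prod.ext_iff.1 (Option.some_injective _ (Prod.ext_iff.1 h).2)).1
  have hind := (M.h_indep.precomp hinj).comp
    (fun j h => ENNReal.ofReal (ξ (x 0)) * if j = 0 then 0 else gain h ‖x j - x 0‖) (fun j => by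
      by_cases hj : j = 0
      · simp [hj]
      · simp only [hj, if_false]
        exact (measurable_gain_comp measurable_id measurable_const).const_mul _)
  refine lintegral_expNeg_tsum hind (fun j => ?_) fun j => ?_
  · have := M.h_measurable 0 (some (j, κ j))
    by_cases hj : j = 0
    · simp [hj, Function.comp_def]
    · simp only [hj, if_false, Function.comp_def]
      exact (measurable_gain_comp this measurable_const).const_mul _
  · by_cases hj : j = 0
    · simp [hj, expNeg_zero]
    · simp only [hj, if_false, Function.comp_def]
      rw [expNeg_fadingWeight hξ, ← lintegral_expNeg_gain hξ]
      exact M.lintegral_comp_gain (0, some (j, κ j)) ‖x j - x 0‖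
        (f := fun v => expNeg (ENNReal.ofReal (ξ (x 0)) * v)) (by fun_prop)

/-- User selection in cluster j ≠ 0 uses the links to base station j, whereas the interference uses
the links to base station 0. Hence the latter fading is still independent and exponential once the
selected users are fixed, and selection does not bias it. With zero offsets the distances involve
only base stations. -/
lemma lintegral_expNeg_interf [IsProbabilityMeasure P] [NeZero K] {F Ξ : ℝ → ℝ}
    (hF : Measurable F) (hΞ : Measurable Ξ) (hΞ0 : ∀ d, 0 < Ξ d) :
    ∫⁻ ω, ENNReal.ofReal (F ‖M.x 0 ω‖) *
        expNeg (ENNReal.ofReal (Ξ ‖M.x 0 ω‖) * (M.config ω).interf 0) ∂P =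
      ∫⁻ ω, ENNReal.ofReal (F ‖M.x 0 ω‖) * expNeg (∑' i, if i = 0 then 0 else
        fadingWeight (fun y => Ξ ‖y‖) (M.x 0 ω) (M.x i ω)) ∂P := by
  let T : Set (ℕ × Option (ℕ × Fin K)) := {q | ∃ j ≠ 0, ∃ k, q = (0, some (j, k))}
  have hTj : ∀ j ≠ 0, ∀ k, (j, some (j, k)) ∉ T := by
    rintro j hj k ⟨i, -, l, h⟩
    exact hj (Prod.ext_iff.1 h).1
  let Φ : ((ℕ × Fin K → Plane) × (ℕ × Option (ℕ × Fin K) → ℂ)) × Config K → ℝ≥0∞ := fun p =>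
    ENNReal.ofReal (F ‖p.2.1 0‖) * expNeg (ENNReal.ofReal (Ξ ‖p.2.1 0‖) *
      ∑' j, if j = 0 then 0 else gain (p.1.2 (0, some (j, p.2.sel j))) ‖p.2.1 j - p.2.1 0‖)
  have hΦ : Measurable Φ := by
    have hs : Measurable fun p : ((ℕ × Fin K → Plane) × (ℕ × Option (ℕ × Fin K) → ℂ)) × Config K =>
        ∑' j, if j = 0 then 0 else
          gain (p.1.2 (0, some (j, p.2.sel j))) ‖p.2.1 j - p.2.1 0‖ := by
      refine Measurable.tsum fun j => ?_
      by_cases hj : j = 0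
      · simp [hj]
      · simp only [hj, if_false]
        exact Config.measurable_apply_sel (f := fun (p : ((ℕ × Fin K → Plane) ×
          (ℕ × Option (ℕ × Fin K) → ℂ)) × Config K) k =>
          gain (p.1.2 (0, some (j, k))) ‖p.2.1 j - p.2.1 0‖)
          (fun k => measurable_gain_comp (by fun_prop) (by fun_prop))
          ((Config.measurable_sel j).comp measurable_snd)
    fun_prop
  have h := lintegral_indepFun ((Config.measurable_keep ∅ T).comp M.measurable_config)
    ((Config.measurable_drop ∅ T).comp M.measurable_config) (M.indepFun_keep_drop ∅ T) hΦ
  have hl : ∀ ω, Φ ((Config.keep ∅ T ∘ M.config) ω, (Config.drop ∅ T ∘ M.config) ω) =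
      ENNReal.ofReal (F ‖M.x 0 ω‖) *
        expNeg (ENNReal.ofReal (Ξ ‖M.x 0 ω‖) * (M.config ω).interf 0) := by
    intro ω
    simp only [Φ, Function.comp]
    rw [Config.interf]
    congr 3
    refine tsum_congr fun j => ?_
    by_cases hj : j = 0
    · simp [hj]
    · have hmem : ∀ k, ((0, some (j, k)) : ℕ × Option (ℕ × Fin K)) ∈ T := fun k => ⟨j, hj, k, rfl⟩
      rw [if_neg hj, if_neg hj, Config.sel_drop (by simp) (hTj j hj)]
      simp [Config.keep, Config.drop, hmem]
  have hr : ∀ ω, ∫⁻ u, Φ (u, (Config.drop ∅ T ∘ M.config) ω)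
      ∂(P.map (Config.keep ∅ T ∘ M.config)) = ENNReal.ofReal (F ‖M.x 0 ω‖) *
        expNeg (∑' i, if i = 0 then 0 else
          fadingWeight (fun y => Ξ ‖y‖) (M.x 0 ω) (M.x i ω)) := by
    intro ω
    have hΦω : Measurable fun u => Φ (u, (Config.drop ∅ T ∘ M.config) ω) := by fun_prop
    rw [lintegral_map hΦω ((Config.measurable_keep ∅ T).comp M.measurable_config)]
    simp only [Φ, Function.comp]
    rw [lintegral_const_mul' _ _ ENNReal.ofReal_ne_top]
    have hx : ∀ j, ((M.config ω).drop ∅ T).1 j = M.x j ω := fun j => rfl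
    simp only [hx]
    congr 1
    rw [← M.lintegral_expNeg_tsum_gain (fun j => (M.config ω).sel j) (ξ := fun y => Ξ ‖y‖)
      (fun j => M.x j ω) (hΞ0 _)]
    refine lintegral_congr fun ω' => ?_
    congr 2
    refine tsum_congr fun j => ?_
    by_cases hj : j = 0
    · simp [hj]
    · have hmem : ∀ k, ((0, some (j, k)) : ℕ × Option (ℕ × Fin K)) ∈ T := fun k => ⟨j, hj, k, rfl⟩
      rw [if_neg hj, if_neg hj, Config.sel_drop (by simp) (hTj j hj)]
      simp [Config.keep, hmem, config]
  simp_rw [hl, hr] at h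
  exact h

/-- The distribution of the largest composite gain in the cluster of the nearest base station. -/
lemma measure_forall_cellGain_lt [IsProbabilityMeasure P] (t : ℝ≥0∞) :
    P {ω | ∀ k, (M.config ω).cellGain 0 k < t} =
      (1 - ∫⁻ v, expNeg (t * ENNReal.ofReal (‖v‖ ^ 4))
        ∂(ProbabilityTheory.cond volume (Metric.closedBall (0 : Plane) Rc))) ^ K := by
  classical
  have hprob := isProbabilityMeasure_expMeasure (r := 1) one_pos
  let f : ℂ → Plane → ℝ≥0∞ := fun h v => {h | gain h ‖v‖ < t}.indicator 1 h
  have hf : Measurable (Function.uncurry f) := by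
    have hs : MeasurableSet {p : ℂ × Plane | gain p.1 ‖p.2‖ < t} :=
      measurableSet_lt (measurable_gain_comp (by fun_prop) (by fun_prop)) measurable_const
    have : Function.uncurry f = {p : ℂ × Plane | gain p.1 ‖p.2‖ < t}.indicator 1 := by
      ext p; rfl
    rw [this]
    exact measurable_one.indicator hs
  let U : Ω → Fin K → ℂ := fun ω k => M.h 0 (some (0, k)) ω
  let V : Ω → Fin K → Plane := fun ω k => M.y 0 k ω
  have hU : Measurable U := measurable_pi_lambda _ fun k => M.h_measurable _ _
  have hV : Measurable V := measurable_pi_lambda _ fun k => M.y_measurable _ _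
  have hUV : IndepFun U V P := M.y_h_indep.symm.comp
    (φ := fun (p : ℕ × Option (ℕ × Fin K) → ℂ) k => p (0, some (0, k)))
    (ψ := fun (p : ℕ × Fin K → Plane) k => p (0, k)) (by fun_prop) (by fun_prop)
  have hfk : ∀ k : Fin K, Measurable fun p : (Fin K → ℂ) × (Fin K → Plane) => f (p.1 k) (p.2 k) :=
    fun k => hf.comp (g := Function.uncurry f)
      (f := fun p : (Fin K → ℂ) × (Fin K → Plane) => (p.1 k, p.2 k)) (by fun_prop)
  have h := lintegral_indepFun hU hV hUV
    (Φ := fun p => ∏ k, f (p.1 k) (p.2 k)) (Finset.measurable_prod _ fun k _ => hfk k)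
  have hms : MeasurableSet {ω | ∀ k, (M.config ω).cellGain 0 k < t} := by
    rw [Set.ofPred_forall]
    exact MeasurableSet.iInter fun k => measurableSet_lt
      ((Config.measurable_cellGain 0 k).comp M.measurable_config) measurable_const
  have hl : ∫⁻ ω, ∏ k, f (U ω k) (V ω k) ∂P = P {ω | ∀ k, (M.config ω).cellGain 0 k < t} := by
    rw [← lintegral_indicator_one hms]
    refine lintegral_congr fun ω => ?_
    by_cases hω : ∀ k, (M.config ω).cellGain 0 k < t
    · rw [Set.indicator_of_mem (by exact hω), Pi.one_apply]
      exact Finset.prod_eq_one fun k _ => Set.indicator_of_mem (by exact hω k) _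
    · rw [Set.indicator_of_notMem (by exact hω)]
      push Not at hω
      obtain ⟨k, hk⟩ := hω
      exact Finset.prod_eq_zero (Finset.mem_univ k)
        (Set.indicator_of_notMem (s := {h | gain h ‖V ω k‖ < t}) (by exact not_lt.2 hk) _)
  -- With the offsets fixed, the K gains are independent with explicit exponential tails; averaging
  -- over the independent, identically distributed offsets then gives a K-th power.
  have hinner : ∀ v : Fin K → Plane, ∫⁻ u, ∏ k, f (u k) (v k) ∂(P.map U) =
      ∏ k, (1 - expNeg (t * ENNReal.ofReal (‖v k‖ ^ 4))) := by
    intro v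
    have hfv : ∀ k, Measurable fun h => f h (v k) := fun k => hf.comp (f := fun h => (h, v k))
      (by fun_prop)
    have hinj : Function.Injective fun k : Fin K =>
        ((0, some (0, k)) : ℕ × Option (ℕ × Fin K)) := by
      intro i j h'
      simpa using h'
    have hfm : Measurable fun u : Fin K → ℂ => ∏ k, f (u k) (v k) :=
      Finset.measurable_prod _ fun k _ => (hfv k).comp (measurable_pi_apply k)
    rw [lintegral_map hfm hU,
      lintegral_prod_eq_prod_lintegral_of_indepFun Finset.univ (fun k ω => f (U ω k) (v k))
        ((M.h_indep.precomp hinj).comp (fun k h => f h (v k)) hfv)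
        (fun k => (hfv k).comp (M.h_measurable _ _))]
    refine Finset.prod_congr rfl fun k _ => ?_
    have hg := M.lintegral_comp_gain (0, some (0, k)) ‖v k‖ (f := (Set.Iio t).indicator 1)
      (measurable_one.indicator measurableSet_Iio)
    have hset : {s : ℝ | t ≤ ENNReal.ofReal s / ENNReal.ofReal (‖v k‖ ^ 4)}ᶜ =
        {s : ℝ | ENNReal.ofReal s / ENNReal.ofReal (‖v k‖ ^ 4) < t} := by
      ext s; simp
    have hmeas : MeasurableSet {s : ℝ | t ≤ ENNReal.ofReal s / ENNReal.ofReal (‖v k‖ ^ 4)} :=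
      measurableSet_le measurable_const (by fun_prop)
    rw [← expMeasure_gain_ge, ← prob_compl_eq_one_sub hmeas, hset, ← lintegral_indicator_one
      (hset ▸ hmeas.compl)]
    exact hg
  rw [hl] at h
  simp_rw [hinner] at h
  rw [h]
  have hinj : Function.Injective fun k : Fin K => ((0, k) : ℕ × Fin K) := by
    intro i j h'
    simpa using h'
  rw [lintegral_prod_eq_prod_lintegral_of_indepFun Finset.univ
    (fun k ω => 1 - expNeg (t * ENNReal.ofReal (‖V ω k‖ ^ 4)))
    ((M.y_indep.precomp hinj).comp (fun _ v => 1 - expNeg (t * ENNReal.ofReal (‖v‖ ^ 4)))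
      (fun _ => by fun_prop)) (fun k => by have := M.y_measurable 0 k; fun_prop)]
  have hk : ∀ k, ∫⁻ ω, 1 - expNeg (t * ENNReal.ofReal (‖V ω k‖ ^ 4)) ∂P =
      1 - ∫⁻ v, expNeg (t * ENNReal.ofReal (‖v‖ ^ 4))
        ∂(ProbabilityTheory.cond volume (Metric.closedBall (0 : Plane) Rc)) := by
    intro k
    have hy : P.map (M.y 0 k) = ProbabilityTheory.cond volume (Metric.closedBall 0 Rc) :=
      M.y_uniform 0 k
    have hym := M.y_measurable 0 k
    rw [← hy, lintegral_map (by fun_prop) hym, lintegral_sub (by fun_prop)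
      (((lintegral_mono fun ω => expNeg_le_one _).trans_lt (by simp)).ne)
      (Eventually.of_forall fun ω => expNeg_le_one _)]
    simp [V]
  simp_rw [hk]
  simp

end Network

/-! ### The outage probability without offsets -/

namespace Config

variable {K : ℕ} [NeZero K]

/-- The gain that a NOMA user of the nearest base station needs in order to be decoded. -/
def nomaThreshold (s φ ρ ε₁ : ℝ) (θ : Config K) : ℝ≥0∞ :=
  ENNReal.ofReal ε₁ * (θ.power φ + (θ.interf s + ENNReal.ofReal (1 / ρ)))

/-- The received power that the CoMP user needs in order to be decoded. -/
def compThreshold (s ρ ε₀ : ℝ) (θ : Config K) : ℝ≥0∞ :=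
  ENNReal.ofReal ε₀ * (θ.interf s + ENNReal.ofReal (1 / ρ))

/-- The configurations for which both users are decoded. -/
def decoded (s φ ρ ε₀ ε₁ : ℝ) : Set (Config K) :=
  {θ | (∃ k, θ.nomaThreshold s φ ρ ε₁ ≤ θ.cellGain 0 k) ∧ θ.compThreshold s ρ ε₀ ≤ θ.power φ}

lemma measurable_nomaThreshold (s φ ρ ε₁ : ℝ) :
    Measurable (nomaThreshold s φ ρ ε₁ : Config K → ℝ≥0∞) :=
  ((measurable_power φ).add ((measurable_interf s).add_const _)).const_mul _

lemma measurable_compThreshold (s ρ ε₀ : ℝ) :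
    Measurable (compThreshold s ρ ε₀ : Config K → ℝ≥0∞) :=
  ((measurable_interf s).add_const _).const_mul _

lemma measurableSet_comp (s φ ρ ε₀ : ℝ) :
    MeasurableSet {θ : Config K | θ.compThreshold s ρ ε₀ ≤ θ.power φ} :=
  measurableSet_le (measurable_compThreshold s ρ ε₀) (measurable_power φ)

lemma measurableSet_decoded (s φ ρ ε₀ ε₁ : ℝ) :
    MeasurableSet (decoded s φ ρ ε₀ ε₁ : Set (Config K)) := by
  have : {θ : Config K | ∃ k, θ.nomaThreshold s φ ρ ε₁ ≤ θ.cellGain 0 k} =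
      ⋃ k, {θ | θ.nomaThreshold s φ ρ ε₁ ≤ θ.cellGain 0 k} := by
    ext θ; simp
  have h : MeasurableSet {θ : Config K | ∃ k, θ.nomaThreshold s φ ρ ε₁ ≤ θ.cellGain 0 k} := by
    rw [this]
    exact MeasurableSet.iUnion fun k =>
      measurableSet_le (measurable_nomaThreshold s φ ρ ε₁) (measurable_cellGain 0 k)
  exact h.inter (measurableSet_comp s φ ρ ε₀)

end Config

lemma continuous_xi (φ ε₀ ε₁ μ : ℝ) : Continuous (xi φ ε₀ ε₁ μ) := by
  unfold xi
  fun_prop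

lemma xi_pos {φ ε₀ ε₁ μ : ℝ} (hφ : 0 < φ) (hε₀ : 0 < ε₀) (hε₁ : 0 < ε₁) (hμ : 0 < μ) (d : ℝ) :
    0 < xi φ ε₀ ε₁ μ d := by
  unfold xi
  positivity

/-- The factor that remains after the fading of the CoMP user has been integrated out. -/
def radialFactor (φ ρ ε₀ ε₁ μ d : ℝ) : ℝ :=
  d ^ 4 / (φ * ε₁ * μ + d ^ 4) * Real.exp (-(xi φ ε₀ ε₁ μ d * (1 / ρ)))

section RadialFactor

variable {lam φ ρ ε₀ ε₁ μ : ℝ}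

lemma measurable_radialFactor : Measurable (radialFactor φ ρ ε₀ ε₁ μ) := by
  have := (continuous_xi φ ε₀ ε₁ μ).measurable
  unfold radialFactor
  fun_prop

lemma radialFactor_nonneg (hφ : 0 < φ) (hε₁ : 0 < ε₁) (hμ : 0 < μ) (d : ℝ) :
    0 ≤ radialFactor φ ρ ε₀ ε₁ μ d := by
  unfold radialFactor
  positivity

lemma radialFactor_le_one (hφ : 0 < φ) (hρ : 0 < ρ) (hε₀ : 0 < ε₀) (hε₁ : 0 < ε₁) (hμ : 0 < μ)
    (d : ℝ) : radialFactor φ ρ ε₀ ε₁ μ d ≤ 1 := by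
  have h1 : d ^ 4 / (φ * ε₁ * μ + d ^ 4) ≤ 1 := by
    rw [div_le_one (by positivity)]
    have : 0 < φ * ε₁ * μ := by positivity
    linarith
  have h2 : Real.exp (-(xi φ ε₀ ε₁ μ d * (1 / ρ))) ≤ 1 := by
    have := xi_pos hφ hε₀ hε₁ hμ d
    rw [Real.exp_le_one_iff, neg_nonpos]
    positivity
  exact mul_le_one₀ h1 (Real.exp_pos _).le h2

lemma beta_half_half : ProbabilityTheory.beta (2 / 4) ((4 - 2) / 4) = Real.pi := by
  rw [ProbabilityTheory.beta, show (4 - 2 : ℝ) / 4 = 1 / 2 by norm_num,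
    show (2 : ℝ) / 4 = 1 / 2 by norm_num, Real.Gamma_one_half_eq, Real.mul_self_sqrt Real.pi_nonneg]
  norm_num

/-- In F_N the factor exp(-με₁/ρ) stands in the product in front of the integral, so the integrand
is the natural one multiplied by exp(με₁/ρ). One factor d of d⁵ is the polar Jacobian. -/
lemma integrand_eq (hφ : 0 < φ) (hρ : 0 < ρ) (d : ℝ) :
    integrand lam φ ρ ε₀ ε₁ μ d = Real.exp (μ * ε₁ * (1 / ρ)) * (2 * Real.pi * lam) *
      (d * (radialFactor φ ρ ε₀ ε₁ μ d *
        Real.exp (-(lam * (Real.pi * d ^ 2 + exteriorExponent (xi φ ε₀ ε₁ μ d) d))))) := by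
  have hsq : xi φ ε₀ ε₁ μ d ^ (2 / 4 : ℝ) = √(xi φ ε₀ ε₁ μ d) := by
    rw [Real.sqrt_eq_rpow]; norm_num
  have hmove : ∀ A B X : ℝ, Real.exp A * X * Real.exp B = Real.exp (A + B) * X := by
    intro A B X
    rw [Real.exp_add]; ring
  unfold integrand radialFactor
  rw [hsq, beta_half_half]
  set a := Real.arctan √(-(1 / 2) + 1 / 2 * √(1 + 16 * d ^ 4 / xi φ ε₀ ε₁ μ d)) with ha
  calc _ = Real.exp ((-(2 * Real.pi * lam * (√(xi φ ε₀ ε₁ μ d) / 4) * Real.pi) +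
        1 / 2 * Real.pi * lam * √(xi φ ε₀ ε₁ μ d) * a) +
        (-(ε₀ * (φ * ε₁ * μ + d ^ 4) / (φ * ρ)) - lam * Real.pi * d ^ 2)) *
        (2 * Real.pi * lam * d ^ 5 / (φ * ε₁ * μ + d ^ 4)) := hmove _ _ _
    _ = Real.exp ((μ * ε₁ * (1 / ρ) + -(xi φ ε₀ ε₁ μ d * (1 / ρ))) +
        -(lam * (Real.pi * d ^ 2 + exteriorExponent (xi φ ε₀ ε₁ μ d) d))) *
        (2 * Real.pi * lam * d ^ 5 / (φ * ε₁ * μ + d ^ 4)) := by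
      congr 2
      have h1 : xi φ ε₀ ε₁ μ d * (1 / ρ) =
          μ * ε₁ * (1 / ρ) + ε₀ * (φ * ε₁ * μ + d ^ 4) / (φ * ρ) := by
        unfold xi; field_simp
      rw [h1, exteriorExponent, ← ha]
      ring
    _ = _ := by rw [Real.exp_add, Real.exp_add]; ring

lemma integrableOn_integrand (hlam : 0 < lam) (hφ : 0 < φ) (hρ : 0 < ρ) (hε₀ : 0 < ε₀)
    (hε₁ : 0 < ε₁) (hμ : 0 < μ) : IntegrableOn (integrand lam φ ρ ε₀ ε₁ μ) (Set.Ioi 0) := by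
  have h := integrableOn_radial hlam (measurable_radialFactor (ρ := ρ))
    (radialFactor_nonneg (ρ := ρ) (ε₀ := ε₀) hφ hε₁ hμ) (radialFactor_le_one hφ hρ hε₀ hε₁ hμ)
    (continuous_xi φ ε₀ ε₁ μ).measurable
  have heq : integrand lam φ ρ ε₀ ε₁ μ = fun d => Real.exp (μ * ε₁ * (1 / ρ)) * (2 * Real.pi * lam) *
      (d * (radialFactor φ ρ ε₀ ε₁ μ d *
        Real.exp (-(lam * (Real.pi * d ^ 2 + exteriorExponent (xi φ ε₀ ε₁ μ d) d))))) :=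
    funext fun d => integrand_eq hφ hρ d
  rw [heq]
  exact h.const_mul _

end RadialFactor

namespace Network

variable {Ω : Type*} [MeasurableSpace Ω] {K : ℕ} {lam Rc : ℝ} {P : Measure Ω}
  (M : Network K lam Rc P) [IsProbabilityMeasure P] [NeZero K] {φ ρ ε₀ ε₁ : ℝ}

/-- The quotients can be cleared even for infinite interference, because the noise is positive and
the numerators are almost surely finite. As the selected user has the largest gain, it is decoded
exactly when some user of the cluster reaches the threshold. -/
lemma outageWith_eq (hlam : 0 < lam) (hρ : 0 < ρ) (ε₀ ε₁ : ℝ) (u : ℕ → Ω → Plane) (s : ℝ)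
    (hu : ∀ ω j, u j ω = s • M.y j (M.kstar j ω) ω + M.x j ω) :
    M.outageWith φ ρ ε₀ ε₁ u = 1 - P.real (M.config ⁻¹' Config.decoded s φ ρ ε₀ ε₁) := by
  have hmeas := M.measurable_config (Config.measurableSet_decoded (K := K) s φ ρ ε₀ ε₁)
  rw [← probReal_compl_eq_one_sub hmeas, outageWith]
  refine measureReal_congr ?_
  filter_upwards [M.ae_kstar_eq_sel, M.ae_offset, M.ae_nearest_ne_zero hlam.le] with ω hk hy hx
  refine propext (not_congr ?_)
  have hI := M.interference_eq hk u s (hu ω)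
  have hn : ENNReal.ofReal (1 / ρ) ≠ 0 := by positivity
  have hC : M.compPower φ ω = (M.config ω).power φ := rfl
  have hgain : ∀ (h : ℂ) (v : Plane), v ≠ 0 → gain h ‖v‖ ≠ ⊤ := by
    intro h v hv
    have : 0 < ‖v‖ := norm_pos_iff.2 hv
    rw [gain_eq]
    exact (ENNReal.div_lt_top ENNReal.ofReal_ne_top (by positivity)).ne
  have hCtop : (M.config ω).power φ ≠ ⊤ :=
    ENNReal.mul_ne_top ENNReal.ofReal_ne_top (hgain _ _ hx)
  have hZ : gain (M.h 0 (some (0, M.kstar 0 ω)) ω) ‖M.y 0 (M.kstar 0 ω) ω‖ =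
      (M.config ω).cellGain 0 ((M.config ω).sel 0) := by rw [hk]; rfl
  refine and_congr ?_ ?_
  · rw [sinrNOMA, hI, hC, add_assoc, ENNReal.le_div_iff_mul_le (Or.inl (by simp [hρ]))
      (Or.inr (hgain _ _ (hy _ _).1)), hZ]
    exact ⟨fun h => ⟨_, h⟩, fun ⟨k, h⟩ => h.trans (le_argmax _ k)⟩
  · rw [sinrCoMP, hI, hC, ENNReal.le_div_iff_mul_le (Or.inl (by simp [hρ])) (Or.inr hCtop)]
    rfl

/-- Integrating out the cluster of the nearest base station. -/
lemma measure_decoded (s φ ρ ε₀ ε₁ : ℝ) :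
    P (M.config ⁻¹' Config.decoded s φ ρ ε₀ ε₁) =
      ∫⁻ ω, {θ : Config K | θ.compThreshold s ρ ε₀ ≤ θ.power φ}.indicator (fun θ =>
        1 - (1 - ∫⁻ v, expNeg (θ.nomaThreshold s φ ρ ε₁ * ENNReal.ofReal (‖v‖ ^ 4))
          ∂(ProbabilityTheory.cond volume (Metric.closedBall (0 : Plane) Rc))) ^ K)
        (M.config ω) ∂P := by
  -- The offsets of the nearest cluster and its links to its own base station. Neither threshold nor
  -- the CoMP power depends on them.
  let S : Set (ℕ × Fin K) := {p | p.1 = 0}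
  let T : Set (ℕ × Option (ℕ × Fin K)) := {q | ∃ k, q = (0, some (0, k))}
  let B : Set (Config K) := {θ | θ.compThreshold s ρ ε₀ ≤ θ.power φ}
  let Q : Set (((ℕ × Fin K → Plane) × (ℕ × Option (ℕ × Fin K) → ℂ)) × Config K) :=
    {p | (∃ k, p.2.nomaThreshold s φ ρ ε₁ ≤ gain (p.1.2 (0, some (0, k))) ‖p.1.1 (0, k)‖) ∧
      p.2 ∈ B}
  have hQ : MeasurableSet Q := by
    have : {p : ((ℕ × Fin K → Plane) × (ℕ × Option (ℕ × Fin K) → ℂ)) × Config K |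
        ∃ k, p.2.nomaThreshold s φ ρ ε₁ ≤ gain (p.1.2 (0, some (0, k))) ‖p.1.1 (0, k)‖} =
        ⋃ k, {p | p.2.nomaThreshold s φ ρ ε₁ ≤ gain (p.1.2 (0, some (0, k))) ‖p.1.1 (0, k)‖} := by
      ext p; simp
    have hU : MeasurableSet {p : ((ℕ × Fin K → Plane) × (ℕ × Option (ℕ × Fin K) → ℂ)) × Config K |
        ∃ k, p.2.nomaThreshold s φ ρ ε₁ ≤ gain (p.1.2 (0, some (0, k))) ‖p.1.1 (0, k)‖} := by
      rw [this]
      exact MeasurableSet.iUnion fun k => measurableSet_le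
        ((Config.measurable_nomaThreshold s φ ρ ε₁).comp measurable_snd)
        (measurable_gain_comp (by fun_prop) (by fun_prop))
    exact hU.inter (measurable_snd (Config.measurableSet_comp s φ ρ ε₀))
  have h := lintegral_indepFun ((Config.measurable_keep S T).comp M.measurable_config)
    ((Config.measurable_drop S T).comp M.measurable_config) (M.indepFun_keep_drop S T)
    (Φ := Q.indicator 1) (measurable_one.indicator hQ)
  have hI : ∀ ω, ((M.config ω).drop S T).interf s = (M.config ω).interf s := fun ω =>
    Config.interf_drop (fun j hj k => by simpa [S] using hj)
      (fun j hj k => by simp [T, hj]) (fun j hj k => by simp [T, hj]) s _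
  have hpow : ∀ ω, ((M.config ω).drop S T).power φ = (M.config ω).power φ := fun ω => by
    simp [Config.power, Config.drop, T]
  have hnoma : ∀ ω, ((M.config ω).drop S T).nomaThreshold s φ ρ ε₁ =
      (M.config ω).nomaThreshold s φ ρ ε₁ := fun ω => by
    rw [Config.nomaThreshold, Config.nomaThreshold, hI, hpow]
  have hB : ∀ ω, (M.config ω).drop S T ∈ B ↔ M.config ω ∈ B := fun ω => by
    simp only [B, Set.mem_ofPred_eq, Config.compThreshold, hI, hpow]
  have hkeep : ∀ ω k, gain (((M.config ω).keep S T).2 (0, some (0, k)))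
      ‖((M.config ω).keep S T).1 (0, k)‖ = (M.config ω).cellGain 0 k := fun ω k => by
    simp [Config.keep, Config.cellGain, S, T]
  have hl : ∫⁻ ω, Q.indicator 1 ((Config.keep S T ∘ M.config) ω, (Config.drop S T ∘ M.config) ω) ∂P =
      P (M.config ⁻¹' Config.decoded s φ ρ ε₀ ε₁) := by
    rw [← lintegral_indicator_one
      (M.measurable_config (Config.measurableSet_decoded (K := K) s φ ρ ε₀ ε₁))]
    refine lintegral_congr fun ω => ?_
    have : ((Config.keep S T ∘ M.config) ω, (Config.drop S T ∘ M.config) ω) ∈ Q ↔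
        ω ∈ M.config ⁻¹' Config.decoded s φ ρ ε₀ ε₁ := by
      refine and_congr ?_ (hB ω)
      simp only [Function.comp, hkeep, hnoma]
    by_cases hω : ω ∈ M.config ⁻¹' Config.decoded s φ ρ ε₀ ε₁
    · rw [Set.indicator_of_mem hω, Set.indicator_of_mem (this.2 hω)]; rfl
    · rw [Set.indicator_of_notMem hω, Set.indicator_of_notMem (fun h => hω (this.1 h))]
  rw [← hl, h]
  refine lintegral_congr fun ω => ?_
  have hmQ : Measurable fun u => Q.indicator (fun _ => (1 : ℝ≥0∞)) (u, (Config.drop S T ∘ M.config) ω) :=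
    (measurable_const.indicator hQ).comp measurable_prodMk_right
  change ∫⁻ u, Q.indicator (fun _ => (1 : ℝ≥0∞)) (u, _) ∂_ = _
  rw [lintegral_map hmQ ((Config.measurable_keep S T).comp M.measurable_config)]
  by_cases hω : M.config ω ∈ B
  · rw [Set.indicator_of_mem (by exact hω), ← M.measure_forall_cellGain_lt]
    set t := (M.config ω).nomaThreshold s φ ρ ε₁ with ht
    have hms : MeasurableSet {ω' | ∀ k, (M.config ω').cellGain 0 k < t} := by
      rw [Set.ofPred_forall]
      exact MeasurableSet.iInter fun k => measurableSet_lt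
        ((Config.measurable_cellGain 0 k).comp M.measurable_config) measurable_const
    rw [← prob_compl_eq_one_sub hms, ← lintegral_indicator_one hms.compl]
    refine lintegral_congr fun ω' => ?_
    have : ((Config.keep S T ∘ M.config) ω', (Config.drop S T ∘ M.config) ω) ∈ Q ↔
        ω' ∈ {ω' | ∀ k, (M.config ω').cellGain 0 k < t}ᶜ := by
      refine (and_iff_left ((hB ω).2 hω)).trans ?_
      simp only [Function.comp, hkeep, hnoma, ← ht, Set.mem_compl_iff, Set.mem_ofPred_eq, not_forall,
        not_lt]
    by_cases hω' : ω' ∈ {ω' | ∀ k, (M.config ω').cellGain 0 k < t}ᶜ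
    · rw [Set.indicator_of_mem hω', Set.indicator_of_mem (this.2 hω')]; rfl
    · rw [Set.indicator_of_notMem hω', Set.indicator_of_notMem (fun h => hω' (this.1 h))]
  · rw [Set.indicator_of_notMem (by exact hω)]
    refine lintegral_eq_zero_of_ae_eq_zero (Eventually.of_forall fun ω' => ?_)
    exact Set.indicator_of_notMem (fun h => hω ((hB ω).1 h.2)) _

/-- The single integral as an expectation over the network without offsets. -/
lemma lintegral_expNeg_nomaThreshold (hlam : 0 < lam) (hφ : 0 < φ) (hρ : 0 < ρ) (hε₀ : 0 < ε₀)
    (hε₁ : 0 < ε₁) {μ : ℝ} (hμ : 0 < μ) :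
    ∫⁻ ω, {θ : Config K | θ.compThreshold 0 ρ ε₀ ≤ θ.power φ}.indicator (fun θ =>
        expNeg (ENNReal.ofReal μ * θ.nomaThreshold 0 φ ρ ε₁)) (M.config ω) ∂P =
      ENNReal.ofReal (Real.exp (-(μ * ε₁ * (1 / ρ))) *
        ∫ d in Set.Ioi 0, integrand lam φ ρ ε₀ ε₁ μ d) := by
  let q : ℕ × Option (ℕ × Fin K) := (0, none)
  let J : Config K → ℝ≥0∞ := fun θ => θ.interf 0 + ENNReal.ofReal (1 / ρ)
  have hJ : Measurable J := (Config.measurable_interf 0).add_const _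
  let pw : ℝ × Config K → ℝ≥0∞ := fun p =>
    ENNReal.ofReal φ * (ENNReal.ofReal p.1 / ENNReal.ofReal (‖p.2.1 0‖ ^ 4))
  have hpw : Measurable pw := by fun_prop
  let Φ : ℝ × Config K → ℝ≥0∞ :=
    {p | ENNReal.ofReal ε₀ * J p.2 ≤ pw p}.indicator fun p =>
      expNeg (ENNReal.ofReal μ * (ENNReal.ofReal ε₁ * (pw p + J p.2)))
  have hΦ : Measurable Φ :=
    (by fun_prop : Measurable fun p : ℝ × Config K =>
      expNeg (ENNReal.ofReal μ * (ENNReal.ofReal ε₁ * (pw p + J p.2)))).indicator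
      (measurableSet_le (by fun_prop) hpw)
  have h := M.lintegral_fading q hΦ
  have hJd : ∀ ω, J ((M.config ω).drop ∅ {q}) = J (M.config ω) := fun ω => by
    simp only [J]
    rw [Config.interf_drop (by simp) (by simp [q]) (by simp [q])]
  have hl : ∀ ω, Φ (‖M.h q.1 q.2 ω‖ ^ 2, (M.config ω).drop ∅ {q}) =
      {θ : Config K | θ.compThreshold 0 ρ ε₀ ≤ θ.power φ}.indicator (fun θ =>
        expNeg (ENNReal.ofReal μ * θ.nomaThreshold 0 φ ρ ε₁)) (M.config ω) := by
    intro ω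
    have hp : pw (‖M.h q.1 q.2 ω‖ ^ 2, (M.config ω).drop ∅ {q}) = (M.config ω).power φ := by
      simp only [pw, Config.power, gain_eq]
      rfl
    have hmem : ((‖M.h q.1 q.2 ω‖ ^ 2, (M.config ω).drop ∅ {q}) : ℝ × Config K) ∈
        {p : ℝ × Config K | ENNReal.ofReal ε₀ * J p.2 ≤ pw p} ↔
        M.config ω ∈ {θ : Config K | θ.compThreshold 0 ρ ε₀ ≤ θ.power φ} := by
      simp only [Set.mem_ofPred_eq, hp, hJd]
      rfl
    by_cases hω : M.config ω ∈ {θ : Config K | θ.compThreshold 0 ρ ε₀ ≤ θ.power φ}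
    · rw [Set.indicator_of_mem hω]
      simp only [Φ]
      rw [Set.indicator_of_mem (hmem.2 hω), hp, hJd]
      rfl
    · rw [Set.indicator_of_notMem hω]
      exact Set.indicator_of_notMem (fun h' => hω (hmem.1 h')) _
  simp_rw [hl] at h
  have hr : ∀ᵐ ω ∂P, ∫⁻ t, Φ (t, (M.config ω).drop ∅ {q}) ∂(expMeasure 1) =
      ENNReal.ofReal (radialFactor φ ρ ε₀ ε₁ μ ‖M.x 0 ω‖) *
        expNeg (ENNReal.ofReal (xi φ ε₀ ε₁ μ ‖M.x 0 ω‖) * (M.config ω).interf 0) := by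
    filter_upwards [M.ae_nearest_ne_zero hlam.le] with ω hx
    have hxi := xi_pos hφ hε₀ hε₁ hμ ‖M.x 0 ω‖
    have h1 := lintegral_power_ge hφ hε₀ hε₁ hμ (norm_pos_iff.2 hx) (J (M.config ω))
    have h2 : ∀ t, Φ (t, (M.config ω).drop ∅ {q}) =
        {t | ENNReal.ofReal ε₀ * J (M.config ω) ≤
        ENNReal.ofReal φ * (ENNReal.ofReal t / ENNReal.ofReal (‖M.x 0 ω‖ ^ 4))}.indicator
        (fun t => expNeg (ENNReal.ofReal μ * (ENNReal.ofReal ε₁ *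
          (ENNReal.ofReal φ * (ENNReal.ofReal t / ENNReal.ofReal (‖M.x 0 ω‖ ^ 4)) +
            J (M.config ω))))) t := by
      intro t
      simp only [Φ, Set.indicator, Set.mem_ofPred_eq, hJd]
      rfl
    simp_rw [h2]
    rw [h1]
    simp only [J]
    rw [mul_add, expNeg_add, ← ENNReal.ofReal_mul hxi.le, expNeg_ofReal (by positivity),
      radialFactor, ENNReal.ofReal_mul (by positivity)]
    ring
  -- The CoMP fading has been integrated out; the interferers' fading and then the Poisson process
  -- follow.
  rw [h, lintegral_congr_ae hr,
    M.lintegral_expNeg_interf measurable_radialFactor (continuous_xi φ ε₀ ε₁ μ).measurable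
      (xi_pos hφ hε₀ hε₁ hμ),
    M.hppp.lintegral_radial_mul_expNeg hlam M.ordered measurable_radialFactor
      (radialFactor_nonneg hφ hε₁ hμ) (radialFactor_le_one hφ hρ hε₀ hε₁ hμ)
      (continuous_xi φ ε₀ ε₁ μ) (xi_pos hφ hε₀ hε₁ hμ)]
  congr 1
  simp_rw [integrand_eq hφ hρ]
  rw [integral_const_mul, ← mul_assoc, ← mul_assoc, ← Real.exp_add, neg_add_cancel, Real.exp_zero,
    one_mul]

end Network

/-! ### Convergence of the quadrature formula -/

lemma prod_weightT_mul_exp {N : ℕ} (Rc ε₁ ρ : ℝ) (k : Fin (N + 1) → ℕ) :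
    ∏ n with k n ≠ 0,
        weightT N n ^ k n * Real.exp (-((k n : ℝ) * nodeT Rc N n * ε₁ * (1 / ρ))) =
      (∏ n with k n ≠ 0, weightT N n ^ k n) * Real.exp (-(muOf Rc N k * ε₁ * (1 / ρ))) := by
  rw [Finset.prod_mul_distrib, ← Real.exp_sum, muOf, Finset.sum_mul, Finset.sum_mul,
    Finset.sum_neg_distrib]

lemma measurable_lintegral_expNeg (ν : Measure Plane) [SFinite ν] :
    Measurable fun t : ℝ≥0∞ => ∫⁻ v, expNeg (t * ENNReal.ofReal (‖v‖ ^ 4)) ∂ν := by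
  have : Measurable fun p : ℝ≥0∞ × Plane => expNeg (p.1 * ENNReal.ofReal (‖p.2‖ ^ 4)) := by
    fun_prop
  exact this.lintegral_prod_right'

namespace Network

variable {Ω : Type*} [MeasurableSpace Ω] {K : ℕ} {lam Rc : ℝ} {P : Measure Ω}
  (M : Network K lam Rc P) [IsProbabilityMeasure P] [NeZero K] {φ ρ ε₀ ε₁ : ℝ}

/-- An exact identity for every N: F_N is what the outage formula becomes when the distribution
function of a composite gain is replaced by its quadrature. -/
lemma integral_one_sub_chebyshevSum_pow (hlam : 0 < lam) (hRc : 0 < Rc) (hφ : 0 < φ) (hρ : 0 < ρ)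
    (hε₀ : 0 < ε₀) (hε₁ : 0 < ε₁) (N : ℕ) :
    ∫ ω, {θ : Config K | θ.compThreshold 0 ρ ε₀ ≤ θ.power φ}.indicator (fun θ =>
        1 - chebyshevSum Rc N (θ.nomaThreshold 0 φ ρ ε₁) ^ K) (M.config ω) ∂P =
      1 - outageFormula K lam Rc φ ρ ε₀ ε₁ N := by
  set B : Set (Config K) := {θ | θ.compThreshold 0 ρ ε₀ ≤ θ.power φ} with hB
  have hBm : MeasurableSet B := Config.measurableSet_comp 0 φ ρ ε₀
  have hthr := Config.measurable_nomaThreshold (K := K) 0 φ ρ ε₁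
  have hm : ∀ μ : ℝ, Measurable fun ω => B.indicator (fun θ =>
      expNeg (ENNReal.ofReal μ * θ.nomaThreshold 0 φ ρ ε₁)) (M.config ω) := fun μ =>
    ((hthr.const_mul _).expNeg.indicator hBm).comp M.measurable_config
  have hle : ∀ (μ : ℝ) (ω : Ω), B.indicator (fun θ =>
      expNeg (ENNReal.ofReal μ * θ.nomaThreshold 0 φ ρ ε₁)) (M.config ω) ≤ 1 := fun μ ω =>
    Set.indicator_le' (fun _ _ => expNeg_le_one _) (fun _ _ => zero_le) _
  have hint : ∀ μ : ℝ, Integrable (fun ω => (B.indicator (fun θ =>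
      expNeg (ENNReal.ofReal μ * θ.nomaThreshold 0 φ ρ ε₁)) (M.config ω)).toReal) P := fun μ => by
    refine Integrable.of_bound (hm μ).ennreal_toReal.aestronglyMeasurable 1
      (Eventually.of_forall fun ω => ?_)
    rw [Real.norm_of_nonneg ENNReal.toReal_nonneg]
    simpa using ENNReal.toReal_mono ENNReal.one_ne_top (hle μ ω)
  have hval : ∀ μ : ℝ, 0 < μ → ∫ ω, (B.indicator (fun θ =>
      expNeg (ENNReal.ofReal μ * θ.nomaThreshold 0 φ ρ ε₁)) (M.config ω)).toReal ∂P =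
      Real.exp (-(μ * ε₁ * (1 / ρ))) * ∫ d in Set.Ioi 0, integrand lam φ ρ ε₀ ε₁ μ d := by
    intro μ hμ
    rw [integral_toReal (hm μ).aemeasurable
      (Eventually.of_forall fun ω => (hle μ ω).trans_lt ENNReal.one_lt_top),
      M.lintegral_expNeg_nomaThreshold hlam hφ hρ hε₀ hε₁ hμ, ENNReal.toReal_ofReal]
    refine mul_nonneg (Real.exp_pos _).le (setIntegral_nonneg measurableSet_Ioi fun d hd => ?_)
    have hd' : 0 < d := hd
    unfold integrand
    positivity
  have hpt : ∀ ω, B.indicator (fun θ =>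
        1 - chebyshevSum Rc N (θ.nomaThreshold 0 φ ρ ε₁) ^ K) (M.config ω) =
      -∑ k ∈ tuples K N, (Nat.multinomial Finset.univ k : ℝ) *
        (∏ n with k n ≠ 0, weightT N n ^ k n) * (B.indicator (fun θ =>
          expNeg (ENNReal.ofReal (muOf Rc N k) * θ.nomaThreshold 0 φ ρ ε₁))
          (M.config ω)).toReal := by
    intro ω
    by_cases hω : M.config ω ∈ B
    · simp only [Set.indicator_of_mem hω]
      exact one_sub_chebyshevSum_pow hRc K N _
    · simp [Set.indicator_of_notMem hω]
  simp_rw [hpt]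
  rw [integral_neg, integral_finsetSum _ fun k _ => (hint _).const_mul _, outageFormula,
    sub_add_cancel_left]
  congr 1
  refine Finset.sum_congr rfl fun k hk => ?_
  rw [integral_const_mul, hval _ (muOf_pos hRc hk), prod_weightT_mul_exp]
  ring

/-- The limit is taken under the expectation, before the K-th power is expanded, so the alternating
multinomial sum with its growing number of terms never has to be estimated. -/
theorem tendsto_outageFormula (hlam : 0 < lam) (hRc : 0 < Rc) (hφ : 0 < φ) (hρ : 0 < ρ)
    (hε₀ : 0 < ε₀) (hε₁ : 0 < ε₁) :
    Tendsto (fun N : ℕ => outageFormula K lam Rc φ ρ ε₀ ε₁ N) atTop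
      (𝓝 (M.outageNoOffset φ ρ ε₀ ε₁)) := by
  set B : Set (Config K) := {θ | θ.compThreshold 0 ρ ε₀ ≤ θ.power φ} with hB
  have hBm : MeasurableSet B := Config.measurableSet_comp 0 φ ρ ε₀
  have hthr := Config.measurable_nomaThreshold (K := K) 0 φ ρ ε₁
  set G : ℝ≥0∞ → ℝ≥0∞ := fun t => ∫⁻ v, expNeg (t * ENNReal.ofReal (‖v‖ ^ 4))
    ∂(ProbabilityTheory.cond volume (Metric.closedBall (0 : Plane) Rc)) with hG
  have hprob : IsProbabilityMeasure
      (ProbabilityTheory.cond volume (Metric.closedBall (0 : Plane) Rc)) :=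
    cond_isProbabilityMeasure_of_finite (Metric.measure_closedBall_pos _ _ hRc).ne'
      measure_closedBall_lt_top.ne
  have hGm : Measurable G := measurable_lintegral_expNeg _
  have hG1 : ∀ t, G t ≤ 1 := fun t =>
    (lintegral_mono fun v => expNeg_le_one _).trans (by simp)
  have hlim : P.real (M.config ⁻¹' Config.decoded 0 φ ρ ε₀ ε₁) =
      ∫ ω, B.indicator (fun θ => 1 - (1 - (G (θ.nomaThreshold 0 φ ρ ε₁)).toReal) ^ K)
        (M.config ω) ∂P := by
    have hm : Measurable fun ω => B.indicator (fun θ =>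
        1 - (1 - G (θ.nomaThreshold 0 φ ρ ε₁)) ^ K) (M.config ω) :=
      Measurable.comp (((((hGm.comp hthr).const_sub 1).pow_const K).const_sub 1).indicator hBm)
        M.measurable_config
    have hle : ∀ ω, B.indicator (fun θ =>
        1 - (1 - G (θ.nomaThreshold 0 φ ρ ε₁)) ^ K) (M.config ω) ≤ 1 := fun ω =>
      Set.indicator_le' (fun _ _ => tsub_le_self) (fun _ _ => zero_le) _
    rw [measureReal_def, M.measure_decoded, ← integral_toReal hm.aemeasurable
      (Eventually.of_forall fun ω => (hle ω).trans_lt ENNReal.one_lt_top)]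
    refine integral_congr_ae (Eventually.of_forall fun ω => ?_)
    by_cases hω : M.config ω ∈ B
    · simp only [Set.indicator_of_mem hω]
      rw [ENNReal.toReal_sub_of_le (pow_le_one₀ zero_le tsub_le_self) ENNReal.one_ne_top,
        ENNReal.toReal_pow, ENNReal.toReal_sub_of_le (hG1 _) ENNReal.one_ne_top, ENNReal.toReal_one]
    · simp [Set.indicator_of_notMem hω]
  have hconv : Tendsto (fun N => ∫ ω, B.indicator (fun θ =>
      1 - chebyshevSum Rc N (θ.nomaThreshold 0 φ ρ ε₁) ^ K) (M.config ω) ∂P) atTop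
      (𝓝 (∫ ω, B.indicator (fun θ => 1 - (1 - (G (θ.nomaThreshold 0 φ ρ ε₁)).toReal) ^ K)
        (M.config ω) ∂P)) := by
    refine tendsto_integral_of_dominated_convergence (fun _ => 1 + (1 + Real.pi) ^ K)
      (fun N => ?_) (integrable_const _) (fun N => Eventually.of_forall fun ω => ?_)
      (Eventually.of_forall fun ω => ?_)
    · exact (Measurable.comp (((((measurable_chebyshevSum Rc N).comp hthr).pow_const K).const_sub
        1).indicator hBm) M.measurable_config).aestronglyMeasurable
    · by_cases hω : M.config ω ∈ B
      · rw [Set.indicator_of_mem hω]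
        refine (norm_sub_le _ _).trans ?_
        rw [norm_one, norm_pow, Real.norm_eq_abs]
        gcongr
        exact abs_chebyshevSum_le _ _ _
      · rw [Set.indicator_of_notMem hω, norm_zero]
        positivity
    · by_cases hω : M.config ω ∈ B
      · simp only [Set.indicator_of_mem hω]
        exact ((tendsto_chebyshevSum hRc _).pow K).const_sub 1
      · simp [Set.indicator_of_notMem hω]
  rw [outageNoOffset, M.outageWith_eq hlam hρ ε₀ ε₁ M.x 0 (fun ω j => by simp), hlim]
  have := hconv.const_sub 1
  simp_rw [hB, M.integral_one_sub_chebyshevSum_pow hlam hRc hφ hρ hε₀ hε₁, sub_sub_cancel] at this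
  exact this

end Network

/-! ### The effect of the offsets -/

lemma gain_le_mul_gain {r r' c : ℝ} (hr : 0 < r) (hr' : 0 < r') (h : r' ^ 4 ≤ c * r ^ 4) (z : ℂ) :
    gain z r ≤ ENNReal.ofReal c * gain z r' := by
  have hr4 : 0 < r ^ 4 := by positivity
  have hr4' : 0 < r' ^ 4 := by positivity
  have hc : 0 ≤ c := by
    by_contra hc
    push Not at hc
    nlinarith
  rw [gain_eq, gain_eq, ← ENNReal.ofReal_div_of_pos hr4, ← ENNReal.ofReal_div_of_pos hr4',
    ← ENNReal.ofReal_mul hc]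
  refine ENNReal.ofReal_le_ofReal ?_
  rw [mul_div_assoc', div_le_div_iff₀ hr4 hr4']
  nlinarith [sq_nonneg ‖z‖]

/-- For δ ≤ 1/8, (1 + δ)⁴ ≤ 1 + 8δ and (1 + 8δ)(1 - δ)⁴ ≥ (1 + 8δ)(1 - 4δ) ≥ 1. The last inequality
is where 1/8 comes from. -/
lemma gain_perturb {r r' δ : ℝ} (hr : 0 < r) (hδ0 : 0 ≤ δ) (hδ : δ ≤ 1 / 8)
    (h : |r' - r| ≤ δ * r) (z : ℂ) :
    gain z r ≤ ENNReal.ofReal (1 + 8 * δ) * gain z r' ∧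
      gain z r' ≤ ENNReal.ofReal (1 + 8 * δ) * gain z r := by
  obtain ⟨h1, h2⟩ := abs_le.1 h
  have hlo : (1 - δ) * r ≤ r' := by linarith
  have hhi : r' ≤ (1 + δ) * r := by linarith
  have hδ1 : 0 < 1 - δ := by linarith
  have hr' : 0 < r' := lt_of_lt_of_le (by positivity) hlo
  have hr4 : 0 < r ^ 4 := by positivity
  constructor
  · refine gain_le_mul_gain hr hr' ?_ z
    calc r' ^ 4 ≤ ((1 + δ) * r) ^ 4 := by gcongr
      _ = (1 + δ) ^ 4 * r ^ 4 := by ring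
      _ ≤ (1 + 8 * δ) * r ^ 4 := by
          gcongr
          have h3 : δ ^ 2 ≤ δ * (1 / 8) := by nlinarith
          have h4 : δ ^ 3 ≤ δ * (1 / 8) := by nlinarith
          have h5 : δ ^ 4 ≤ δ * (1 / 8) := by nlinarith
          nlinarith
  · refine gain_le_mul_gain hr' hr ?_ z
    have h3 : 1 - 4 * δ ≤ (1 - δ) ^ 4 := by
      have := one_add_mul_le_pow (a := -δ) (by linarith) 4
      norm_num at this
      rw [← sub_eq_add_neg] at this
      linarith
    calc r ^ 4 = 1 * r ^ 4 := by ring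
      _ ≤ (1 + 8 * δ) * (1 - δ) ^ 4 * r ^ 4 := by
          gcongr
          nlinarith
      _ = (1 + 8 * δ) * ((1 - δ) * r) ^ 4 := by ring
      _ ≤ (1 + 8 * δ) * r' ^ 4 := by gcongr

namespace Config

variable {K : ℕ}

/-- The largest ratio of the radius of a cluster to the distance between an interfering base station
and the nearest one, truncated. -/
def distortion (Rc : ℝ) (θ : Config K) : ℝ≥0∞ :=
  min (⨆ j, if j = 0 then 0 else ENNReal.ofReal Rc / ENNReal.ofReal ‖θ.1 j - θ.1 0‖)
    (ENNReal.ofReal (1 / 8))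

lemma measurable_distortion (Rc : ℝ) : Measurable (distortion Rc : Config K → ℝ≥0∞) := by
  refine Measurable.min (Measurable.iSup fun j => ?_) measurable_const
  by_cases hj : j = 0
  · simp [hj]
  · simp only [hj, if_false]
    fun_prop

lemma distortion_ne_top (Rc : ℝ) (θ : Config K) : distortion Rc θ ≠ ⊤ :=
  ((min_le_right _ _).trans_lt ENNReal.ofReal_lt_top).ne

variable [NeZero K]

/-- Below the truncation level the distortion is the true supremum δ, so Rc ≤ δ‖x_j - x_0‖ for every
j ≠ 0. Each offset then changes its distance by a relative amount at most δ, and the gains compare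
term by term. -/
lemma interf_le {Rc : ℝ} (hRc : 0 < Rc) {θ : Config K} (hy : ∀ p, ‖θ.2.1 p‖ ≤ Rc)
    (hD : distortion Rc θ < ENNReal.ofReal (1 / 8)) :
    θ.interf 0 ≤ ENNReal.ofReal (1 + 8 * (distortion Rc θ).toReal) * θ.interf 1 ∧
      θ.interf 1 ≤ ENNReal.ofReal (1 + 8 * (distortion Rc θ).toReal) * θ.interf 0 := by
  set δ := (distortion Rc θ).toReal with hδ
  have hδ8 : δ ≤ 1 / 8 := ENNReal.toReal_le_of_le_ofReal (by norm_num) hD.le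
  have hsup : distortion Rc θ =
      ⨆ j, if j = 0 then 0 else ENNReal.ofReal Rc / ENNReal.ofReal ‖θ.1 j - θ.1 0‖ := by
    rw [distortion, min_eq_left_iff]
    by_contra h
    rw [distortion, min_eq_right (not_le.1 h).le] at hD
    exact lt_irrefl _ hD
  have hj : ∀ j ≠ 0, 0 < ‖θ.1 j - θ.1 0‖ ∧ Rc ≤ δ * ‖θ.1 j - θ.1 0‖ := by
    intro j hj
    have h1 : ENNReal.ofReal Rc / ENNReal.ofReal ‖θ.1 j - θ.1 0‖ ≤ distortion Rc θ := by
      rw [hsup]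
      refine le_trans (le_of_eq ?_) (le_iSup _ j)
      rw [if_neg hj]
    have hpos : 0 < ‖θ.1 j - θ.1 0‖ := by
      rcases (norm_nonneg (θ.1 j - θ.1 0)).eq_or_lt with h | h
      · rw [← h, ENNReal.ofReal_zero, ENNReal.div_zero (by positivity)] at h1
        exact absurd h1 (not_le.2 (distortion_ne_top Rc θ).lt_top)
      · exact h
    refine ⟨hpos, ?_⟩
    rw [← ENNReal.ofReal_toReal (distortion_ne_top Rc θ), ← ENNReal.ofReal_div_of_pos hpos,
      ENNReal.ofReal_le_ofReal_iff ENNReal.toReal_nonneg, div_le_iff₀ hpos] at h1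
    exact h1
  have key : ∀ j ≠ 0, ∀ (z : ℂ) (k : Fin K),
      gain z ‖(0 : ℝ) • θ.2.1 (j, k) + θ.1 j - θ.1 0‖ ≤
        ENNReal.ofReal (1 + 8 * δ) * gain z ‖(1 : ℝ) • θ.2.1 (j, k) + θ.1 j - θ.1 0‖ ∧
      gain z ‖(1 : ℝ) • θ.2.1 (j, k) + θ.1 j - θ.1 0‖ ≤
        ENNReal.ofReal (1 + 8 * δ) * gain z ‖(0 : ℝ) • θ.2.1 (j, k) + θ.1 j - θ.1 0‖ := by
    intro j hj0 z k
    obtain ⟨hpos, hle⟩ := hj j hj0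
    rw [zero_smul, zero_add, one_smul]
    refine gain_perturb hpos ENNReal.toReal_nonneg hδ8 ?_ z
    refine (abs_norm_sub_norm_le _ _).trans ?_
    rw [show θ.2.1 (j, k) + θ.1 j - θ.1 0 - (θ.1 j - θ.1 0) = θ.2.1 (j, k) by abel]
    exact (hy _).trans hle
  unfold interf
  rw [← ENNReal.tsum_mul_left, ← ENNReal.tsum_mul_left]
  constructor
  · refine ENNReal.tsum_le_tsum fun j => ?_
    by_cases h : j = 0
    · simp [h]
    · rw [if_neg h, if_neg h]
      exact (key j h _ _).1
  · refine ENNReal.tsum_le_tsum fun j => ?_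
    by_cases h : j = 0
    · simp [h]
    · rw [if_neg h, if_neg h]
      exact (key j h _ _).2

/-- Noise and CoMP power are unchanged, so both thresholds grow by a factor at most c. Losing
decodability therefore puts a gain or the CoMP power between its old threshold and c times it. -/
lemma mem_of_mem_decoded {s s' φ ρ ε₀ ε₁ c : ℝ} (hc : 1 ≤ c) {θ : Config K}
    (hI : θ.interf s' ≤ ENNReal.ofReal c * θ.interf s)
    (h : θ ∈ decoded s φ ρ ε₀ ε₁ \ decoded s' φ ρ ε₀ ε₁) :
    (∃ k, θ.nomaThreshold s φ ρ ε₁ ≤ θ.cellGain 0 k ∧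
      θ.cellGain 0 k < ENNReal.ofReal c * θ.nomaThreshold s φ ρ ε₁) ∨
    (θ.compThreshold s ρ ε₀ ≤ θ.power φ ∧
      θ.power φ < ENNReal.ofReal c * θ.compThreshold s ρ ε₀) := by
  have hc' : 1 ≤ ENNReal.ofReal c := by simpa using ENNReal.ofReal_le_ofReal hc
  have hself : ∀ a : ℝ≥0∞, a ≤ ENNReal.ofReal c * a := fun a => le_mul_of_one_le_left zero_le hc'
  have hJ : θ.interf s' + ENNReal.ofReal (1 / ρ) ≤
      ENNReal.ofReal c * (θ.interf s + ENNReal.ofReal (1 / ρ)) := by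
    rw [mul_add]
    exact add_le_add hI (hself _)
  have h1 : θ.nomaThreshold s' φ ρ ε₁ ≤ ENNReal.ofReal c * θ.nomaThreshold s φ ρ ε₁ := by
    unfold nomaThreshold
    rw [mul_left_comm]
    gcongr
    rw [mul_add]
    exact add_le_add (hself _) hJ
  have h0 : θ.compThreshold s' ρ ε₀ ≤ ENNReal.ofReal c * θ.compThreshold s ρ ε₀ := by
    unfold compThreshold
    rw [mul_left_comm]
    gcongr
  obtain ⟨⟨⟨k, hk⟩, hp⟩, hn⟩ := h
  by_cases hp' : θ.compThreshold s' ρ ε₀ ≤ θ.power φ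
  · left
    refine ⟨k, hk, lt_of_lt_of_le ?_ h1⟩
    by_contra hlt
    exact hn ⟨⟨k, not_lt.1 hlt⟩, hp'⟩
  · right
    exact ⟨hp, (not_le.1 hp').trans_le h0⟩

end Config

namespace Network

variable {Ω : Type*} [MeasurableSpace Ω] {K : ℕ} {lam Rc : ℝ} {P : Measure Ω}
  (M : Network K lam Rc P) [IsProbabilityMeasure P] {φ ρ ε₀ ε₁ : ℝ}

/-- A gain is unlikely to fall between a threshold and a small multiple of it. -/
lemma measure_gain_Ico_le (q : ℕ × Option (ℕ × Fin K)) {r : Config K → ℝ} {τ : Config K → ℝ≥0∞}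
    (hr : Measurable r) (hτ : Measurable τ) (hrq : ∀ θ, r (θ.drop ∅ {q}) = r θ)
    (hτq : ∀ θ, τ (θ.drop ∅ {q}) = τ θ) :
    P {ω | τ (M.config ω) ≤ gain (M.h q.1 q.2 ω) (r (M.config ω)) ∧
        gain (M.h q.1 q.2 ω) (r (M.config ω)) <
          ENNReal.ofReal (1 + 8 * ((M.config ω).distortion Rc).toReal) * τ (M.config ω)} ≤
      8 * ∫⁻ ω, (M.config ω).distortion Rc ∂P := by
  have hD := Config.measurable_distortion (K := K) Rc
  let Q : Set (ℝ × Config K) := {p |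
    τ p.2 ≤ ENNReal.ofReal p.1 / ENNReal.ofReal (r p.2 ^ 4) ∧
    ENNReal.ofReal p.1 / ENNReal.ofReal (r p.2 ^ 4) <
      ENNReal.ofReal (1 + 8 * (p.2.distortion Rc).toReal) * τ p.2}
  have hQ : MeasurableSet Q := by
    have h1 : Measurable fun p : ℝ × Config K =>
        ENNReal.ofReal p.1 / ENNReal.ofReal (r p.2 ^ 4) := by fun_prop
    have h2 : Measurable fun p : ℝ × Config K => τ p.2 := by fun_prop
    have h3 : Measurable fun p : ℝ × Config K =>
        ENNReal.ofReal (1 + 8 * (p.2.distortion Rc).toReal) * τ p.2 := by fun_prop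
    exact (measurableSet_le h2 h1).inter (measurableSet_lt h1 h3)
  have h := M.lintegral_fading q (Φ := Q.indicator 1) (measurable_one.indicator hQ)
  have hDq : ∀ θ : Config K, (θ.drop ∅ {q}).distortion Rc = θ.distortion Rc := fun θ => rfl
  have hmem : ∀ (t : ℝ) (ω : Ω), (t, (M.config ω).drop ∅ {q}) ∈ Q ↔
      τ (M.config ω) ≤ ENNReal.ofReal t / ENNReal.ofReal (r (M.config ω) ^ 4) ∧
      ENNReal.ofReal t / ENNReal.ofReal (r (M.config ω) ^ 4) <
        ENNReal.ofReal (1 + 8 * ((M.config ω).distortion Rc).toReal) * τ (M.config ω) := by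
    intro t ω
    simp only [Q, Set.mem_ofPred_eq, hrq, hτq, hDq]
  have hhq := M.h_measurable q.1 q.2
  have hcfg := M.measurable_config
  have hm : MeasurableSet {ω | τ (M.config ω) ≤ gain (M.h q.1 q.2 ω) (r (M.config ω)) ∧
        gain (M.h q.1 q.2 ω) (r (M.config ω)) <
          ENNReal.ofReal (1 + 8 * ((M.config ω).distortion Rc).toReal) * τ (M.config ω)} := by
    have hg := measurable_gain_comp hhq (hr.comp hcfg)
    simp only [Function.comp] at hg
    exact (measurableSet_le (by fun_prop) hg).inter (measurableSet_lt hg (by fun_prop))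
  rw [← lintegral_indicator_one hm]
  calc _ = ∫⁻ ω, Q.indicator 1 (‖M.h q.1 q.2 ω‖ ^ 2, (M.config ω).drop ∅ {q}) ∂P := by
        refine lintegral_congr fun ω => ?_
        have := hmem (‖M.h q.1 q.2 ω‖ ^ 2) ω
        rw [← gain_eq] at this
        simp only [Set.indicator, this, Set.mem_ofPred_eq, Pi.one_apply]
    _ = ∫⁻ ω, ∫⁻ t, Q.indicator 1 (t, (M.config ω).drop ∅ {q}) ∂(expMeasure 1) ∂P := h
    _ ≤ ∫⁻ ω, 8 * (M.config ω).distortion Rc ∂P := by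
        refine lintegral_mono fun ω => ?_
        have h1 := expMeasure_gain_Ico_le (r (M.config ω)) (τ (M.config ω))
          (c := 1 + 8 * ((M.config ω).distortion Rc).toReal) (by simp)
        have h2 : ENNReal.ofReal (1 + 8 * ((M.config ω).distortion Rc).toReal - 1) =
            8 * (M.config ω).distortion Rc := by
          rw [add_sub_cancel_left, ENNReal.ofReal_mul (by norm_num),
            ENNReal.ofReal_toReal (Config.distortion_ne_top _ _)]
          norm_num
        rw [h2] at h1
        refine le_trans (le_of_eq ?_) h1
        have hm1 : Measurable fun t => ENNReal.ofReal t / ENNReal.ofReal (r (M.config ω) ^ 4) := by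
          fun_prop
        have hm2 := (measurableSet_le (measurable_const (a := τ (M.config ω))) hm1).inter
          (measurableSet_lt hm1 (measurable_const (a := ENNReal.ofReal
            (1 + 8 * ((M.config ω).distortion Rc).toReal) * τ (M.config ω))))
        refine Eq.trans ?_ (lintegral_indicator_one hm2)
        refine lintegral_congr fun t => ?_
        simp only [Set.indicator, hmem, Set.mem_ofPred_eq, Pi.one_apply]
    _ = 8 * ∫⁻ ω, (M.config ω).distortion Rc ∂P :=
        lintegral_const_mul' _ _ (by norm_num)

lemma lintegral_Ioi_div_sq {a b : ℝ} (ha : 0 < a) (hb : 0 ≤ b) :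
    ∫⁻ t in Set.Ioi a, ENNReal.ofReal (b / t ^ 2) = ENNReal.ofReal (b / a) := by
  have h1 : ∀ t ∈ Set.Ioi a, b / t ^ 2 = b * t ^ (-2 : ℝ) := by
    intro t ht
    have ht' : 0 < t := ha.trans ht
    rw [Real.rpow_neg ht'.le, Real.rpow_ofNat, div_eq_mul_inv]
  have hint := (integrableOn_Ioi_rpow_of_lt (a := -2) (by norm_num) ha).const_mul b
  rw [setLIntegral_congr_fun measurableSet_Ioi (fun t ht => by rw [h1 t ht]),
    ← ofReal_integral_eq_lintegral_ofReal hint, integral_const_mul,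
    integral_Ioi_rpow_of_lt (by norm_num) ha]
  · congr 1
    norm_num
    rw [Real.rpow_neg_one, div_eq_mul_inv]
  · filter_upwards [ae_restrict_mem measurableSet_Ioi] with t ht
    have ht' : 0 < t := ha.trans ht
    positivity

/-- Layer-cake formula with the tail bound min(1, π²a²/t²), a = Rc√lam. Splitting at t = a makes
both pieces proportional to a. -/
lemma lintegral_distortion_le (hlam : 0 < lam) (hRc : 0 < Rc) :
    ∫⁻ ω, (M.config ω).distortion Rc ∂P ≤
      ENNReal.ofReal ((1 + Real.pi ^ 2) * (Rc * √lam)) := by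
  have hDm : Measurable fun ω => (M.config ω).distortion Rc :=
    (Config.measurable_distortion (K := K) Rc).comp M.measurable_config
  set a := Rc * √lam with ha
  have ha0 : 0 < a := by positivity
  have ha2 : a ^ 2 = lam * Rc ^ 2 := by rw [ha, mul_pow, Real.sq_sqrt hlam.le]; ring
  have h1 : ∫⁻ ω, (M.config ω).distortion Rc ∂P =
      ∫⁻ t in Set.Ioi 0, P {ω | t < ((M.config ω).distortion Rc).toReal} := by
    rw [← lintegral_eq_lintegral_meas_lt P (Eventually.of_forall fun ω => ENNReal.toReal_nonneg)
      hDm.ennreal_toReal.aemeasurable]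
    exact lintegral_congr fun ω => (ENNReal.ofReal_toReal (Config.distortion_ne_top _ _)).symm
  have h2 : ∀ t : ℝ, 0 < t → P {ω | t < ((M.config ω).distortion Rc).toReal} ≤
      ENNReal.ofReal (Real.pi ^ 2 * a ^ 2 / t ^ 2) := by
    intro t ht
    have h := M.hppp.measure_exists_near_le hlam M.ordered (s := Rc / t) (by positivity)
    rw [show Real.pi ^ 2 * a ^ 2 / t ^ 2 = Real.pi ^ 2 * lam * (Rc / t) ^ 2 by
      rw [ha2]; field_simp]
    refine (measure_mono fun ω hω => ?_).trans h
    have hω' : ENNReal.ofReal t < (M.config ω).distortion Rc :=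
      (ENNReal.ofReal_lt_iff_lt_toReal ht.le (Config.distortion_ne_top _ _)).2 hω
    have h3 := hω'.trans_le (min_le_left _ _)
    rw [lt_iSup_iff] at h3
    obtain ⟨j, hj⟩ := h3
    by_cases hj0 : j = 0
    · simp [hj0] at hj
    · refine ⟨j, hj0, ?_⟩
      rw [if_neg hj0] at hj
      change ENNReal.ofReal t < ENNReal.ofReal Rc / ENNReal.ofReal ‖M.x j ω - M.x 0 ω‖ at hj
      rcases (norm_nonneg (M.x j ω - M.x 0 ω)).eq_or_lt with h | hpos
      · rw [← h]; positivity
      · rw [← ENNReal.ofReal_div_of_pos hpos, ENNReal.ofReal_lt_ofReal_iff_of_nonneg ht.le,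
          lt_div_iff₀ hpos] at hj
        rw [lt_div_iff₀ ht]
        linarith
  rw [h1, ← Set.Ioc_union_Ioi_eq_Ioi ha0.le,
    lintegral_union measurableSet_Ioi (Set.Ioc_disjoint_Ioi le_rfl)]
  have h3 : ∫⁻ t in Set.Ioc 0 a, P {ω | t < ((M.config ω).distortion Rc).toReal} ≤
      ENNReal.ofReal a := by
    refine (lintegral_mono fun t => prob_le_one).trans ?_
    simp
  have h4 : ∫⁻ t in Set.Ioi a, P {ω | t < ((M.config ω).distortion Rc).toReal} ≤
      ENNReal.ofReal (Real.pi ^ 2 * a ^ 2 / a) := by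
    rw [← lintegral_Ioi_div_sq ha0 (by positivity)]
    exact setLIntegral_mono' measurableSet_Ioi fun t ht => h2 t (ha0.trans ht)
  refine (add_le_add h3 h4).trans ?_
  rw [← ENNReal.ofReal_add ha0.le (by positivity)]
  refine ENNReal.ofReal_le_ofReal (le_of_eq ?_)
  field_simp

variable [NeZero K]

/-- K + 2 exceptional events, each of probability at most 8D: truncated distortion (by Markov), one
near-threshold gain for each of the K users, and a near-threshold CoMP power. Summing over all users
avoids conditioning on which one is selected. -/
lemma measure_decoded_sdiff_le (hRc : 0 < Rc) (hφ : 0 < φ) {s s' : ℝ}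
    (hs : s = 0 ∧ s' = 1 ∨ s = 1 ∧ s' = 0) :
    P (M.config ⁻¹' (Config.decoded s φ ρ ε₀ ε₁ \ Config.decoded s' φ ρ ε₀ ε₁)) ≤
      8 * (K + 2) * ∫⁻ ω, (M.config ω).distortion Rc ∂P := by
  have hDm := (Config.measurable_distortion (K := K) Rc).comp M.measurable_config
  set D := ∫⁻ ω, (M.config ω).distortion Rc ∂P with hD
  let E : Set Ω := {ω | ENNReal.ofReal (1 / 8) ≤ (M.config ω).distortion Rc}
  let A : Fin K → Set Ω := fun k => {ω | (M.config ω).nomaThreshold s φ ρ ε₁ ≤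
      gain (M.h 0 (some (0, k)) ω) ‖(M.config ω).2.1 (0, k)‖ ∧
    gain (M.h 0 (some (0, k)) ω) ‖(M.config ω).2.1 (0, k)‖ <
      ENNReal.ofReal (1 + 8 * ((M.config ω).distortion Rc).toReal) *
        (M.config ω).nomaThreshold s φ ρ ε₁}
  let B : Set Ω := {ω | (M.config ω).compThreshold s ρ ε₀ / ENNReal.ofReal φ ≤
      gain (M.h 0 none ω) ‖(M.config ω).1 0‖ ∧
    gain (M.h 0 none ω) ‖(M.config ω).1 0‖ <
      ENNReal.ofReal (1 + 8 * ((M.config ω).distortion Rc).toReal) *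
        ((M.config ω).compThreshold s ρ ε₀ / ENNReal.ofReal φ)}
  have hE : P E ≤ 8 * D := by
    have h := mul_meas_ge_le_lintegral (μ := P) hDm (ENNReal.ofReal (1 / 8))
    have h8 : (8 : ℝ≥0∞) * ENNReal.ofReal (1 / 8) = 1 := by
      rw [← ENNReal.ofReal_ofNat, ← ENNReal.ofReal_mul (by norm_num)]
      norm_num
    calc P E = 8 * (ENNReal.ofReal (1 / 8) * P E) := by rw [← mul_assoc, h8, one_mul]
      _ ≤ 8 * D := mul_le_mul_right h _
  have hA : ∀ k, P (A k) ≤ 8 * D := fun k =>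
    M.measure_gain_Ico_le (0, some (0, k)) (r := fun θ => ‖θ.2.1 (0, k)‖) (by fun_prop)
      (Config.measurable_nomaThreshold s φ ρ ε₁) (fun θ => by simp [Config.drop]) (fun θ => by
        rw [Config.nomaThreshold, Config.nomaThreshold, Config.interf_drop (by simp)
          (fun j hj l => by simp [hj]) (fun j hj l => by simp [hj])]
        simp [Config.power, Config.drop])
  have hB : P B ≤ 8 * D :=
    M.measure_gain_Ico_le (0, none) (r := fun θ => ‖θ.1 0‖)
      (τ := fun θ => θ.compThreshold s ρ ε₀ / ENNReal.ofReal φ) (by fun_prop)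
      ((Config.measurable_compThreshold s ρ ε₀).div_const _) (fun θ => rfl) (fun θ => by
        rw [Config.compThreshold, Config.compThreshold, Config.interf_drop (by simp)
          (fun j hj l => by simp) (fun j hj l => by simp)])
  have hsub : (M.config ⁻¹' (Config.decoded s φ ρ ε₀ ε₁ \ Config.decoded s' φ ρ ε₀ ε₁) : Set Ω)
      ≤ᵐ[P] (E ∪ ((⋃ k, A k) ∪ B) : Set Ω) := by
    filter_upwards [M.ae_offset] with ω hy hω
    by_cases hωE : ω ∈ E
    · exact Or.inl hωE
    · right
      have hI := Config.interf_le hRc (θ := M.config ω) (fun p => (hy p.1 p.2).2) (not_le.1 hωE)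
      have hI' : (M.config ω).interf s' ≤
          ENNReal.ofReal (1 + 8 * ((M.config ω).distortion Rc).toReal) * (M.config ω).interf s := by
        rcases hs with ⟨rfl, rfl⟩ | ⟨rfl, rfl⟩
        · exact hI.2
        · exact hI.1
      rcases Config.mem_of_mem_decoded (by simp) hI' hω with ⟨k, hk⟩ | hp
      · exact Or.inl (Set.mem_iUnion.2 ⟨k, hk⟩)
      · right
        have hφ0 : ENNReal.ofReal φ ≠ 0 := by positivity
        refine ⟨?_, ?_⟩
        · rw [ENNReal.div_le_iff_le_mul (Or.inl hφ0) (Or.inl ENNReal.ofReal_ne_top), mul_comm]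
          exact hp.1
        · rw [← mul_div_assoc, ENNReal.lt_div_iff_mul_lt (Or.inl hφ0)
            (Or.inl ENNReal.ofReal_ne_top), mul_comm]
          exact hp.2
  calc _ ≤ P (E ∪ ((⋃ k, A k) ∪ B)) := measure_mono_ae hsub
    _ ≤ P E + (∑ k, P (A k) + P B) := by
        refine (measure_union_le _ _).trans (add_le_add le_rfl ?_)
        exact (measure_union_le _ _).trans (add_le_add (measure_iUnion_fintype_le _ _) le_rfl)
    _ ≤ 8 * D + (∑ _k : Fin K, 8 * D + 8 * D) := by
        gcongr with k
        exact hA k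
    _ = 8 * (K + 2) * D := by
        simp only [Finset.sum_const, Finset.card_univ, Fintype.card_fin, nsmul_eq_mul]
        ring

/-- Each one-sided difference of probabilities is at most the probability of a set difference,
bounded in both directions by `measure_decoded_sdiff_le`. -/
theorem abs_outage_sub_outageNoOffset_le (hlam : 0 < lam) (hRc : 0 < Rc) (hφ : 0 < φ)
    (hρ : 0 < ρ) (ε₀ ε₁ : ℝ) :
    |M.outage φ ρ ε₀ ε₁ - M.outageNoOffset φ ρ ε₀ ε₁| ≤
      8 * (K + 2) * (1 + Real.pi ^ 2) * (Rc * √lam) := by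
  rw [outage, outageNoOffset, M.outageWith_eq hlam hρ ε₀ ε₁ M.x 0 (fun ω j => by simp),
    M.outageWith_eq hlam hρ ε₀ ε₁ M.userPos 1 (fun ω j => by rw [one_smul]; rfl), abs_le]
  have key : ∀ s s' : ℝ, (s = 0 ∧ s' = 1 ∨ s = 1 ∧ s' = 0) →
      P.real (M.config ⁻¹' Config.decoded s φ ρ ε₀ ε₁) -
        P.real (M.config ⁻¹' Config.decoded s' φ ρ ε₀ ε₁) ≤
      8 * (K + 2) * (1 + Real.pi ^ 2) * (Rc * √lam) := by
    intro s s' hs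
    have h1 := M.measure_decoded_sdiff_le (ρ := ρ) (ε₀ := ε₀) (ε₁ := ε₁) hRc hφ hs
    have h2 := h1.trans (mul_le_mul_right (M.lintegral_distortion_le hlam hRc) _)
    have h3 : (8 * (K + 2) : ℝ≥0∞) = ENNReal.ofReal (8 * (K + 2)) := by
      rw [ENNReal.ofReal_mul (by norm_num), ENNReal.ofReal_add (by positivity) (by norm_num)]
      simp
    rw [h3, ← ENNReal.ofReal_mul (by positivity)] at h2
    have h4 := ENNReal.toReal_le_of_le_ofReal (by positivity) h2
    rw [mul_assoc]
    refine (le_measureReal_sdiff (measure_ne_top _ _)).trans h4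
  constructor
  · linarith [key 1 0 (Or.inr ⟨rfl, rfl⟩)]
  · linarith [key 0 1 (Or.inl ⟨rfl, rfl⟩)]

end Network

end NNOMA

end

/-! ### The proposition. -/

theorem proposition2 (K : ℕ) (hK : 1 ≤ K) :
    ∃ C : ℝ, ∀ lam Rc φ ρ rate₀ rate₁ : ℝ,
      0 < lam → 0 < Rc → 0 < φ → 0 < ρ → 0 < rate₀ → 0 < rate₁ →
      ∀ ε₀ ε₁ : ℝ, ε₀ = (2 : ℝ) ^ rate₀ - 1 → ε₁ = (2 : ℝ) ^ rate₁ - 1 →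
      (∀ N : ℕ, ∀ k ∈ NNOMA.tuples K N, IntegrableOn
        (NNOMA.integrand lam φ ρ ε₀ ε₁ (NNOMA.muOf Rc N k)) (Set.Ioi 0)) ∧
      ∀ {Ω : Type*} [MeasurableSpace Ω] (P : Measure Ω) [IsProbabilityMeasure P]
        (M : NNOMA.Network K lam Rc P),
        Tendsto (fun N : ℕ => NNOMA.outageFormula K lam Rc φ ρ ε₀ ε₁ N) atTop
          (𝓝 (M.outageNoOffset φ ρ ε₀ ε₁)) ∧
        |M.outage φ ρ ε₀ ε₁ - M.outageNoOffset φ ρ ε₀ ε₁| ≤ C * (Rc * Real.sqrt lam) := by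
  have : NeZero K := ⟨by omega⟩
  -- 8 comes from perturbing the gains (and from the truncation at 1/8), K + 2 counts the
  -- exceptional events, and 1 + π² comes from the mean distortion.
  refine ⟨8 * (K + 2) * (1 + Real.pi ^ 2), fun lam Rc φ ρ rate₀ rate₁ hlam hRc hφ hρ hr₀ hr₁ ε₀ ε₁
    hε₀ hε₁ => ?_⟩
  have h₀ : 0 < ε₀ := by
    rw [hε₀, sub_pos]; exact Real.one_lt_rpow (by norm_num) hr₀
  have h₁ : 0 < ε₁ := by
    rw [hε₁, sub_pos]; exact Real.one_lt_rpow (by norm_num) hr₁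
  refine ⟨fun N k hk => NNOMA.integrableOn_integrand hlam hφ hρ h₀ h₁ (NNOMA.muOf_pos hRc hk),
    fun P _ M => ⟨M.tendsto_outageFormula hlam hRc hφ hρ h₀ h₁, ?_⟩⟩
  exact M.abs_outage_sub_outageNoOffset_le hlam hRc hφ hρ ε₀ ε₁
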